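/- Let $p\ge 5$ be a prime and let $\mathbb C_p$ be the completion of an algebraic closure of $\mathbb Q_p$, with $|p|=1/p$. Fix $\pi\in\mathbb C_p$ with $\pi^{p-1}=-p$, fix $i,\sqrt3\in\mathbb C_p$ with $i^2=-1$, $(\sqrt3)^2=3$, and put $\kappa=\frac{2i}{3\sqrt3}$. For $s\ge1$ let $\theta_s(t)$ be the power series $\exp\pi(t-t^{p^s})$ (evaluated at $t$ as a power series) and $\theta=\theta_1$; let $g_s(j)=-\sum_{t^{p^s-1}=1}t^{-j}\theta_s(t)$ and $g=-g_2\big(\tfrac{p^2-1}{3}\big)$. Fix a real number $b$ with $\frac1{p-1}<b<\frac{p-1}p$ and put $b'=b/p$. *Frobenius.* For $a\in\mathbb C_p$ let $R_a$ be the space of series $\sum_{n\ge0}B_nx^{-n}$ over $\mathbb C_p$ with $\inf_n(\mathrm{ord}_p B_n+bn/3)>-\infty$ that are killed by $D_a^*=-x\frac{\partial}{\partial x}+\mathrm{Trunc}_x\circ\pi(3x^3+ax)$, where $\mathrm{Trunc}_x$ discards the positive powers of $x$; let $R'_a=R_a/\langle1\rangle$, and let $g_1^*(a),g_2^*(a)$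 be the solutions of $D_a^*g=0$ of the form $x^{-1}+O(x^{-3})$ and $x^{-2}+O(x^{-3})$. Let $\alpha_a^*=\mathrm{Trunc}_x\circ\theta(x^3)\theta(ax)\circ(x\mapsto x^p)$. *Solutions near infinity.* Let $v(t)=\sum_{n\ge0}\frac{(1/6)_n(5/6)_n}{(2\kappa\pi)^n\,n!}t^{3n}$, let $\bar v$ be the same series with $-\kappa$ in place of $\kappa$, and put $v_1(a)=v(1/a)$, $v_2(a)=\bar v(1/a)$, $$V(a)=\begin{pmatrix}v_1&v_2\\ \frac1{2\pi}\big[(-\tfrac12a^{-2}+3\kappa\pi a)v_1+a^{-1}v_1'\big]&\frac1{2\pi}\big[(-\tfrac12a^{-2}-3\kappa\pi a)v_2+a^{-1}v_2'\big]\end{pmatrix}.$$ For $1<|z|<p^{b'/3}$ choose, near $z$, an analytic branch of $\sqrt a$ and branches of $e^{\kappa\pi a^3}$ and $e^{\kappa\pi a^{3p}}$ (a branch of $e^{h(a)}$ near $z$ is a nonzero constant times $\exp(h(a)-h(z))$), and put, near $z$, $$\mathcal Y(a)=a^{-1/2}V(a)\,\mathrm{diag}(e^{\kappa\pi a^3},e^{-\kappa\pi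 a^3}),\qquad \mathcal Y^\phi(a)=a^{-p/2}V(a^p)\,\mathrm{diag}(e^{\kappa\pi a^{3p}},e^{-\kappa\pi a^{3p}}).$$ The branches of the exponentials are called compatible if near $z$ $$e^{\kappa\pi a^3}e^{-\kappa\pi a^{3p}}=\theta(\kappa a^3)\exp(\pi(\kappa^p-\kappa)a^{3p})\ \text{ when } p\equiv1,7 \bmod 12,$$ $$e^{\kappa\pi a^3}e^{\kappa\pi a^{3p}}=\theta(\kappa a^3)\exp(\pi(\kappa^p+\kappa)a^{3p})\ \text{ when } p\equiv5,11 \bmod 12.$$ **Theorem.** 1. For $|a|<p^{2b'/3}$, the spaces $R_a$ and $R_{a^p}$ have the bases $1,g_1^*(a),g_2^*(a)$ and $1,g_1^*(a^p),g_2^*(a^p)$; the series defining $\alpha_a^*$ converge on $R_{a^p}$, and $\alpha_a^*$ maps $R_{a^p}$ to $R_a$ and $1$ to $1$. Let $\mathfrak A_a$ be the matrix, acting on columns, of the induced map $R'_{a^p}\to R'_a$ in the bases $g_1^*,g_2^*$. 2. For every $z$ with $1<|z|<p^{b'/3}$ and all branches, $\mathcal Y$ is an analytic fundamental solution matrix near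 $z$ of $\frac{d}{da}C=\begin{pmatrix}0&2\pi a\\-\frac{2\pi a^3}3&0\end{pmatrix}C$, and there is a unique constant matrix $M$ with $\mathfrak A_{a^2}\mathcal Y^\phi=\mathcal YM$ near $z$. It is invertible; it is diagonal if $p\equiv1,7\bmod 12$ and antidiagonal if $p\equiv5,11\bmod12$. 3. If the branches are compatible, then $M$ is one and the same matrix for all such $z$ and all such branches, and it is $$\begin{pmatrix}\mu&0\\0&\mu\end{pmatrix},\ \mu^2=p\quad(p\equiv1\bmod 12);\qquad \begin{pmatrix}\mu&0\\0&-\mu\end{pmatrix},\ \mu^2=-p\quad(p\equiv7\bmod 12);$$ $$\begin{pmatrix}0&\mu\\ \mu&0\end{pmatrix},\ \mu^2=-g\quad(p\equiv5\bmod 12);\qquad \begin{pmatrix}0&\mu\\-\mu&0\end{pmatrix},\ \mu^2=g\quad(p\equiv11\bmod 12).$$ -/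

import Mathlib

open Filter Topology

namespace Airy

noncomputable section

variable (p : ℕ) [Fact p.Prime]

/-- Coefficient of `t ^ n` in the power series `exp (π (t - t ^ q)) = exp (π t) * exp (-π t ^ q)`. -/
def thetaCoeff (π : ℂ_[p]) (q n : ℕ) : ℂ_[p] :=
  ∑ j ∈ Finset.range (n / q + 1),
    (π ^ (n - q * j) / ((n - q * j).factorial : ℂ_[p])) * ((-π) ^ j / (j.factorial : ℂ_[p]))

/-- Dwork's splitting function `θ_s(t) = exp (π (t - t ^ (p ^ s)))`: the value at `t` of the
power series (not the composite of the exponential function with a polynomial). -/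
def theta (π : ℂ_[p]) (s : ℕ) (t : ℂ_[p]) : ℂ_[p] :=
  ∑' n : ℕ, thetaCoeff p π (p ^ s) n * t ^ n

/-- The Gauss sum `g_s(j) = - ∑ t ^ (-j) θ_s(t)`, over the `t` in `ℂ_p` with
`t ^ (p ^ s - 1) = 1`. -/
def gaussSum (π : ℂ_[p]) (s : ℕ) (j : ℤ) : ℂ_[p] :=
  -∑ t ∈ Polynomial.nthRootsFinset (p ^ s - 1) (1 : ℂ_[p]), t ^ (-j) * theta p π s t

/-! ### The dual relative cohomology of `x ^ 3 + a x` and its Frobenius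

A series `∑ B_n x ^ (-n)` is represented by its coefficient sequence `B : ℕ → ℂ_[p]`. -/

/-- The series `∑ B_n x ^ (-n)` with `inf_n (ord B_n + b n / 3) > -∞`. -/
def dualCochain (b : ℝ) : Submodule ℂ_[p] (ℕ → ℂ_[p]) where
  carrier := {B | ∃ C : ℝ, ∀ n : ℕ, ‖B n‖ ≤ C * (p : ℝ) ^ (b * n / 3)}
  zero_mem' := ⟨0, fun n => by simp⟩
  add_mem' := by
    rintro B B' ⟨C, hC⟩ ⟨C', hC'⟩
    refine ⟨C + C', fun n => ?_⟩
    rw [add_mul]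
    exact (norm_add_le _ _).trans (add_le_add (hC n) (hC' n))
  smul_mem' := by
    rintro c B ⟨C, hC⟩
    refine ⟨‖c‖ * C, fun n => ?_⟩
    rw [mul_assoc, Pi.smul_apply, norm_smul]
    exact mul_le_mul_of_nonneg_left (hC n) (norm_nonneg c)

/-- `D_a^* = -x ∂/∂x + Trunc_x [π (3 x ^ 3 + a x)]`, where `Trunc_x` discards the positive
powers of `x`. -/
def dualD (π a : ℂ_[p]) : (ℕ → ℂ_[p]) →ₗ[ℂ_[p]] (ℕ → ℂ_[p]) where
  toFun B n := n * B n + π * (3 * B (n + 3) + a * B (n + 1))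
  map_add' B B' := by
    funext n
    simp only [Pi.add_apply]
    ring
  map_smul' c B := by
    funext n
    simp only [Pi.smul_apply, smul_eq_mul, RingHom.id_apply]
    ring

/-- `R_a`, the kernel of `D_a^*` on the space of dual cochains. -/
def dualKernel (π : ℂ_[p]) (b : ℝ) (a : ℂ_[p]) : Submodule ℂ_[p] (ℕ → ℂ_[p]) :=
  dualCochain p b ⊓ LinearMap.ker (dualD p π a)

/-- The constant series `1`. -/
def oneSeries : ℕ → ℂ_[p] := Pi.single 0 1

/-- Coefficients of the solution of `D_a^* g = 0` with `g = x ^ (-1) + O(x ^ (-3))` (`j = 0`)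
or `g = x ^ (-2) + O(x ^ (-3))` (`j = 1`). -/
def dualBasis (π a : ℂ_[p]) (j : Fin 2) : ℕ → ℂ_[p]
  | 0 => 0
  | 1 => if j = 0 then 1 else 0
  | 2 => if j = 1 then 1 else 0
  | n + 3 => -(n / (3 * π)) * dualBasis π a j n - a / 3 * dualBasis π a j (n + 1)

/-- Coefficient of `x ^ m` in `F(a, x) = θ(x ^ 3) θ(a x)`. -/
def frobKernelCoeff (π a : ℂ_[p]) (m : ℕ) : ℂ_[p] :=
  ∑ i ∈ Finset.range (m / 3 + 1),
    thetaCoeff p π p i * thetaCoeff p π p (m - 3 * i) * a ^ (m - 3 * i)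

/-- `α_a^* = Trunc_x ∘ F(a, x) ∘ (x ↦ x ^ p)`. -/
def dualFrobenius (π a : ℂ_[p]) (B : ℕ → ℂ_[p]) : ℕ → ℂ_[p] := fun n =>
  ∑' r : ℕ, if n ≤ p * r then frobKernelCoeff p π a (p * r - n) * B r else 0

/-- The matrix `𝔄_a` of the map `R'_{a^p} → R'_a` induced by `α_a^*`, where `R'_a = R_a / ⟨1⟩`
has basis `g_1^*(a), g_2^*(a)`, with the column convention. The coordinate with respect to
`g_i^*(a)` is read off as the coefficient of `x ^ (-i)`. -/
def frobMatrix (π a : ℂ_[p]) : Matrix (Fin 2) (Fin 2) ℂ_[p] :=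
  Matrix.of fun i j => dualFrobenius p π a (dualBasis p π (a ^ p) j) (i + 1)

/-- `{1, g_1^*(a), g_2^*(a)}` is a basis of `R_a`, likewise at `a ^ p`, the operator `α_a^*` maps
`R_{a^p}` to `R_a`, and `A` is the matrix of the induced map `R_{a^p} / ⟨1⟩ → R_a / ⟨1⟩`. -/
def IsDualFrobeniusMatrix (π : ℂ_[p]) (b : ℝ) (a : ℂ_[p])
    (A : Matrix (Fin 2) (Fin 2) ℂ_[p]) : Prop :=
  (∀ t ∈ ({a, a ^ p} : Set ℂ_[p]),
    LinearIndependent ℂ_[p] ![oneSeries p, dualBasis p π t 0, dualBasis p π t 1] ∧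
    Submodule.span ℂ_[p] {oneSeries p, dualBasis p π t 0, dualBasis p π t 1} =
      dualKernel p π b t) ∧
  (∀ B ∈ dualKernel p π b (a ^ p),
    (∀ n : ℕ, Summable fun r : ℕ =>
      if n ≤ p * r then frobKernelCoeff p π a (p * r - n) * B r else 0) ∧
    dualFrobenius p π a B ∈ dualKernel p π b a) ∧
  dualFrobenius p π a (oneSeries p) = oneSeries p ∧
  ∀ j : Fin 2, dualFrobenius p π a (dualBasis p π (a ^ p) j) - ∑ i, A i j • dualBasis p π a i ∈
    Submodule.span ℂ_[p] {oneSeries p}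

/-! ### Solutions of the ramified Airy system near infinity -/

/-- The power series `v(t) = ∑ (1/6)_n (5/6)_n / ((2 κ π) ^ n n!) t ^ (3 n)`, with `(c)_n` the
rising factorial. -/
def airyV (κ π t : ℂ_[p]) : ℂ_[p] :=
  ∑' n : ℕ, (ascPochhammer ℂ_[p] n).eval (1 / 6) * (ascPochhammer ℂ_[p] n).eval (5 / 6) /
    ((2 * κ * π) ^ n * (n.factorial : ℂ_[p])) * t ^ (3 * n)

/-- `v(1 / a)`. -/
def airyW (κ π a : ℂ_[p]) : ℂ_[p] := airyV p κ π a⁻¹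

/-- The matrix `V(a)`: first row `v_1 = v(1/a)` and `v_2 = \bar v(1/a)` (`κ` replaced by `-κ`).
The second row is determined by `C_2 = C_1' / (2 π a)` for
`C_1 = a ^ (-1/2) v_1 exp (κ π a ^ 3)`, resp. `C_1 = a ^ (-1/2) v_2 exp (-κ π a ^ 3)`. -/
def airyVMatrix (κ π a : ℂ_[p]) : Matrix (Fin 2) (Fin 2) ℂ_[p] :=
  !![airyW p κ π a, airyW p (-κ) π a;
     (2 * π)⁻¹ * ((-(1 / 2) * (a ^ 2)⁻¹ + 3 * κ * π * a) * airyW p κ π a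
        + a⁻¹ * deriv (airyW p κ π) a),
     (2 * π)⁻¹ * ((-(1 / 2) * (a ^ 2)⁻¹ - 3 * κ * π * a) * airyW p (-κ) π a
        + a⁻¹ * deriv (airyW p (-κ) π) a)]

/-- The coefficient matrix of the Airy system after the change of variable `a ↦ a ^ 2`. -/
def airySystem (π a : ℂ_[p]) : Matrix (Fin 2) (Fin 2) ℂ_[p] :=
  !![0, 2 * π * a; -(2 * π * a ^ 3 / 3), 0]

/-- `s` is a local analytic branch of `√a` at `z`. -/
def IsSqrtBranch (z : ℂ_[p]) (s : ℂ_[p] → ℂ_[p]) : Prop :=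
  AnalyticAt ℂ_[p] s z ∧ ∀ᶠ a in 𝓝 z, s a ^ 2 = a

/-- `e` is a local branch of `exp (h a)` at `z`, that is, a nonzero constant multiple of
`exp (h a - h z)`. The exponential series itself need not converge at `h z`. -/
def IsExpBranch (h : ℂ_[p] → ℂ_[p]) (z : ℂ_[p]) (e : ℂ_[p] → ℂ_[p]) : Prop :=
  ∃ c : ℂ_[p], c ≠ 0 ∧ ∀ᶠ a in 𝓝 z, e a = c * NormedSpace.exp (h a - h z)

/-- `s` is a branch of `√a`, `e` one of `exp (κ π a ^ 3)` and `e'` one of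
`exp (κ π a ^ (3 p))`, all at `z`. -/
def IsBranchData (κ π z : ℂ_[p]) (s e e' : ℂ_[p] → ℂ_[p]) : Prop :=
  IsSqrtBranch p z s ∧
  IsExpBranch p (fun a => κ * π * a ^ 3) z e ∧
  IsExpBranch p (fun a => κ * π * a ^ (3 * p)) z e'

/-- `𝒴(a) = a ^ (-1/2) V(a) S(a)`, `S(a) = diag (exp (κ π a ^ 3), exp (-κ π a ^ 3))`. -/
def airyY (κ π : ℂ_[p]) (s e : ℂ_[p] → ℂ_[p]) (a : ℂ_[p]) : Matrix (Fin 2) (Fin 2) ℂ_[p] :=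
  (s a)⁻¹ • (airyVMatrix p κ π a * Matrix.diagonal ![e a, (e a)⁻¹])

/-- `𝒴^φ(a) = a ^ (-p/2) V(a ^ p) S(a ^ p)`. -/
def airyYFrob (κ π : ℂ_[p]) (s e' : ℂ_[p] → ℂ_[p]) (a : ℂ_[p]) : Matrix (Fin 2) (Fin 2) ℂ_[p] :=
  (s a ^ p)⁻¹ • (airyVMatrix p κ π (a ^ p) * Matrix.diagonal ![e' a, (e' a)⁻¹])

/-- `𝒴` is, near `z`, an analytic fundamental solution matrix of the Airy system in the ramified
variable. -/
def IsFundamentalSolutionAt (π z : ℂ_[p]) (Y : ℂ_[p] → Matrix (Fin 2) (Fin 2) ℂ_[p]) : Prop :=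
  (∀ i j, AnalyticAt ℂ_[p] (fun x => Y x i j) z) ∧
  ∀ᶠ a in 𝓝 z,
    (∀ i j, HasDerivAt (fun x => Y x i j) ((airySystem p π a * Y a) i j) a) ∧ (Y a).det ≠ 0

/-- The relation `𝔄_{a^2} 𝒴^φ = 𝒴 M` near `z`. -/
def FrobRelation (κ π z : ℂ_[p]) (s e e' : ℂ_[p] → ℂ_[p])
    (M : Matrix (Fin 2) (Fin 2) ℂ_[p]) : Prop :=
  ∀ᶠ a in 𝓝 z, frobMatrix p π (a ^ 2) * airyYFrob p κ π s e' a = airyY p κ π s e a * M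

/-- The branches of `exp (κ π a ^ 3)` and `exp (κ π a ^ (3 p))` are compatible:
`exp (κ π a ^ 3) exp (-κ π a ^ (3 p)) = θ(κ a ^ 3) exp (π (κ ^ p - κ) a ^ (3 p))` if
`p ≡ 1, 7 mod 12`, and
`exp (κ π a ^ 3) exp (κ π a ^ (3 p)) = θ(κ a ^ 3) exp (π (κ ^ p + κ) a ^ (3 p))` otherwise. -/
def IsCompatible (κ π z : ℂ_[p]) (e e' : ℂ_[p] → ℂ_[p]) : Prop :=
  ((p % 12 = 1 ∨ p % 12 = 7) → ∀ᶠ a in 𝓝 z, e a * (e' a)⁻¹ =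
    theta p π 1 (κ * a ^ 3) * NormedSpace.exp (π * (κ ^ p - κ) * a ^ (3 * p))) ∧
  ((p % 12 = 5 ∨ p % 12 = 11) → ∀ᶠ a in 𝓝 z, e a * e' a =
    theta p π 1 (κ * a ^ 3) * NormedSpace.exp (π * (κ ^ p + κ) * a ^ (3 * p)))

end

end Airy

/-!
The matrix `M` is `𝒴(a)⁻¹ 𝔄_{a²} 𝒴^φ(a)`. It is locally constant because the Frobenius matrix is
horizontal for the Airy system, and the point is that it is the same constant, of the given shape,
on the whole annulus. Neither follows from local arguments, since the annulus is not connected in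
the metric topology; Laurent series on the annulus take the place of analytic continuation.

*The Frobenius matrix.* The coefficients of `θ` satisfy Dwork's estimate `norm_thetaCoeff_le`, which
comes from the integrality of the truncated Artin-Hasse exponential. It makes `α_a^*` converge on
the growth space, and the differential equation of the kernel `θ(x³) θ(a x)` in `x` gives
`D_a^* ∘ α_a^* = p α_a^* ∘ D_{a^p}^*` (`dualD_dualFrobenius`). Solutions of `D_a^* B = 0` are given
by a recursion whose free parameters are the first three coefficients, hence the bases and the
matrix `𝔄_a` (`isDualFrobeniusMatrix_frobMatrix`). The differential equation of the kernel in `a`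
gives `𝔄' = N 𝔄 - p a^(p-1) 𝔄 N(a^p)` (`hasDerivAt_frobMatrix`). As `N` has trace zero, `det 𝔄` is
constant. At `a = 0` one or the other diagonal of `𝔄` vanishes, and the product of the two remaining
entries, which are `p`-adic analogues of values of the gamma function at `1/3` and `2/3`, is found
by `p`-adic approximation from Wilson's theorem (`frobSum_third_mul`). So `det 𝔄 = p`.

*The annulus.* With `𝒴 = a^(-1/2) V diag(e, e⁻¹)`, a Wronskian argument gives `det V = -3 κ a`
(`airy_wronskian`). Therefore the entries of `V(a)⁻¹ 𝔄_{a²} V(a^p)`, up to constants and a power of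
`a` the functions `normPairing π (±κ) (±κ)`, have Laurent expansions on `1 < |a| < p^(b'/3)`, and
each solves a rank one equation (`hasDerivAt_normPairing`) with formal solution
`exp(-π (κ₁ a³ + κ₂ a^(3p)))`. If `κ₁^p + κ₂` is divisible by `p`, the inverse `airyE` of this
exponential converges on the annulus, and the entry is a constant times `airyE⁻¹`
(`exists_normPairing_eq`). Exactly one sign of `κ₂` has this property: `κ^p ≡ κ` or `κ^p ≡ -κ`
according as `-3` is a square modulo `p` or not (`norm_kappa_pow_sub_le`). With the other sign, a
twist by `airyE` leads to `a K' = c p a^(3p) K`, `|c| = |π|`, which has no nonzero Laurent solution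
on the annulus (`eq_zero_of_laurent_recurrence`). Hence the entry vanishes, and `M` is diagonal or
antidiagonal according to `p mod 3`.

*The constant.* The substitution `a ↦ -a` exchanges `κ` and `-κ`, which expresses one of the two
nonzero entries of `M` through the other (`normPairing_neg`); compatibility of the branches says
precisely that the exponentials cancel `airyE⁻¹`. The determinant then gives `μ² = ± p`
(`exists_connection_eq_diagonal`, `exists_connection_eq_antidiagonal`), with a sign depending on
`p mod 4`. For `p ≡ 2 mod 3` the Gauss sum `g` is equal to `p` by Stickelberger's evaluation
(`gaussSum_cubic`).
-/

namespace Airy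

/-! ### Convergent power series and Laurent series over an ultrametric field -/

section NonarchimedeanSeries

variable {K : Type*} [NontriviallyNormedField K]

/-- `f` is, on `‖a‖ < R`, the sum of the power series with coefficients `c`, which converges
there. Convergence is encoded by boundedness of `‖c n‖ * ρ ^ n` for every `ρ < R`. -/
def HasPowerSeriesOn (f : K → K) (c : ℕ → K) (R : ℝ) : Prop :=
  (∀ ρ : ℝ, 0 < ρ → ρ < R → ∃ C : ℝ, ∀ n : ℕ, ‖c n‖ * ρ ^ n ≤ C) ∧
    ∀ a : K, ‖a‖ < R → HasSum (fun n : ℕ => c n * a ^ n) (f a)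

/-- `f` is, on the annulus `1 < ‖a‖ < R`, the sum of the Laurent series with coefficients `c`,
which converges there. -/
def HasLaurentSeriesOn (f : K → K) (c : ℤ → K) (R : ℝ) : Prop :=
  (∀ ρ : ℝ, 1 < ρ → ρ < R → ∃ C : ℝ, ∀ n : ℤ, ‖c n‖ * ρ ^ n ≤ C) ∧
    ∀ a : K, 1 < ‖a‖ → ‖a‖ < R → HasSum (fun n : ℤ => c n * a ^ n) (f a)

/-- `f` has a convergent Laurent expansion on the annulus `1 < ‖a‖ < R`. -/
def IsLaurentOn (f : K → K) (R : ℝ) : Prop := ∃ c, HasLaurentSeriesOn f c R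

theorem summable_norm_of_forall_bound {c : ℕ → K} {R : ℝ}
    (h : ∀ ρ : ℝ, 0 < ρ → ρ < R → ∃ C : ℝ, ∀ n : ℕ, ‖c n‖ * ρ ^ n ≤ C) {a : K} (ha : ‖a‖ < R) :
    Summable fun n => ‖c n * a ^ n‖ := by
  obtain ⟨ρ, h1, h2⟩ := exists_between ha
  have hρ : 0 < ρ := (norm_nonneg a).trans_lt h1
  obtain ⟨C, hC⟩ := h ρ hρ h2
  refine Summable.of_nonneg_of_le (fun n => norm_nonneg _) (fun n => ?_)
    ((summable_geometric_of_lt_one (by positivity) ((div_lt_one hρ).2 h1)).mul_left C)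
  rw [norm_mul, norm_pow, div_pow, mul_div_assoc', le_div_iff₀ (by positivity)]
  calc _ = (‖c n‖ * ρ ^ n) * ‖a‖ ^ n := by ring
    _ ≤ _ := by gcongr; exact hC n

theorem summable_norm_of_forall_laurent_bound {c : ℤ → K} {R : ℝ}
    (h : ∀ ρ : ℝ, 1 < ρ → ρ < R → ∃ C : ℝ, ∀ n : ℤ, ‖c n‖ * ρ ^ n ≤ C) {a : K} (ha : 1 < ‖a‖)
    (haR : ‖a‖ < R) : Summable fun n : ℤ => ‖c n * a ^ n‖ := by
  have hpos : 0 < ‖a‖ := one_pos.trans ha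
  obtain ⟨ρ, h1, h2⟩ := exists_between haR
  obtain ⟨ρ', h1', h2'⟩ := exists_between ha
  obtain ⟨C, hC⟩ := h ρ (ha.trans h1) h2
  obtain ⟨C', hC'⟩ := h ρ' h1' (h2'.trans haR)
  have hρ : 0 < ρ := hpos.trans h1
  have hρ' : 0 < ρ' := one_pos.trans h1'
  refine Summable.of_nat_of_neg ?_ ?_
  · refine Summable.of_nonneg_of_le (fun n => norm_nonneg _) (fun n => ?_)
      ((summable_geometric_of_lt_one (by positivity) ((div_lt_one hρ).2 h1)).mul_left C)
    rw [norm_mul, norm_zpow, div_pow, mul_div_assoc', le_div_iff₀ (by positivity), zpow_natCast]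
    calc _ = (‖c n‖ * ρ ^ (n : ℤ)) * ‖a‖ ^ n := by rw [zpow_natCast]; ring
      _ ≤ _ := by gcongr; exact hC n
  · refine Summable.of_nonneg_of_le (fun n => norm_nonneg _) (fun n => ?_)
      ((summable_geometric_of_lt_one (by positivity) ((div_lt_one hpos).2 h2')).mul_left C')
    rw [norm_mul, norm_zpow, div_pow, mul_div_assoc', zpow_neg, zpow_natCast, ← div_eq_mul_inv]
    gcongr
    have := hC' (-n)
    rwa [zpow_neg, zpow_natCast, ← div_eq_mul_inv, div_le_iff₀ (by positivity)] at this

theorem HasPowerSeriesOn.apply_zero {f : K → K} {c : ℕ → K} {R : ℝ}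
    (hf : HasPowerSeriesOn f c R) (hR : 0 < R) : f 0 = c 0 := by
  refine (hf.2 0 (by simpa using hR)).unique ?_
  convert hasSum_ite_eq (0 : ℕ) (c 0) using 2 with n
  split_ifs with h <;> simp [h]

theorem HasPowerSeriesOn.of_bound [CompleteSpace K] {c : ℕ → K} {R : ℝ}
    (h : ∀ ρ : ℝ, 0 < ρ → ρ < R → ∃ C : ℝ, ∀ n : ℕ, ‖c n‖ * ρ ^ n ≤ C) :
    HasPowerSeriesOn (fun a => ∑' n, c n * a ^ n) c R :=
  ⟨h, fun _ ha => (summable_norm_of_forall_bound h ha).of_norm.hasSum⟩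

theorem HasPowerSeriesOn.hasFPowerSeriesOnBall {f : K → K} {c : ℕ → K} {R : ℝ}
    (hf : HasPowerSeriesOn f c R) {ρ : NNReal} (h1 : 0 < ρ) (h2 : ρ < R) :
    HasFPowerSeriesOnBall f (FormalMultilinearSeries.ofScalars K c) 0 ρ := by
  obtain ⟨C, hC⟩ := hf.1 ρ h1 h2
  refine ⟨?_, by exact_mod_cast h1, fun {y} hy => ?_⟩
  · refine FormalMultilinearSeries.le_radius_of_bound _ C fun n => ?_
    simpa using hC n
  · rw [zero_add]
    have hy' : ‖y‖ < ρ := by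
      simpa [← enorm_eq_nnnorm, edist_zero_right, Metric.mem_eball, ← NNReal.coe_lt_coe]
        using hy
    simpa [FormalMultilinearSeries.ofScalars_apply_eq, smul_eq_mul, mul_comm] using
      hf.2 y (hy'.trans h2)

theorem HasPowerSeriesOn.analyticAt [CompleteSpace K] {f : K → K} {c : ℕ → K} {R : ℝ} (hf : HasPowerSeriesOn f c R)
    {a : K} (ha : ‖a‖ < R) : AnalyticAt K f a := by
  obtain ⟨ρ, h1, h2⟩ := exists_between ha
  have hρ : 0 < ρ := (norm_nonneg a).trans_lt h1
  lift ρ to NNReal using hρ.le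
  refine (hf.hasFPowerSeriesOnBall (by exact_mod_cast hρ) h2).analyticAt_of_mem ?_
  simpa [← enorm_eq_nnnorm, edist_zero_right, Metric.mem_eball, ← NNReal.coe_lt_coe] using h1

theorem HasPowerSeriesOn.differentiableAt [CompleteSpace K] {f : K → K} {c : ℕ → K} {R : ℝ}
    (hf : HasPowerSeriesOn f c R) {a : K} (ha : ‖a‖ < R) : DifferentiableAt K f a :=
  (hf.analyticAt ha).differentiableAt

variable [IsUltrametricDist K]

/-- The second-order remainder of `t ↦ t ^ n` is bounded by `‖h‖ ^ 2 ρ ^ (n - 2)`, without the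
binomial factor present over the reals. -/
theorem norm_add_pow_sub_le (a h : K) {ρ : ℝ} (ha : ‖a‖ ≤ ρ) (hh : ‖h‖ ≤ ρ) (n : ℕ) :
    ρ ^ 2 * ‖(a + h) ^ n - a ^ n - n * a ^ (n - 1) * h‖ ≤ ‖h‖ ^ 2 * ρ ^ n := by
  have hρ : 0 ≤ ρ := (norm_nonneg a).trans ha
  induction n with
  | zero => simp
  | succ n ih =>
    have key : (a + h) ^ (n + 1) - a ^ (n + 1) - ((n + 1 : ℕ) : K) * a ^ (n + 1 - 1) * h
        = (a + h) * ((a + h) ^ n - a ^ n - n * a ^ (n - 1) * h) + n * a ^ (n - 1) * h ^ 2 := by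
      rcases n with _ | n
      · simp
      · simp only [Nat.add_sub_cancel]; push_cast; ring
    rw [key]
    have hah : ‖a + h‖ ≤ ρ := (IsUltrametricDist.norm_add_le_max a h).trans (max_le ha hh)
    have h1 : ρ ^ 2 * ‖(a + h) * ((a + h) ^ n - a ^ n - n * a ^ (n - 1) * h)‖
        ≤ ‖h‖ ^ 2 * ρ ^ (n + 1) := by
      rw [norm_mul]
      calc _ = ‖a + h‖ * (ρ ^ 2 * ‖(a + h) ^ n - a ^ n - n * a ^ (n - 1) * h‖) := by ring
        _ ≤ ρ * (‖h‖ ^ 2 * ρ ^ n) := by gcongr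
        _ = _ := by ring
    have h2 : ρ ^ 2 * ‖(n : K) * a ^ (n - 1) * h ^ 2‖ ≤ ‖h‖ ^ 2 * ρ ^ (n + 1) := by
      rcases n with _ | n
      · simp; positivity
      · rw [norm_mul, norm_mul, norm_pow, norm_pow, Nat.add_sub_cancel]
        calc _ ≤ ρ ^ 2 * (1 * ρ ^ n * ‖h‖ ^ 2) := by
              gcongr; exact IsUltrametricDist.norm_natCast_le_one K _
          _ = _ := by ring
    calc _ ≤ ρ ^ 2 * max _ _ := by gcongr; exact IsUltrametricDist.norm_add_le_max _ _
      _ = max _ _ := mul_max_of_nonneg _ _ (by positivity)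
      _ ≤ _ := max_le h1 h2

variable [CompleteSpace K]

theorem HasPowerSeriesOn.hasDerivAt_tsum {f : K → K} {c : ℕ → K} {R : ℝ}
    (hf : HasPowerSeriesOn f c R) {a : K} (ha : ‖a‖ < R) :
    HasDerivAt f (∑' n : ℕ, n * c n * a ^ (n - 1)) a := by
  obtain ⟨ρ, h1, h2⟩ := exists_between ha
  have hρ : 0 < ρ := (norm_nonneg a).trans_lt h1
  obtain ⟨C, hC⟩ := hf.1 ρ hρ h2
  have hsum : Summable fun n : ℕ => n * c n * a ^ (n - 1) := by
    refine Summable.of_norm ((summable_nat_add_iff 1).1 ?_)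
    refine summable_norm_of_forall_bound (c := fun n => ((n + 1 : ℕ) : K) * c (n + 1)) (R := R)
      (fun σ hσ hσR => ?_) ha
    obtain ⟨D, hD⟩ := hf.1 σ hσ hσR
    refine ⟨D / σ, fun n => ?_⟩
    rw [le_div_iff₀ hσ, norm_mul]
    calc _ ≤ 1 * ‖c (n + 1)‖ * σ ^ n * σ := by
          gcongr; exact IsUltrametricDist.norm_natCast_le_one K _
      _ = ‖c (n + 1)‖ * σ ^ (n + 1) := by ring
      _ ≤ D := hD _
  rw [hasDerivAt_iff_isLittleO_nhds_zero]
  refine Asymptotics.IsBigO.trans_isLittleO (g := fun h : K => h ^ 2) ?_ ?_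
  · refine Asymptotics.IsBigO.of_bound (C / ρ ^ 2) ?_
    filter_upwards [Metric.ball_mem_nhds (0 : K) hρ] with h hh
    rw [mem_ball_zero_iff] at hh
    have hah : ‖a + h‖ < R :=
      ((IsUltrametricDist.norm_add_le_max a h).trans_lt (max_lt h1 hh)).trans h2
    have hs := ((hf.2 _ hah).sub (hf.2 _ ha)).sub (hsum.hasSum.mul_right h)
    have C0 : 0 ≤ C := (by positivity : 0 ≤ ‖c 0‖ * ρ ^ 0).trans (hC 0)
    rw [smul_eq_mul, mul_comm h, ← hs.tsum_eq]
    refine IsUltrametricDist.norm_tsum_le_of_forall_le_of_nonneg (by positivity) fun n => ?_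
    have := norm_add_pow_sub_le a h h1.le hh.le n
    rw [show c n * (a + h) ^ n - c n * a ^ n - n * c n * a ^ (n - 1) * h
      = c n * ((a + h) ^ n - a ^ n - n * a ^ (n - 1) * h) by ring, norm_mul, norm_pow,
      div_mul_eq_mul_div, le_div_iff₀ (by positivity)]
    calc _ = ‖c n‖ * (ρ ^ 2 * ‖(a + h) ^ n - a ^ n - n * a ^ (n - 1) * h‖) := by ring
      _ ≤ ‖c n‖ * (‖h‖ ^ 2 * ρ ^ n) := by gcongr
      _ = (‖c n‖ * ρ ^ n) * ‖h‖ ^ 2 := by ring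
      _ ≤ _ := by gcongr; exact hC n
  · exact Asymptotics.isLittleO_pow_id one_lt_two

theorem HasPowerSeriesOn.deriv {f : K → K} {c : ℕ → K} {R : ℝ} (hf : HasPowerSeriesOn f c R) :
    HasPowerSeriesOn (deriv f) (fun n => ((n + 1 : ℕ) : K) * c (n + 1)) R := by
  have hb : ∀ σ : ℝ, 0 < σ → σ < R →
      ∃ C : ℝ, ∀ n : ℕ, ‖((n + 1 : ℕ) : K) * c (n + 1)‖ * σ ^ n ≤ C := by
    intro σ hσ hσR
    obtain ⟨D, hD⟩ := hf.1 σ hσ hσR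
    refine ⟨D / σ, fun n => ?_⟩
    rw [le_div_iff₀ hσ, norm_mul]
    calc _ ≤ 1 * ‖c (n + 1)‖ * σ ^ n * σ := by
          gcongr; exact IsUltrametricDist.norm_natCast_le_one K _
      _ = ‖c (n + 1)‖ * σ ^ (n + 1) := by ring
      _ ≤ D := hD _
  refine ⟨hb, fun a ha => ?_⟩
  rw [(hf.hasDerivAt_tsum ha).deriv]
  have h := (summable_norm_of_forall_bound hb ha).of_norm
  have h2 : Summable fun n : ℕ => (n : K) * c n * a ^ (n - 1) :=
    (summable_nat_add_iff 1).1 h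
  rw [h2.tsum_eq_zero_add]
  simpa using h.hasSum

/-- A function with vanishing derivative, given by a convergent power series on a disc, is
constant on that disc. -/
theorem eq_of_deriv_eq_zero [CharZero K] {f : K → K} {c : ℕ → K} {R : ℝ}
    (hf : HasPowerSeriesOn f c R) (h : ∀ a : K, a ≠ 0 → ‖a‖ < R → deriv f a = 0) {a : K}
    (ha : ‖a‖ < R) : f a = f 0 := by
  have hR : 0 < R := (norm_nonneg a).trans_lt ha
  have h0 : _root_.deriv f =ᶠ[𝓝[≠] 0] fun _ => 0 := by
    have : ∀ᶠ x in 𝓝[≠] (0 : K), ‖x‖ < R :=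
      nhdsWithin_le_nhds ((continuous_norm.tendsto' 0 0 norm_zero).eventually (gt_mem_nhds hR))
    filter_upwards [this, self_mem_nhdsWithin] with x hx hx0 using h x hx0 hx
  have han := hf.deriv.analyticAt (a := 0) (by simpa using hR)
  have h1 := (han.frequently_eq_iff_eventually_eq analyticAt_const).1 h0.frequently
  have han' : AnalyticAt K f 0 := hf.analyticAt (by simpa using hR)
  have hc : ∀ n, c (n + 1) = 0 := by
    have hs := hf.deriv
    obtain ⟨ρ, h1', h2'⟩ := exists_between hR
    lift ρ to NNReal using h1'.le
    have hps := hs.hasFPowerSeriesOnBall (by exact_mod_cast h1') h2'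
    have hz := hps.hasFPowerSeriesAt.congr h1
    intro n
    have this : (FormalMultilinearSeries.ofScalars K
        (fun n => ((n + 1 : ℕ) : K) * c (n + 1))).coeff n = 0 := by
      rw [hz.eq_zero]
      rfl
    rw [FormalMultilinearSeries.coeff_ofScalars] at this
    have hne : ((n + 1 : ℕ) : K) ≠ 0 := by exact_mod_cast n.succ_ne_zero
    exact (mul_eq_zero.1 this).resolve_left hne
  rw [hf.apply_zero hR]
  refine (hf.2 a ha).unique ?_
  convert hasSum_ite_eq (0 : ℕ) (c 0) using 2 with n
  rcases n with _ | n <;> simp [hc]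

end NonarchimedeanSeries


section LaurentSeries

variable {K : Type*} [NontriviallyNormedField K]

theorem HasLaurentSeriesOn.sub {f g : K → K} {c d : ℤ → K} {R : ℝ} [IsUltrametricDist K]
    (hf : HasLaurentSeriesOn f c R) (hg : HasLaurentSeriesOn g d R) :
    HasLaurentSeriesOn (fun a => f a - g a) (fun n => c n - d n) R := by
  refine ⟨fun ρ h1 h2 => ?_, fun a h1 h2 => ?_⟩
  · obtain ⟨C, hC⟩ := hf.1 ρ h1 h2
    obtain ⟨D, hD⟩ := hg.1 ρ h1 h2
    have hρ : 0 < ρ := one_pos.trans h1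
    refine ⟨max C D, fun n => ?_⟩
    have := IsUltrametricDist.norm_add_le_max (c n) (-d n)
    rw [norm_neg, ← sub_eq_add_neg] at this
    calc _ ≤ max ‖c n‖ ‖d n‖ * ρ ^ n := by gcongr
      _ = max (‖c n‖ * ρ ^ n) (‖d n‖ * ρ ^ n) := max_mul_of_nonneg _ _ (by positivity)
      _ ≤ _ := max_le_max (hC n) (hD n)
  · simpa only [sub_mul] using (hf.2 a h1 h2).sub (hg.2 a h1 h2)

theorem HasLaurentSeriesOn.congr {f g : K → K} {c : ℤ → K} {R : ℝ}
    (hf : HasLaurentSeriesOn f c R) (h : ∀ a, 1 < ‖a‖ → ‖a‖ < R → f a = g a) :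
    HasLaurentSeriesOn g c R :=
  ⟨hf.1, fun a h1 h2 => by rw [← h a h1 h2]; exact hf.2 a h1 h2⟩

theorem IsLaurentOn.congr {f g : K → K} {R : ℝ}
    (hf : IsLaurentOn f R) (h : ∀ a, 1 < ‖a‖ → ‖a‖ < R → f a = g a) : IsLaurentOn g R := by
  obtain ⟨c, hc⟩ := hf
  exact ⟨c, hc.congr h⟩

theorem HasLaurentSeriesOn.zpow_mul {f : K → K} {c : ℤ → K} {R : ℝ} (m : ℤ) (k : K)
    (hf : HasLaurentSeriesOn f c R) :
    HasLaurentSeriesOn (fun a => k * a ^ m * f a) (fun n => k * c (n - m)) R := by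
  refine ⟨fun ρ h1 h2 => ?_, fun a h1 h2 => ?_⟩
  · obtain ⟨C, hC⟩ := hf.1 ρ h1 h2
    have hρ : 0 < ρ := one_pos.trans h1
    refine ⟨‖k‖ * ρ ^ m * C, fun n => ?_⟩
    have := hC (n - m)
    rw [norm_mul]
    calc _ = ‖k‖ * ρ ^ m * (‖c (n - m)‖ * ρ ^ (n - m)) := by
          rw [zpow_sub₀ hρ.ne']; field_simp
      _ ≤ _ := by gcongr
  · have ha : a ≠ 0 := norm_pos_iff.1 (one_pos.trans h1)
    have h := ((Equiv.subRight m).hasSum_iff).2 ((hf.2 a h1 h2).mul_left (k * a ^ m))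
    refine h.congr_fun fun n => ?_
    simp only [Function.comp_apply, Equiv.subRight_apply]
    rw [zpow_sub₀ ha]
    field_simp

theorem IsLaurentOn.zpow_mul {f : K → K} {R : ℝ} (m : ℤ) (k : K)
    (hf : IsLaurentOn f R) : IsLaurentOn (fun a => k * a ^ m * f a) R := by
  obtain ⟨c, hc⟩ := hf
  exact ⟨_, hc.zpow_mul m k⟩

theorem IsLaurentOn.const_mul {f : K → K} {R : ℝ} (k : K)
    (hf : IsLaurentOn f R) : IsLaurentOn (fun a => k * f a) R := by
  simpa using hf.zpow_mul 0 k

/-- Substituting `l * a ^ m`, with `m` a nonzero integer, in a power series gives a Laurent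
series. -/
theorem HasPowerSeriesOn.isLaurentOn_comp {f : K → K} {c : ℕ → K} {S : ℝ}
    (hf : HasPowerSeriesOn f c S) {R : ℝ} (l : K) {m : ℤ} (hm : m ≠ 0)
    (h : ∀ ρ : ℝ, 1 < ρ → ρ < R → ‖l‖ * ρ ^ m < S) :
    IsLaurentOn (fun a => f (l * a ^ m)) R := by
  have hinj : Function.Injective fun k : ℕ => m * (k : ℤ) := fun a b hab => by
    simpa [hm] using hab
  refine ⟨Function.extend (fun k : ℕ => m * (k : ℤ)) (fun k => c k * l ^ k) 0,
    fun ρ h1 h2 => ?_, fun a h1 h2 => ?_⟩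
  · have hρ : 0 < ρ := one_pos.trans h1
    obtain ⟨σ, hσ1, hσ2⟩ := exists_between (h ρ h1 h2)
    have hσ : 0 < σ := (by positivity : 0 ≤ ‖l‖ * ρ ^ m).trans_lt hσ1
    obtain ⟨C, hC⟩ := hf.1 σ hσ hσ2
    have C0 : 0 ≤ C := (by positivity : 0 ≤ ‖c 0‖ * σ ^ 0).trans (hC 0)
    refine ⟨C, fun n => ?_⟩
    by_cases hn : ∃ k : ℕ, m * (k : ℤ) = n
    · obtain ⟨k, rfl⟩ := hn
      rw [hinj.extend_apply, norm_mul, norm_pow, zpow_mul, zpow_natCast]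
      calc _ = ‖c k‖ * (‖l‖ * ρ ^ m) ^ k := by rw [mul_pow]; ring
        _ ≤ ‖c k‖ * σ ^ k := by gcongr
        _ ≤ C := hC k
    · rw [Function.extend_apply' _ _ _ hn]
      simpa using C0
  · have hs := hf.2 (l * a ^ m) (by rw [norm_mul, norm_zpow]; exact h _ h1 h2)
    rw [← hinj.hasSum_iff (fun n hn => by
      rw [Function.extend_apply' _ _ _ (by simpa using hn)]; simp)]
    refine hs.congr_fun fun k => ?_
    simp only [Function.comp_apply]
    rw [hinj.extend_apply, mul_pow, zpow_mul, zpow_natCast]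
    ring

variable [IsUltrametricDist K]

theorem IsLaurentOn.sub {f g : K → K} {R : ℝ}
    (hf : IsLaurentOn f R) (hg : IsLaurentOn g R) : IsLaurentOn (fun a => f a - g a) R := by
  obtain ⟨c, hc⟩ := hf
  obtain ⟨d, hd⟩ := hg
  exact ⟨_, hc.sub hd⟩

theorem IsLaurentOn.add {f g : K → K} {R : ℝ}
    (hf : IsLaurentOn f R) (hg : IsLaurentOn g R) : IsLaurentOn (fun a => f a + g a) R := by
  simpa using hf.sub (hg.const_mul (-1))

variable [CompleteSpace K]

theorem IsLaurentOn.mul {f g : K → K} {R : ℝ}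
    (hf : IsLaurentOn f R) (hg : IsLaurentOn g R) : IsLaurentOn (fun a => f a * g a) R := by
  obtain ⟨c, hc⟩ := hf
  obtain ⟨d, hd⟩ := hg
  refine ⟨fun n => ∑' k, c k * d (n - k), fun ρ h1 h2 => ?_, fun a h1 h2 => ?_⟩
  · obtain ⟨C, hC⟩ := hc.1 ρ h1 h2
    obtain ⟨D, hD⟩ := hd.1 ρ h1 h2
    have hρ : 0 < ρ := one_pos.trans h1
    have C0 : 0 ≤ C := (by positivity : 0 ≤ ‖c 0‖ * ρ ^ (0 : ℤ)).trans (hC 0)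
    have D0 : 0 ≤ D := (by positivity : 0 ≤ ‖d 0‖ * ρ ^ (0 : ℤ)).trans (hD 0)
    refine ⟨C * D, fun n => ?_⟩
    rw [← le_div_iff₀ (by positivity)]
    refine IsUltrametricDist.norm_tsum_le_of_forall_le_of_nonneg (by positivity) fun k => ?_
    rw [norm_mul, le_div_iff₀ (by positivity)]
    calc _ = (‖c k‖ * ρ ^ k) * (‖d (n - k)‖ * ρ ^ (n - k)) := by
          rw [zpow_sub₀ hρ.ne']; field_simp
      _ ≤ _ := by gcongr; exacts [hC k, hD _]
  · have ha : a ≠ 0 := norm_pos_iff.1 (one_pos.trans h1)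
    have hs1 := summable_norm_of_forall_laurent_bound hc.1 h1 h2
    have hs2 := summable_norm_of_forall_laurent_bound hd.1 h1 h2
    have hsm : Summable fun x : ℤ × ℤ => (c x.1 * a ^ x.1) * (d x.2 * a ^ x.2) :=
      summable_mul_of_summable_norm (f := fun n : ℤ => c n * a ^ n)
        (g := fun n : ℤ => d n * a ^ n) hs1 hs2
    have hs := (hc.2 a h1 h2).mul (hd.2 a h1 h2) hsm
    let e : ℤ × ℤ ≃ ℤ × ℤ :=
      { toFun := fun x => (x.2, x.1 - x.2)
        invFun := fun x => (x.1 + x.2, x.1)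
        left_inv := fun x => by ext <;> simp
        right_inv := fun x => by ext <;> simp }
    have hs' := e.hasSum_iff.2 hs
    have hsum := hs'.summable
    refine (hs'.prod_fiberwise fun n => (hsum.prod_factor n).hasSum).congr_fun fun n => ?_
    rw [← tsum_mul_right]
    refine tsum_congr fun k => ?_
    simp only [Function.comp_apply, e, Equiv.coe_fn_mk]
    rw [zpow_sub₀ ha]
    field_simp

/-- A Laurent series is the sum of a power series in `a` and a power series in `a⁻¹`. -/
theorem HasLaurentSeriesOn.exists_decomp {f : K → K} {c : ℤ → K} {R : ℝ}
    (hf : HasLaurentSeriesOn f c R) (hR : 1 < R) : ∃ g h : K → K,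
      HasPowerSeriesOn g (fun n => c n) R ∧
      HasPowerSeriesOn h (fun n => if n = 0 then 0 else c (-n)) 1 ∧
      ∀ a, 1 < ‖a‖ → ‖a‖ < R → f a = g a + h a⁻¹ := by
  have hb1 : ∀ ρ : ℝ, 0 < ρ → ρ < R → ∃ C : ℝ, ∀ n : ℕ, ‖c n‖ * ρ ^ n ≤ C := by
    intro ρ h1 h2
    obtain ⟨σ, hσ1, hσ2⟩ := exists_between (max_lt h2 hR)
    obtain ⟨C, hC⟩ := hf.1 σ ((le_max_right _ _).trans_lt hσ1) hσ2
    refine ⟨C, fun n => le_trans ?_ (hC n)⟩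
    rw [zpow_natCast]
    gcongr
    exact ((le_max_left _ _).trans_lt hσ1).le
  have hb2 : ∀ ρ : ℝ, 0 < ρ → ρ < 1 →
      ∃ C : ℝ, ∀ n : ℕ, ‖if n = 0 then 0 else c (-n)‖ * ρ ^ n ≤ C := by
    intro ρ h1 h2
    obtain ⟨σ, hσ1, hσ2⟩ := exists_between (lt_min hR (one_lt_inv_iff₀.2 ⟨h1, h2⟩))
    obtain ⟨C, hC⟩ := hf.1 σ hσ1 (hσ2.trans_le (min_le_left _ _))
    have hσ : 0 < σ := one_pos.trans hσ1
    refine ⟨C, fun n => ?_⟩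
    split_ifs with hn
    · simpa using (by positivity : 0 ≤ ‖c 0‖ * σ ^ (0 : ℤ)).trans (hC 0)
    · refine le_trans ?_ (hC (-n))
      rw [zpow_neg, zpow_natCast, ← inv_pow]
      gcongr
      rw [le_inv_comm₀ h1 hσ]
      exact (hσ2.trans_le (min_le_right _ _)).le
  refine ⟨_, _, .of_bound hb1, .of_bound hb2, fun a h1 h2 => ?_⟩
  have hs1 := (summable_norm_of_forall_bound hb1 h2).of_norm
  have hs2 := (summable_norm_of_forall_bound hb2 (a := a⁻¹)
    (by rw [norm_inv]; exact inv_lt_one_of_one_lt₀ h1)).of_norm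
  refine (hf.2 a h1 h2).unique (HasSum.of_nat_of_neg_add_one ?_ ?_)
  · simpa using hs1.hasSum
  · have := (hasSum_nat_add_iff' 1).2 hs2.hasSum
    simp only [Finset.sum_range_one, if_true, zero_mul, sub_zero] at this
    refine this.congr_fun fun n => ?_
    rw [if_neg n.succ_ne_zero, inv_pow, ← zpow_natCast, ← zpow_neg]
    push_cast
    rfl

theorem HasLaurentSeriesOn.analyticAt {f : K → K} {c : ℤ → K} {R : ℝ}
    (hf : HasLaurentSeriesOn f c R) {a : K} (h1 : 1 < ‖a‖) (h2 : ‖a‖ < R) :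
    AnalyticAt K f a := by
  obtain ⟨g, h, hg, hh, hfgh⟩ := hf.exists_decomp (h1.trans h2)
  have ha : a ≠ 0 := norm_pos_iff.1 (one_pos.trans h1)
  have h3 : AnalyticAt K (fun x => h x⁻¹) a := by
    refine AnalyticAt.fun_comp (hh.analyticAt ?_) (analyticAt_inv ha)
    rw [norm_inv]; exact inv_lt_one_of_one_lt₀ h1
  refine ((hg.analyticAt h2).add h3).congr ?_
  filter_upwards [continuous_norm.continuousAt.eventually (lt_mem_nhds h1),
    continuous_norm.continuousAt.eventually (gt_mem_nhds h2)] with x hx1 hx2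
  exact (hfgh x hx1 hx2).symm

theorem HasLaurentSeriesOn.mul_deriv {f : K → K} {c : ℤ → K} {R : ℝ}
    (hf : HasLaurentSeriesOn f c R) :
    HasLaurentSeriesOn (fun a => a * deriv f a) (fun n => n * c n) R := by
  refine ⟨fun ρ h1 h2 => ?_, fun a h1 h2 => ?_⟩
  · obtain ⟨C, hC⟩ := hf.1 ρ h1 h2
    have hρ : 0 < ρ := one_pos.trans h1
    refine ⟨C, fun n => le_trans ?_ (hC n)⟩
    gcongr
    rw [norm_mul]
    exact mul_le_of_le_one_left (norm_nonneg _) (IsUltrametricDist.norm_intCast_le_one K n)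
  · obtain ⟨g, h, hg, hh, hfgh⟩ := hf.exists_decomp (h1.trans h2)
    have ha : a ≠ 0 := norm_pos_iff.1 (one_pos.trans h1)
    have ha' : ‖a⁻¹‖ < 1 := by rw [norm_inv]; exact inv_lt_one_of_one_lt₀ h1
    have hd := ((hg.differentiableAt h2).hasDerivAt).add
      (((hh.differentiableAt ha').hasDerivAt).comp a (hasDerivAt_inv ha))
    have hd' : deriv f a = deriv g a + deriv h a⁻¹ * (-(a ^ 2)⁻¹) := by
      refine HasDerivAt.deriv (hd.congr_of_eventuallyEq ?_)
      filter_upwards [continuous_norm.continuousAt.eventually (lt_mem_nhds h1),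
        continuous_norm.continuousAt.eventually (gt_mem_nhds h2)] with x hx1 hx2
      exact hfgh x hx1 hx2
    have e : a * deriv f a = a * deriv g a + (-a⁻¹) * deriv h a⁻¹ := by
      rw [hd']; field_simp
    simp only [e]
    have s1 := (hg.deriv.2 a h2).mul_left a
    have s2 := (hh.deriv.2 _ ha').mul_left (-a⁻¹)
    refine HasSum.of_nat_of_neg_add_one ?_ ?_
    · refine (hasSum_nat_add_iff' 1).1 ?_
      simp only [Finset.sum_range_one, Nat.cast_zero, Int.cast_zero, zero_mul, sub_zero]
      refine s1.congr_fun fun n => ?_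
      push_cast
      rw [zpow_add₀ ha, zpow_natCast, zpow_one]
      ring
    · refine s2.congr_fun fun n => ?_
      simp only [Nat.succ_ne_zero, if_false]
      rw [zpow_neg, zpow_add₀ ha, zpow_natCast, zpow_one, inv_pow]
      push_cast
      field_simp

/-- The coefficients of a convergent Laurent series vanish if its sum does. The series is
averaged over the roots of unity of order `2 ^ s`, which isolates the coefficients in a residue
class modulo `2 ^ s`. -/
theorem HasLaurentSeriesOn.eq_zero [IsAlgClosed K] [CharZero K] (h2 : ‖(2 : K)‖ = 1)
    {c : ℤ → K} {R : ℝ} (hf : HasLaurentSeriesOn (fun _ => 0) c R) {a : K} (ha1 : 1 < ‖a‖)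
    (haR : ‖a‖ < R) (m : ℤ) : c m = 0 := by
  have ha : a ≠ 0 := norm_pos_iff.1 (one_pos.trans ha1)
  have hsum := (summable_norm_of_forall_laurent_bound hf.1 ha1 haR).of_norm
  have ht := hsum.tendsto_cofinite_zero
  suffices h : ∀ ε > 0, ‖c m * a ^ m‖ ≤ ε by
    have := le_of_forall_pos_le_add (a := ‖c m * a ^ m‖) (b := 0) fun ε hε => by
      simpa using h ε hε
    have := norm_le_zero_iff.1 this
    exact (mul_eq_zero.1 this).resolve_right (zpow_ne_zero _ ha)
  intro ε hε
  have hfin : {n : ℤ | ε ≤ ‖c n * a ^ n‖}.Finite := by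
    have := ht.norm.eventually (gt_mem_nhds (by simpa using hε : ‖(0 : K)‖ < ε))
    simpa only [eventually_cofinite, not_lt] using this
  obtain ⟨B, hB⟩ := (hfin.image fun n => (n - m).natAbs).bddAbove
  set N : ℕ := 2 ^ B with hN
  have hBN : B < N := Nat.lt_two_pow_self
  have hN0 : N ≠ 0 := by positivity
  have hNK : (N : K) ≠ 0 := by exact_mod_cast hN0
  have hNn : ‖(N : K)‖ = 1 := by simp [hN, h2]
  have : NeZero (N : K) := ⟨hNK⟩
  obtain ⟨ζ, hζ⟩ := HasEnoughRootsOfUnity.exists_primitiveRoot K N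
  have hζn : ‖ζ‖ = 1 := by
    have : ‖ζ‖ ^ N = 1 := by rw [← norm_pow, hζ.pow_eq_one, norm_one]
    exact (pow_eq_one_iff_of_nonneg (norm_nonneg _) hN0).1 this
  have hζ0 : ζ ≠ 0 := hζ.ne_zero hN0
  -- the sum of `ζ ^ (-i m)` times the series at `ζ ^ i a`
  have h1 : HasSum (fun n : ℤ => ∑ i ∈ Finset.range N,
      ζ ^ (-(i : ℤ) * m) * (c n * (ζ ^ i * a) ^ n)) 0 := by
    have : (0 : K) = ∑ i ∈ Finset.range N, ζ ^ (-(i : ℤ) * m) * 0 := by simp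
    rw [this]
    refine hasSum_sum fun i _ => (hf.2 (ζ ^ i * a) ?_ ?_).mul_left _
    all_goals simpa [hζn] using by assumption
  have h3 : ∀ n : ℤ, ∑ i ∈ Finset.range N, ζ ^ (-(i : ℤ) * m) * (c n * (ζ ^ i * a) ^ n)
      = if (N : ℤ) ∣ n - m then N * (c n * a ^ n) else 0 := by
    intro n
    have e : ∀ i ∈ Finset.range N, ζ ^ (-(i : ℤ) * m) * (c n * (ζ ^ i * a) ^ n)
        = (ζ ^ (n - m)) ^ i * (c n * a ^ n) := by
      intro i _
      rw [mul_zpow, ← zpow_natCast ζ i, ← zpow_natCast (ζ ^ (n - m)) i, ← _root_.zpow_mul, ← _root_.zpow_mul,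
        show (n - m) * (i : ℤ) = -(i : ℤ) * m + i * n by ring, zpow_add₀ hζ0]
      ring
    rw [Finset.sum_congr rfl e, ← Finset.sum_mul]
    split_ifs with hd
    · rw [(hζ.zpow_eq_one_iff_dvd _).2 hd]; simp
    · have hne : ζ ^ (n - m) ≠ 1 := fun h => hd ((hζ.zpow_eq_one_iff_dvd _).1 h)
      rw [geom_sum_eq hne, ← zpow_natCast, zpow_comm, zpow_natCast, hζ.pow_eq_one]
      simp
  simp only [h3] at h1
  have h4 := h1.sub (hasSum_ite_eq m ((N : K) * (c m * a ^ m)))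
  have h5 : ‖(N : K) * (c m * a ^ m)‖ ≤ ε := by
    rw [show (N : K) * (c m * a ^ m) = -(0 - (N : K) * (c m * a ^ m)) by ring, norm_neg,
      ← h4.tsum_eq]
    refine IsUltrametricDist.norm_tsum_le_of_forall_le_of_nonneg hε.le fun n => ?_
    rcases eq_or_ne n m with rfl | hnm
    · simpa using hε.le
    · rw [if_neg hnm, sub_zero]
      split_ifs with hd
      · rw [norm_mul, hNn, one_mul]
        by_contra hcon
        have h6 := hB ⟨n, (not_le.1 hcon).le, rfl⟩
        have h7 : N ≤ (n - m).natAbs :=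
          Nat.le_of_dvd (by simpa [Nat.pos_iff_ne_zero, sub_eq_zero] using hnm)
            (Int.natCast_dvd.1 hd)
        simp only at h6
        omega
      · simpa using hε.le
  rwa [norm_mul, hNn, one_mul] at h5

/-- A function on the annulus with a Laurent expansion and vanishing derivative is constant. -/
theorem IsLaurentOn.eq_const_of_deriv_eq_zero [IsAlgClosed K] [CharZero K]
    (h2 : ‖(2 : K)‖ = 1) {f : K → K} {R : ℝ} (hf : IsLaurentOn f R)
    (h : ∀ a, 1 < ‖a‖ → ‖a‖ < R → deriv f a = 0) :
    ∃ C, ∀ a, 1 < ‖a‖ → ‖a‖ < R → f a = C := by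
  obtain ⟨c, hc⟩ := hf
  refine ⟨c 0, fun a ha haR => ?_⟩
  have hz : HasLaurentSeriesOn (fun _ => 0) (fun n => n * c n) R :=
    hc.mul_deriv.congr fun a h1 h2 => by rw [h a h1 h2, mul_zero]
  refine (hc.2 a ha haR).unique ?_
  convert hasSum_ite_eq (0 : ℤ) (c 0) using 2 with n
  split_ifs with hn
  · simp [hn]
  · have := hz.eq_zero h2 ha haR n
    rw [(mul_eq_zero.1 this).resolve_left (by exact_mod_cast hn), zero_mul]

end LaurentSeries

/-- Over a field of characteristic zero, an analytic function with vanishing derivative near `z`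
is constant near `z`. -/
theorem eventually_eq_of_eventually_deriv_eq_zero {K : Type*} [NontriviallyNormedField K]
    [CompleteSpace K] [CharZero K] {f : K → K} {z : K} (hf : AnalyticAt K f z)
    (h : ∀ᶠ a in 𝓝 z, deriv f a = 0) : ∀ᶠ a in 𝓝 z, f a = f z := by
  have hit : ∀ n : ℕ, ∀ᶠ a in 𝓝 z, iteratedDeriv (n + 1) f a = 0 := by
    intro n
    induction n with
    | zero => simpa [iteratedDeriv_one] using h
    | succ n ih =>
      filter_upwards [ih.eventually_nhds] with a ha
      rw [iteratedDeriv_succ]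
      have : iteratedDeriv (n + 1) f =ᶠ[𝓝 a] fun _ => 0 := ha
      rw [this.deriv_eq, deriv_const]
  have h1 := hf.hasFPowerSeriesAt
  have h2 : (FormalMultilinearSeries.ofScalars K fun n => iteratedDeriv n f z / n.factorial)
      = FormalMultilinearSeries.ofScalars K (fun n => if n = 0 then f z else 0) := by
    congr 1
    funext n
    rcases n with _ | n
    · simp
    · simp [(hit n).self_of_nhds]
  rw [h2] at h1
  filter_upwards [h1.eventually_hasSum_sub] with a ha
  refine ha.unique ?_
  refine (hasSum_ite_eq (0 : ℕ) (f z)).congr_fun fun n => ?_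
  rcases n with _ | n <;> simp


/-! ### Formal exponentials and the coefficients of the splitting function -/

section FormalExponentials

open PowerSeries

variable {K : Type*} [Field K] [Algebra ℚ K]

/-- The formal power series `exp (c X ^ k)`. -/
noncomputable def expPow (c : K) (k : ℕ) (hk : k ≠ 0) : PowerSeries K :=
  expand k hk (rescale c (exp K))

theorem expPow_mul_expPow (c d : K) {k : ℕ} (hk : k ≠ 0) :
    expPow c k hk * expPow d k hk = expPow (c + d) k hk := by
  rw [expPow, expPow, ← map_mul, exp_mul_exp_eq_exp_add, expPow]

theorem expPow_zero {k : ℕ} (hk : k ≠ 0) : expPow (0 : K) k hk = 1 := by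
  simp [expPow]

theorem expPow_pow (c : K) {k : ℕ} (hk : k ≠ 0) (n : ℕ) :
    expPow c k hk ^ n = expPow (n * c) k hk := by
  induction n with
  | zero => simp [expPow_zero]
  | succ n ih => rw [pow_succ, ih, expPow_mul_expPow]; push_cast; ring_nf

theorem coeff_expPow_mul (c : K) {k : ℕ} (hk : k ≠ 0) (n : ℕ) :
    coeff (k * n) (expPow c k hk) = c ^ n / n.factorial := by
  rw [expPow, coeff_expand_mul, coeff_rescale, coeff_exp]
  simp [div_eq_mul_inv]

theorem coeff_expPow_of_not_dvd (c : K) {k : ℕ} (hk : k ≠ 0) {n : ℕ} (hn : ¬ k ∣ n) :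
    coeff n (expPow c k hk) = 0 := coeff_expand_of_not_dvd _ _ _ hn

theorem coeff_expPow_one (c : K) (n : ℕ) :
    coeff n (expPow c 1 one_ne_zero) = c ^ n / n.factorial := by
  simpa using coeff_expPow_mul c one_ne_zero n

theorem expand_expPow (c : K) {k m : ℕ} (hk : k ≠ 0) (hm : m ≠ 0) :
    expand m hm (expPow c k hk) = expPow c (m * k) (mul_ne_zero hm hk) := by
  rw [expPow, expPow, expand_mul _ hm _ hk]

theorem rescale_expPow (l c : K) {k : ℕ} (hk : k ≠ 0) :
    rescale l (expPow c k hk) = expPow (l ^ k * c) k hk := by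
  ext n
  rw [coeff_rescale]
  by_cases h : k ∣ n
  · obtain ⟨m, rfl⟩ := h
    rw [coeff_expPow_mul, coeff_expPow_mul, mul_pow, pow_mul]
    ring
  · rw [coeff_expPow_of_not_dvd _ _ h, coeff_expPow_of_not_dvd _ _ h, mul_zero]

theorem map_expPow {L : Type*} [Field L] [Algebra ℚ L] (f : K →+* L) (c : K) {k : ℕ}
    (hk : k ≠ 0) : map f (expPow c k hk) = expPow (f c) k hk := by
  ext n
  rw [coeff_map]
  by_cases h : k ∣ n
  · obtain ⟨m, rfl⟩ := h
    rw [coeff_expPow_mul, coeff_expPow_mul]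
    simp
  · rw [coeff_expPow_of_not_dvd _ _ h, coeff_expPow_of_not_dvd _ _ h, map_zero]

end FormalExponentials

section Norms

variable (p : ℕ) [hp : Fact p.Prime]

theorem norm_natCast_complex (n : ℕ) : ‖(n : ℂ_[p])‖ = ‖(n : ℚ_[p])‖ := by
  have := norm_algebraMap' ℂ_[p] (n : ℚ_[p])
  rwa [map_natCast] at this

theorem norm_p_complex : ‖(p : ℂ_[p])‖ = (p : ℝ)⁻¹ := by
  rw [norm_natCast_complex, Padic.norm_p]

theorem norm_natCast_of_not_dvd {n : ℕ} (h : ¬ p ∣ n) : ‖(n : ℂ_[p])‖ = 1 := by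
  rw [norm_natCast_complex]
  exact (Padic.norm_natCast_eq_one_iff).2 ((Nat.Prime.coprime_iff_not_dvd hp.out).2 h)

variable {p} {π : ℂ_[p]}

theorem norm_pi_pow (hπ : π ^ (p - 1) = -(p : ℂ_[p])) : ‖π‖ ^ (p - 1) = (p : ℝ)⁻¹ := by
  rw [← norm_pow, hπ, norm_neg, norm_p_complex]

theorem pi_ne_zero (hπ : π ^ (p - 1) = -(p : ℂ_[p])) : π ≠ 0 := by
  rintro rfl
  have h1 := norm_pi_pow hπ
  have h2 : p - 1 ≠ 0 := by have := hp.out.two_le; omega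
  rw [norm_zero, zero_pow h2] at h1
  have : (p : ℝ) ≠ 0 := by exact_mod_cast hp.out.ne_zero
  exact inv_ne_zero this h1.symm

theorem norm_pi_pos (hπ : π ^ (p - 1) = -(p : ℂ_[p])) : 0 < ‖π‖ := norm_pos_iff.2 (pi_ne_zero hπ)

theorem norm_pi_lt_one (hπ : π ^ (p - 1) = -(p : ℂ_[p])) : ‖π‖ < 1 := by
  by_contra! h
  have h1 := one_le_pow₀ (n := p - 1) h
  rw [norm_pi_pow hπ] at h1
  have : (1 : ℝ) < p := by exact_mod_cast hp.out.one_lt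
  exact absurd h1 (not_le.2 (inv_lt_one_of_one_lt₀ this))

theorem norm_p_eq_norm_pi_pow (hπ : π ^ (p - 1) = -(p : ℂ_[p])) : ‖(p : ℂ_[p])‖ = ‖π‖ ^ (p - 1) := by
  rw [norm_pi_pow hπ, norm_p_complex]

/-- Legendre's formula: the absolute value of `n!` in terms of the digit sum of `n`. -/
theorem norm_factorial (hπ : π ^ (p - 1) = -(p : ℂ_[p])) (n : ℕ) :
    ‖(n.factorial : ℂ_[p])‖ = ‖π‖ ^ (n - (p.digits n).sum) := by
  rw [← sub_one_mul_padicValNat_factorial, pow_mul, norm_pi_pow hπ, norm_natCast_complex,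
    Padic.norm_eq_zpow_neg_valuation (by exact_mod_cast n.factorial_ne_zero),
    Padic.valuation_natCast, zpow_neg, zpow_natCast, inv_pow]

theorem norm_pi_pow_le_norm_factorial (hπ : π ^ (p - 1) = -(p : ℂ_[p])) (n : ℕ) :
    ‖π‖ ^ n ≤ ‖(n.factorial : ℂ_[p])‖ := by
  rw [norm_factorial hπ]
  exact pow_le_pow_of_le_one (norm_nonneg _) (norm_pi_lt_one hπ).le (Nat.sub_le _ _)

theorem norm_factorial_le (hπ : π ^ (p - 1) = -(p : ℂ_[p])) (n : ℕ) :
    ‖(n.factorial : ℂ_[p])‖ ≤ p * (n + 1) * ‖π‖ ^ n := by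
  have hp0 : (0 : ℝ) < p := by exact_mod_cast hp.out.pos
  have hpos := norm_pi_pos hπ
  rcases Nat.eq_zero_or_pos n with rfl | hn
  · simpa using hp.out.one_lt.le
  have hs : (p.digits n).sum ≤ (p - 1) * (p.digits n).length := by
    have := List.sum_le_card_nsmul (p.digits n) (p - 1) fun x hx => by
      have := Nat.digits_lt_base hp.out.one_lt hx
      omega
    simpa [mul_comm] using this
  have hlen : p ^ (p.digits n).length ≤ p * n :=
    Nat.base_pow_length_digits_le p n hp.out.one_lt hn.ne'
  have hs' : (p.digits n).sum ≤ n := Nat.digit_sum_le p n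
  rw [norm_factorial hπ]
  have h1 : ‖π‖ ^ (n - (p.digits n).sum) * ‖π‖ ^ (p.digits n).sum = ‖π‖ ^ n := by
    rw [← pow_add, Nat.sub_add_cancel hs']
  have h2 : ((p : ℝ) * n)⁻¹ ≤ ‖π‖ ^ (p.digits n).sum := by
    calc ((p : ℝ) * n)⁻¹ ≤ ((p : ℝ) ^ (p.digits n).length)⁻¹ := by
          gcongr; exact_mod_cast hlen
      _ = ‖π‖ ^ ((p - 1) * (p.digits n).length) := by
          rw [pow_mul, norm_pi_pow hπ, inv_pow]
      _ ≤ _ := pow_le_pow_of_le_one (norm_nonneg _) (norm_pi_lt_one hπ).le hs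
  have hn' : (0 : ℝ) < n := by exact_mod_cast hn
  rw [← h1]
  calc _ = (p * n : ℝ) * (‖π‖ ^ (n - (p.digits n).sum) * ((p : ℝ) * n)⁻¹) := by field_simp
    _ ≤ (p * n : ℝ) * (‖π‖ ^ (n - (p.digits n).sum) * ‖π‖ ^ (p.digits n).sum) := by gcongr
    _ ≤ _ := by gcongr; linarith

end Norms


section ArtinHasse

open PowerSeries

theorem expPow_congr {K : Type*} [Field K] [Algebra ℚ K] {c d : K} {k l : ℕ} (hk : k ≠ 0)
    (hl : l ≠ 0) (h : c = d) (h' : k = l) : expPow c k hk = expPow d l hl := by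
  subst h h'; rfl

theorem coeff_zero_expPow {K : Type*} [Field K] [Algebra ℚ K] (c : K) {k : ℕ} (hk : k ≠ 0) :
    coeff 0 (expPow c k hk) = 1 := by
  simpa using coeff_expPow_mul c hk 0

variable (p : ℕ) [hp : Fact p.Prime]

/-- The truncated Artin-Hasse exponential `exp (∑ X ^ (p ^ i) / p ^ i)`, over `i ≤ s`. -/
noncomputable def truncArtinHasse (s : ℕ) : PowerSeries ℚ_[p] :=
  ∏ i ∈ Finset.range (s + 1), expPow ((p : ℚ_[p]) ^ i)⁻¹ (p ^ i) (pow_ne_zero i hp.out.ne_zero)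

/-- The functional equation `F(X)^p exp(X^(p^(s+1)) / p^s) = exp(p X) F(X^p)` of the truncated
Artin-Hasse exponential, the input of Dwork's integrality argument. -/
theorem truncArtinHasse_pow_mul (s : ℕ) :
    truncArtinHasse p s ^ p *
        expPow ((p : ℚ_[p]) ^ s)⁻¹ (p ^ (s + 1)) (pow_ne_zero _ hp.out.ne_zero) =
      expPow (p : ℚ_[p]) 1 one_ne_zero * expand p hp.out.ne_zero (truncArtinHasse p s) := by
  have hpQ : (p : ℚ_[p]) ≠ 0 := by exact_mod_cast hp.out.ne_zero
  have h0 : ∀ i : ℕ, expPow ((p : ℚ_[p]) ^ (i + 1))⁻¹ (p ^ (i + 1))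
      (pow_ne_zero _ hp.out.ne_zero) ^ p =
      expPow ((p : ℚ_[p]) ^ i)⁻¹ (p ^ (i + 1)) (pow_ne_zero _ hp.out.ne_zero) := by
    intro i
    rw [expPow_pow]
    refine expPow_congr _ _ ?_ rfl
    rw [pow_succ]
    field_simp
  have h1 : ∀ i : ℕ, expand p hp.out.ne_zero (expPow ((p : ℚ_[p]) ^ i)⁻¹ (p ^ i)
      (pow_ne_zero _ hp.out.ne_zero)) =
      expPow ((p : ℚ_[p]) ^ i)⁻¹ (p ^ (i + 1)) (pow_ne_zero _ hp.out.ne_zero) := by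
    intro i
    rw [expand_expPow]
    exact expPow_congr _ _ rfl (pow_succ' p i).symm
  have h2 : expPow ((p : ℚ_[p]) ^ 0)⁻¹ (p ^ 0) (pow_ne_zero _ hp.out.ne_zero) ^ p =
      expPow (p : ℚ_[p]) 1 one_ne_zero := by
    rw [expPow_pow]
    exact expPow_congr _ _ (by simp) (pow_zero p)
  simp only [truncArtinHasse]
  rw [map_prod, Finset.prod_congr rfl fun i _ => h1 i, ← Finset.prod_pow,
    Finset.prod_range_succ', Finset.prod_congr rfl fun i _ => h0 i, h2,
    Finset.prod_range_succ]
  ring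

theorem coeff_zero_truncArtinHasse (s : ℕ) : coeff 0 (truncArtinHasse p s) = 1 := by
  rw [truncArtinHasse, coeff_zero_eq_constantCoeff, map_prod]
  refine Finset.prod_eq_one fun i _ => ?_
  rw [← coeff_zero_eq_constantCoeff, coeff_zero_expPow]

theorem norm_p_pow_div_factorial_le {i : ℕ} (hi : i ≠ 0) :
    ‖(p : ℚ_[p]) ^ i / i.factorial‖ ≤ (p : ℝ)⁻¹ := by
  have hp0 : (0 : ℝ) < p := by exact_mod_cast hp.out.pos
  have h1 := sub_one_mul_padicValNat_factorial_lt_of_ne_zero p hi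
  have h2 : padicValNat p i.factorial + 1 ≤ i := by
    have : 1 ≤ p - 1 := by have := hp.out.two_le; omega
    nlinarith
  rw [norm_div, norm_pow, Padic.norm_p,
    Padic.norm_eq_zpow_neg_valuation (by exact_mod_cast i.factorial_ne_zero),
    Padic.valuation_natCast, zpow_neg, zpow_natCast, ← inv_pow, div_le_iff₀ (by positivity),
    ← pow_succ']
  refine pow_le_pow_of_le_one (by positivity) ?_ h2
  exact inv_le_one_of_one_le₀ (by exact_mod_cast hp.out.one_lt.le)

/-- `f ^ p` and `f (X ^ p)` agree modulo `p` for a polynomial `f` over `ℤ_p`. -/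
theorem norm_coeff_pow_sub_expand_le (f : Polynomial ℤ_[p]) (n : ℕ) :
    ‖(f ^ p - Polynomial.expand ℤ_[p] p f).coeff n‖ ≤ (p : ℝ)⁻¹ := by
  have h : (f ^ p - Polynomial.expand ℤ_[p] p f).map (PadicInt.toZMod (p := p)) = 0 := by
    rw [Polynomial.map_sub, Polynomial.map_pow, Polynomial.map_expand, ZMod.expand_card, sub_self]
  have h1 : PadicInt.toZMod ((f ^ p - Polynomial.expand ℤ_[p] p f).coeff n) = 0 := by
    rw [← Polynomial.coeff_map, h, Polynomial.coeff_zero]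
  have h2 := (RingHom.mem_ker).2 h1
  rw [PadicInt.ker_toZMod, PadicInt.maximalIdeal_eq_span_p, Ideal.mem_span_singleton] at h2
  obtain ⟨y, hy⟩ := h2
  rw [hy, norm_mul, PadicInt.norm_p]
  exact mul_le_of_le_one_right (by positivity) (PadicInt.norm_le_one y)

/-- Integrality of the Artin-Hasse exponential, by Dwork's argument: the coefficient of `X ^ n`
in `f ^ p` is `p` times that in `f` up to coefficients of lower order. -/
theorem norm_coeff_truncArtinHasse_le (s n : ℕ) (hn : n < p ^ (s + 1)) :
    ‖coeff n (truncArtinHasse p s)‖ ≤ 1 := by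
  induction n using Nat.strong_induction_on with
  | _ n ih =>
  rcases Nat.eq_zero_or_pos n with rfl | hn0
  · rw [coeff_zero_truncArtinHasse]; simp
  set A := truncArtinHasse p s with hA
  have hp0 : (0 : ℝ) < p := by exact_mod_cast hp.out.pos
  have ih' : ∀ m < n, ‖coeff m A‖ ≤ 1 := fun m hm => ih m hm (hm.trans hn)
  let ι : ℤ_[p] →+* ℚ_[p] := PadicInt.Coe.ringHom
  have hlift : ∀ m, ∃ b : ℤ_[p], m < n → ι b = coeff m A := fun m => by
    by_cases hm : m < n
    · exact ⟨⟨coeff m A, ih' m hm⟩, fun _ => rfl⟩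
    · exact ⟨0, fun h => absurd h hm⟩
  choose b hb using hlift
  let B : Polynomial ℤ_[p] := ∑ m ∈ Finset.range n, Polynomial.monomial m (b m)
  let Bq : PowerSeries ℚ_[p] := (B.map ι : Polynomial ℚ_[p])
  have hB : ∀ m, coeff m Bq = if m < n then coeff m A else 0 := by
    intro m
    simp only [Bq, Polynomial.coeff_coe, Polynomial.coeff_map, B, Polynomial.finsetSum_coeff,
      Polynomial.coeff_monomial, Finset.sum_ite_eq', Finset.mem_range]
    split_ifs with hm
    · exact hb m hm
    · exact map_zero ι
  obtain ⟨U, hU⟩ : (X : PowerSeries ℚ_[p]) ^ n ∣ A - Bq := by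
    rw [X_pow_dvd_iff]
    intro m hm
    rw [map_sub, hB, if_pos hm, sub_self]
  have hU0 : coeff 0 U = coeff n A := by
    have := congrArg (coeff n) hU
    rw [map_sub, hB, if_neg (lt_irrefl _), sub_zero, coeff_X_pow_mul', if_pos le_rfl,
      Nat.sub_self] at this
    exact this.symm
  have hAB : A = Bq + X ^ n * U := by rw [← hU]; ring
  -- the coefficient of `X ^ n` in `A ^ p`
  have hAp : coeff n (A ^ p) = coeff n (Bq ^ p) + p * coeff n A := by
    obtain ⟨k, hk⟩ := Polynomial.powAddExpansion Bq (X ^ n * U) p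
    rw [← hAB] at hk
    rw [hk, map_add, map_add]
    have e1 : coeff n (k * (X ^ n * U) ^ 2) = 0 := by
      rw [show k * (X ^ n * U) ^ 2 = X ^ (n + n) * (k * U ^ 2) by ring, coeff_X_pow_mul',
        if_neg (by omega)]
    have e2 : coeff n ((p : PowerSeries ℚ_[p]) * Bq ^ (p - 1) * (X ^ n * U)) = p * coeff n A := by
      rw [show (p : PowerSeries ℚ_[p]) * Bq ^ (p - 1) * (X ^ n * U)
        = X ^ n * ((p : PowerSeries ℚ_[p]) * Bq ^ (p - 1) * U) by ring, coeff_X_pow_mul', if_pos le_rfl, Nat.sub_self,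
        coeff_zero_eq_constantCoeff, map_mul, map_mul, map_pow, ← coeff_zero_eq_constantCoeff,
        hU0, hB, if_pos hn0, hA, coeff_zero_truncArtinHasse]
      simp
    rw [e1, e2, add_zero]
  -- the coefficient of `X ^ n` in the functional equation
  have hfe := congrArg (coeff n) (truncArtinHasse_pow_mul p s)
  rw [← hA] at hfe
  have hleft : coeff n (A ^ p * expPow ((p : ℚ_[p]) ^ s)⁻¹ (p ^ (s + 1))
      (pow_ne_zero _ hp.out.ne_zero)) = coeff n (A ^ p) := by
    rw [coeff_mul, Finset.sum_eq_single (n, 0)]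
    · simp [coeff_zero_expPow]
    · rintro ⟨i, j⟩ hij hne
      rw [Finset.HasAntidiagonal.mem_antidiagonal] at hij
      rw [coeff_expPow_of_not_dvd, mul_zero]
      intro hd
      have hj : j ≠ 0 := by rintro rfl; simp at hij; simp [hij] at hne
      have := Nat.le_of_dvd (Nat.pos_of_ne_zero hj) hd
      simp only at hij
      omega
    · simp
  have hexp : ∀ j ≤ n, coeff j (expand p hp.out.ne_zero A)
      = coeff j ((Polynomial.expand ℤ_[p] p B).map ι : Polynomial ℚ_[p]) ∧
      ‖coeff j (expand p hp.out.ne_zero A)‖ ≤ 1 := by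
    intro j hj
    rw [Polynomial.coeff_coe, Polynomial.coeff_map, Polynomial.coeff_expand hp.out.pos]
    split_ifs with hd
    · obtain ⟨m, rfl⟩ := hd
      have hmn : m < n := by
        rcases Nat.eq_zero_or_pos m with rfl | hm
        · exact hn0
        · have := hp.out.two_le; nlinarith
      rw [coeff_expand_mul, Nat.mul_div_cancel_left _ hp.out.pos]
      refine ⟨?_, ih' m hmn⟩
      have := hB m
      rw [if_pos hmn] at this
      rw [← this]
      simp [Bq]
    · rw [coeff_expand_of_not_dvd _ _ _ hd]; simp
  have hright : ‖coeff n (expPow (p : ℚ_[p]) 1 one_ne_zero * expand p hp.out.ne_zero A)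
      - coeff n (expand p hp.out.ne_zero A)‖ ≤ (p : ℝ)⁻¹ := by
    rw [coeff_mul, Finset.Nat.sum_antidiagonal_eq_sum_range_succ_mk, Finset.sum_range_succ']
    simp only [coeff_zero_expPow, one_mul, Nat.sub_zero, add_sub_cancel_right]
    refine IsUltrametricDist.norm_sum_le_of_forall_le_of_nonneg (by positivity) fun i hi => ?_
    rw [norm_mul, coeff_expPow_one]
    calc _ ≤ (p : ℝ)⁻¹ * 1 := by
          gcongr
          · exact norm_p_pow_div_factorial_le p i.succ_ne_zero
          · exact (hexp _ (Nat.sub_le _ _)).2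
      _ = _ := mul_one _
  rw [← hfe, hleft, hAp, (hexp n le_rfl).1] at hright
  have hmod : ‖coeff n (Bq ^ p) - coeff n ((Polynomial.expand ℤ_[p] p B).map ι :
      Polynomial ℚ_[p])‖ ≤ (p : ℝ)⁻¹ := by
    have h1 := norm_coeff_pow_sub_expand_le p B n
    have h2 : coeff n (Bq ^ p) - coeff n ((Polynomial.expand ℤ_[p] p B).map ι :
      Polynomial ℚ_[p]) = ι ((B ^ p - Polynomial.expand ℤ_[p] p B).coeff n) := by
      rw [← Polynomial.coeff_map, Polynomial.map_sub, Polynomial.coeff_sub, Polynomial.map_pow,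
        ← Polynomial.coeff_coe, ← Polynomial.coeff_coe, Polynomial.coe_pow]
    rw [h2]
    exact h1
  have hfin : ‖(p : ℚ_[p]) * coeff n A‖ ≤ (p : ℝ)⁻¹ := by
    have := (IsUltrametricDist.norm_add_le_max _ _).trans (max_le hright ((norm_neg _).le.trans hmod))
    refine le_trans (le_of_eq ?_) this
    congr 1
    ring
  rw [norm_mul, Padic.norm_p] at hfin
  exact le_of_mul_le_mul_left (by simpa using hfin) (inv_pos.2 hp0)

end ArtinHasse


section SplittingFunction

open PowerSeries

theorem norm_coeff_mul_le {K : Type*} [NormedField K] [IsUltrametricDist K]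
    {f g : PowerSeries K} {τ : ℝ} (hτ : 0 ≤ τ) {N : ℕ} (hf : ∀ n ≤ N, ‖coeff n f‖ ≤ τ ^ n)
    (hg : ∀ n ≤ N, ‖coeff n g‖ ≤ τ ^ n) : ∀ n ≤ N, ‖coeff n (f * g)‖ ≤ τ ^ n := by
  intro n hn
  rw [coeff_mul]
  refine IsUltrametricDist.norm_sum_le_of_forall_le_of_nonneg (by positivity) fun x hx => ?_
  rw [Finset.HasAntidiagonal.mem_antidiagonal] at hx
  rw [norm_mul, ← hx, pow_add]
  gcongr
  · exact hf _ (by omega)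
  · exact hg _ (by omega)

/-- The number `p ^ (-(p - 1) / p ^ 2)`, the inverse of the radius of convergence of the splitting
function `exp (π (t - t ^ p))`. -/
noncomputable def splitRate (p : ℕ) : ℝ := (p : ℝ) ^ (-(((p : ℝ) - 1) / (p : ℝ) ^ 2))

variable {p : ℕ} [hp : Fact p.Prime]

theorem splitRate_pos : 0 < splitRate p :=
  Real.rpow_pos_of_pos (by exact_mod_cast hp.out.pos) _

theorem splitRate_lt_one : splitRate p < 1 := by
  have h1 : (1 : ℝ) < p := by exact_mod_cast hp.out.one_lt
  refine Real.rpow_lt_one_of_one_lt_of_neg h1 ?_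
  have : 0 < ((p : ℝ) - 1) / (p : ℝ) ^ 2 := div_pos (by linarith) (by positivity)
  linarith

variable {π : ℂ_[p]}

theorem norm_pi_eq_rpow (hπ : π ^ (p - 1) = -(p : ℂ_[p])) :
    ‖π‖ = (p : ℝ) ^ (-(1 / ((p : ℝ) - 1))) := by
  have hp0 : (0 : ℝ) < p := by exact_mod_cast hp.out.pos
  have h1 : (1 : ℝ) < p := by exact_mod_cast hp.out.one_lt
  have h2 : ((p - 1 : ℕ) : ℝ) = (p : ℝ) - 1 := by
    rw [Nat.cast_sub hp.out.one_lt.le]; simp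
  have h3 : p - 1 ≠ 0 := by have := hp.out.one_lt; omega
  refine (pow_left_inj₀ (norm_nonneg _) (by positivity) h3).1 ?_
  rw [norm_pi_pow hπ, ← Real.rpow_natCast, ← Real.rpow_mul hp0.le, h2, neg_mul,
    one_div_mul_cancel (by linarith), Real.rpow_neg_one]

theorem splitRate_pow (hπ : π ^ (p - 1) = -(p : ℂ_[p])) :
    splitRate p ^ p ^ 2 = ‖π‖ ^ (p - 1) ^ 2 := by
  have hp0 : (0 : ℝ) < p := by exact_mod_cast hp.out.pos
  have h1 : (1 : ℝ) < p := by exact_mod_cast hp.out.one_lt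
  have h2 : ((p - 1 : ℕ) : ℝ) = (p : ℝ) - 1 := by
    rw [Nat.cast_sub hp.out.one_lt.le]; simp
  rw [norm_pi_eq_rpow hπ, splitRate, ← Real.rpow_mul_natCast hp0.le,
    ← Real.rpow_mul_natCast hp0.le]
  congr 1
  push_cast
  rw [h2]
  have h3 : (p : ℝ) - 1 ≠ 0 := by linarith
  field_simp

theorem norm_pi_le_splitRate (hπ : π ^ (p - 1) = -(p : ℂ_[p])) : ‖π‖ ≤ splitRate p := by
  have hp0 : p ^ 2 ≠ 0 := pow_ne_zero _ hp.out.ne_zero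
  refine (pow_le_pow_iff_left₀ (norm_nonneg _) splitRate_pos.le hp0).1 ?_
  rw [splitRate_pow hπ]
  exact pow_le_pow_of_le_one (norm_nonneg _) (norm_pi_lt_one hπ).le
    (Nat.pow_le_pow_left (Nat.sub_le _ _) 2)

theorem norm_coeff_expPow_le (hπ : π ^ (p - 1) = -(p : ℂ_[p])) {c : ℂ_[p]} {k : ℕ} (hk : k ≠ 0)
    {τ : ℝ} (hτ : 0 ≤ τ) (hc : ‖c‖ ≤ ‖π‖ * τ ^ k) (n : ℕ) :
    ‖coeff n (expPow c k hk)‖ ≤ τ ^ n := by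
  by_cases h : k ∣ n
  · obtain ⟨m, rfl⟩ := h
    have hpos := norm_pi_pos hπ
    have hf := norm_pi_pow_le_norm_factorial hπ m
    rw [coeff_expPow_mul, norm_div, norm_pow,
      div_le_iff₀ ((pow_pos hpos m).trans_le hf)]
    calc ‖c‖ ^ m ≤ (‖π‖ * τ ^ k) ^ m := by gcongr
      _ = τ ^ (k * m) * ‖π‖ ^ m := by rw [mul_pow, pow_mul]; ring
      _ ≤ _ := by gcongr
  · rw [coeff_expPow_of_not_dvd _ _ h, norm_zero]
    positivity

theorem coeff_expand_mul_eq_sum {R : Type*} [CommRing R] {q : ℕ} (hq : q ≠ 0)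
    (f g : PowerSeries R) (n : ℕ) : coeff n (expand q hq f * g) =
      ∑ j ∈ Finset.range (n / q + 1), coeff j f * coeff (n - q * j) g := by
  rw [coeff_mul, Finset.Nat.sum_antidiagonal_eq_sum_range_succ_mk]
  symm
  refine Finset.sum_of_injOn (fun j => q * j) ?_ ?_ ?_ ?_
  · intro a _ b _ hab
    exact Nat.eq_of_mul_eq_mul_left (Nat.pos_of_ne_zero hq) hab
  · intro j hj
    simp only [Finset.coe_range, Set.mem_Iio] at hj ⊢
    have h1 : j ≤ n / q := by omega
    have h2 := (Nat.le_div_iff_mul_le (Nat.pos_of_ne_zero hq)).1 h1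
    rw [mul_comm] at h2
    omega
  · intro i hi hni
    rw [coeff_expand_of_not_dvd, zero_mul]
    rintro ⟨j, rfl⟩
    refine hni ⟨j, ?_, rfl⟩
    simp only [Finset.coe_range, Set.mem_Iio, Finset.mem_range] at hi ⊢
    have : j ≤ n / q := (Nat.le_div_iff_mul_le (Nat.pos_of_ne_zero hq)).2 (by
      rw [mul_comm]; omega)
    omega
  · intro j _
    simp only
    rw [coeff_expand_mul]

theorem thetaCoeff_eq_coeff (π : ℂ_[p]) {q : ℕ} (hq : q ≠ 0) (n : ℕ) :
    thetaCoeff p π q n = coeff n (expPow (-π) q hq * expPow π 1 one_ne_zero) := by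
  conv_rhs => rw [expPow]
  rw [coeff_expand_mul_eq_sum, thetaCoeff]
  refine Finset.sum_congr rfl fun j _ => ?_
  rw [coeff_expPow_one, coeff_rescale, coeff_exp, mul_comm]
  simp [div_eq_mul_inv]

theorem pi_pow_p (hπ : π ^ (p - 1) = -(p : ℂ_[p])) : π ^ p = -(p : ℂ_[p]) * π := by
  rw [← hπ, ← pow_succ, Nat.sub_add_cancel hp.out.one_lt.le]

/-- The Artin-Hasse exponential at `π X` is the splitting function times exponentials of monomials
of degree at least `p ^ 2`. -/
theorem rescale_truncArtinHasse (hπ : π ^ (p - 1) = -(p : ℂ_[p])) (s : ℕ) :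
    rescale π (map (algebraMap ℚ_[p] ℂ_[p]) (truncArtinHasse p (s + 1))) *
      ∏ i ∈ Finset.range s, expPow (-(π ^ p ^ (i + 2) / (p : ℂ_[p]) ^ (i + 2))) (p ^ (i + 2))
        (pow_ne_zero _ hp.out.ne_zero) =
    expPow (-π) p hp.out.ne_zero * expPow π 1 one_ne_zero := by
  have hpC : (p : ℂ_[p]) ≠ 0 := by exact_mod_cast hp.out.ne_zero
  have h0 : ∀ i : ℕ, rescale π (map (algebraMap ℚ_[p] ℂ_[p]) (expPow ((p : ℚ_[p]) ^ i)⁻¹ (p ^ i)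
      (pow_ne_zero i hp.out.ne_zero))) =
      expPow (π ^ p ^ i / (p : ℂ_[p]) ^ i) (p ^ i) (pow_ne_zero i hp.out.ne_zero) := by
    intro i
    rw [map_expPow, rescale_expPow]
    refine expPow_congr _ _ ?_ rfl
    rw [map_inv₀, map_pow, map_natCast, div_eq_mul_inv]
  have h1 : expPow (π ^ p ^ 0 / (p : ℂ_[p]) ^ 0) (p ^ 0) (pow_ne_zero 0 hp.out.ne_zero) =
      expPow π 1 one_ne_zero := expPow_congr _ _ (by simp) (pow_zero p)
  have h2 : expPow (π ^ p ^ (0 + 1) / (p : ℂ_[p]) ^ (0 + 1)) (p ^ (0 + 1))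
      (pow_ne_zero (0 + 1) hp.out.ne_zero) = expPow (-π) p hp.out.ne_zero := by
    refine expPow_congr _ _ ?_ (by simp)
    rw [zero_add, pow_one, pow_one, pi_pow_p hπ]
    field_simp
  rw [truncArtinHasse, map_prod, map_prod, Finset.prod_congr rfl fun i _ => h0 i,
    Finset.prod_range_succ', Finset.prod_range_succ', h1, h2]
  have h3 : (∏ i ∈ Finset.range s, expPow (π ^ p ^ (i + 1 + 1) / (p : ℂ_[p]) ^ (i + 1 + 1))
      (p ^ (i + 1 + 1)) (pow_ne_zero _ hp.out.ne_zero)) *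
      ∏ i ∈ Finset.range s, expPow (-(π ^ p ^ (i + 2) / (p : ℂ_[p]) ^ (i + 2))) (p ^ (i + 2))
        (pow_ne_zero _ hp.out.ne_zero) = 1 := by
    rw [← Finset.prod_mul_distrib]
    refine Finset.prod_eq_one fun i _ => ?_
    rw [expPow_mul_expPow, add_neg_cancel, expPow_zero]
  calc _ = ((∏ i ∈ Finset.range s, expPow (π ^ p ^ (i + 1 + 1) / (p : ℂ_[p]) ^ (i + 1 + 1))
      (p ^ (i + 1 + 1)) (pow_ne_zero _ hp.out.ne_zero)) *
      ∏ i ∈ Finset.range s, expPow (-(π ^ p ^ (i + 2) / (p : ℂ_[p]) ^ (i + 2))) (p ^ (i + 2))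
        (pow_ne_zero _ hp.out.ne_zero)) *
      (expPow (-π) p hp.out.ne_zero * expPow π 1 one_ne_zero) := by ring
    _ = _ := by rw [h3, one_mul]

/-- Dwork's estimate for the coefficients of the splitting function. -/
theorem norm_thetaCoeff_le (hπ : π ^ (p - 1) = -(p : ℂ_[p])) (n : ℕ) :
    ‖thetaCoeff p π p n‖ ≤ splitRate p ^ n := by
  rw [thetaCoeff_eq_coeff π hp.out.ne_zero, ← rescale_truncArtinHasse hπ n]
  have hτ : 0 ≤ splitRate p := splitRate_pos.le
  refine norm_coeff_mul_le hτ (N := n) (fun m hm => ?_) (fun m hm => ?_) n le_rfl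
  · rw [coeff_rescale, coeff_map, norm_mul, norm_pow, norm_algebraMap']
    calc _ ≤ splitRate p ^ m * 1 := by
          gcongr
          · exact norm_pi_le_splitRate hπ
          · refine norm_coeff_truncArtinHasse_le p _ m ?_
            have := Nat.lt_pow_self hp.out.one_lt (n := n + 1 + 1)
            omega
      _ = _ := mul_one _
  · refine Finset.prod_induction _ (fun f : PowerSeries ℂ_[p] =>
      ∀ m ≤ n, ‖coeff m f‖ ≤ splitRate p ^ m) (fun f g hf hg => norm_coeff_mul_le hτ hf hg)
      ?_ ?_ m hm
    · intro m _
      rcases Nat.eq_zero_or_pos m with rfl | hm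
      · simp
      · rw [coeff_one, if_neg hm.ne', norm_zero]; positivity
    · intro i _ m _
      refine norm_coeff_expPow_le hπ _ hτ ?_ m
      have hpos := norm_pi_pos hπ
      rw [norm_neg, norm_div, norm_pow, norm_pow, norm_p_eq_norm_pi_pow hπ,
        div_le_iff₀ (by positivity), show p ^ (i + 2) = p ^ 2 * p ^ i by ring,
        pow_mul (splitRate p), splitRate_pow hπ, ← pow_mul, ← pow_mul, ← pow_succ', ← pow_add ‖π‖]
      refine pow_le_pow_of_le_one (norm_nonneg _) (norm_pi_lt_one hπ).le ?_
      obtain ⟨r, hr⟩ : ∃ r, p = r + 1 := ⟨p - 1, by have := hp.out.one_lt; omega⟩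
      have hi : i + 1 ≤ p ^ i := Nat.lt_pow_self hp.out.one_lt
      rw [hr] at hi ⊢
      simp only [Nat.add_sub_cancel]
      have hr1 : 1 ≤ r := by have := hp.out.one_lt; omega
      nlinarith

end SplittingFunction


/-! ### Differential equations of the splitting function and of the Frobenius kernel -/

section EulerOperator

open PowerSeries

variable {R : Type*} [CommRing R]

/-- The Euler operator `X d/dX` on power series. -/
noncomputable def euler (f : PowerSeries R) : PowerSeries R := X * PowerSeries.derivative R f

theorem coeff_euler (f : PowerSeries R) (n : ℕ) : coeff n (euler f) = n * coeff n f := by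
  rcases n with _ | n
  · simp [euler]
  · rw [euler, coeff_succ_X_mul, coeff_derivative]
    push_cast
    ring

theorem euler_mul (f g : PowerSeries R) : euler (f * g) = euler f * g + f * euler g := by
  simp only [euler, Derivation.leibniz, smul_eq_mul]
  ring

theorem euler_expand {k : ℕ} (hk : k ≠ 0) (f : PowerSeries R) :
    euler (expand k hk f) = (k : PowerSeries R) * expand k hk (euler f) := by
  ext n
  rw [coeff_euler, ← map_natCast (C (R := R)), coeff_C_mul]
  by_cases h : k ∣ n
  · obtain ⟨m, rfl⟩ := h
    rw [coeff_expand_mul, coeff_expand_mul, coeff_euler]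
    push_cast
    ring
  · rw [coeff_expand_of_not_dvd _ _ _ h, coeff_expand_of_not_dvd _ _ _ h, mul_zero, mul_zero]

theorem euler_rescale (a : R) (f : PowerSeries R) :
    euler (rescale a f) = rescale a (euler f) := by
  ext n
  simp only [coeff_euler, coeff_rescale]
  ring

theorem rescale_C (a r : R) : rescale a (C r) = C r := by
  ext n
  rw [coeff_rescale, coeff_C]
  split_ifs with h <;> simp [h]

theorem euler_map {S : Type*} [CommRing S] (φ : R →+* S) (f : PowerSeries R) :
    euler (map φ f) = map φ (euler f) := by
  ext n
  simp only [coeff_euler, coeff_map, map_mul, map_natCast]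

theorem euler_expPow {K : Type*} [Field K] [Algebra ℚ K] (c : K) {k : ℕ} (hk : k ≠ 0) :
    euler (expPow c k hk) = C (k * c) * X ^ k * expPow c k hk := by
  rw [expPow, euler_expand, euler_rescale, euler, derivative_exp, map_mul, map_mul, rescale_X,
    map_mul, expand_X, expand_C, map_mul, map_natCast]
  ring

/-- The coefficient of `X ^ k`, for `k` an integer; it is `0` for negative `k`. Shifts of the index
then need no case distinction. -/
noncomputable def zcoeff (f : PowerSeries R) (k : ℤ) : R :=
  if 0 ≤ k then coeff k.toNat f else 0

theorem zcoeff_natCast (f : PowerSeries R) (n : ℕ) : zcoeff f n = coeff n f := by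
  simp [zcoeff]

theorem zcoeff_of_neg (f : PowerSeries R) {k : ℤ} (hk : k < 0) : zcoeff f k = 0 := by
  rw [zcoeff, if_neg (not_le.2 hk)]

theorem zcoeff_X_pow_mul (f : PowerSeries R) (j : ℕ) (k : ℤ) :
    zcoeff (X ^ j * f) k = zcoeff f (k - j) := by
  rcases lt_or_ge k 0 with h | h
  · rw [zcoeff_of_neg _ h, zcoeff_of_neg _ (by omega)]
  · lift k to ℕ using h
    rw [zcoeff_natCast, coeff_X_pow_mul']
    split_ifs with hj
    · rw [← Nat.cast_sub hj, zcoeff_natCast]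
    · rw [zcoeff_of_neg _ (by omega)]

theorem zcoeff_C_mul (f : PowerSeries R) (r : R) (k : ℤ) :
    zcoeff (C r * f) k = r * zcoeff f k := by
  simp only [zcoeff, coeff_C_mul, mul_ite, mul_zero]

theorem zcoeff_add (f g : PowerSeries R) (k : ℤ) : zcoeff (f + g) k = zcoeff f k + zcoeff g k := by
  simp only [zcoeff, map_add]
  split_ifs <;> simp

theorem zcoeff_sub (f g : PowerSeries R) (k : ℤ) : zcoeff (f - g) k = zcoeff f k - zcoeff g k := by
  simp only [zcoeff, map_sub]
  split_ifs <;> simp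

theorem zcoeff_euler (f : PowerSeries R) (k : ℤ) : zcoeff (euler f) k = k * zcoeff f k := by
  rcases lt_or_ge k 0 with h | h
  · rw [zcoeff_of_neg _ h, zcoeff_of_neg _ h, mul_zero]
  · lift k to ℕ using h
    rw [zcoeff_natCast, zcoeff_natCast, coeff_euler, Int.cast_natCast]

end EulerOperator

section FrobeniusKernel

open PowerSeries

variable (p : ℕ) [hp : Fact p.Prime] (π : ℂ_[p])

/-- The splitting function `exp (π (X - X ^ p))` as a formal power series. -/
noncomputable def thetaSeries : PowerSeries ℂ_[p] :=
  expPow (-π) p hp.out.ne_zero * expPow π 1 one_ne_zero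

theorem coeff_thetaSeries (n : ℕ) : coeff n (thetaSeries p π) = thetaCoeff p π p n :=
  (thetaCoeff_eq_coeff π hp.out.ne_zero n).symm

theorem euler_thetaSeries :
    euler (thetaSeries p π) = (C π * X - C (p * π) * X ^ p) * thetaSeries p π := by
  rw [thetaSeries, euler_mul, euler_expPow, euler_expPow]
  simp only [mul_neg, map_neg, Nat.cast_one, one_mul, pow_one]
  ring

/-- The kernel `F(a, x) = θ(x ^ 3) θ(a x)` as a power series in `x` over the polynomials in `a`. -/
noncomputable def frobKernel : PowerSeries (Polynomial ℂ_[p]) :=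
  expand 3 three_ne_zero (map Polynomial.C (thetaSeries p π)) *
    rescale Polynomial.X (map Polynomial.C (thetaSeries p π))

theorem coeff_frobKernel (m : ℕ) : coeff m (frobKernel p π) =
    ∑ i ∈ Finset.range (m / 3 + 1), Polynomial.C (thetaCoeff p π p i * thetaCoeff p π p (m - 3 * i)) *
      Polynomial.X ^ (m - 3 * i) := by
  rw [frobKernel, coeff_expand_mul_eq_sum]
  refine Finset.sum_congr rfl fun i _ => ?_
  rw [coeff_map, coeff_rescale, coeff_map, coeff_thetaSeries, coeff_thetaSeries,
    Polynomial.C_mul]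
  ring

theorem eval_coeff_frobKernel (a : ℂ_[p]) (m : ℕ) :
    (coeff m (frobKernel p π)).eval a = frobKernelCoeff p π a m := by
  rw [coeff_frobKernel, Polynomial.eval_finsetSum, frobKernelCoeff]
  simp

theorem euler_rescale_thetaSeries :
    euler (rescale (Polynomial.X : Polynomial ℂ_[p]) (map Polynomial.C (thetaSeries p π))) =
      (C (Polynomial.C π * Polynomial.X) * X -
        C (Polynomial.C (p * π) * Polynomial.X ^ p) * X ^ p) *
      rescale (Polynomial.X : Polynomial ℂ_[p]) (map Polynomial.C (thetaSeries p π)) := by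
  rw [euler_rescale, euler_map, euler_thetaSeries]
  simp only [map_mul, map_sub, map_C, map_X, map_pow, rescale_X, rescale_C]
  ring

theorem euler_frobKernel : euler (frobKernel p π) =
    C (Polynomial.C (3 * π)) * (X ^ 3 * frobKernel p π) +
      C (Polynomial.C π * Polynomial.X) * (X ^ 1 * frobKernel p π) -
    (C (Polynomial.C (3 * (p * π))) * (X ^ (3 * p) * frobKernel p π) +
      C (Polynomial.C (p * π) * Polynomial.X ^ p) * (X ^ p * frobKernel p π)) := by
  have h3 : ((3 : ℕ) : PowerSeries (Polynomial ℂ_[p])) = C (Polynomial.C (3 : ℂ_[p])) := by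
    rw [show (3 : ℂ_[p]) = ((3 : ℕ) : ℂ_[p]) by norm_num, map_natCast, map_natCast]
  rw [frobKernel, euler_mul, euler_rescale_thetaSeries, euler_expand, euler_map,
    euler_thetaSeries, h3]
  simp only [map_mul, map_sub, map_C, map_X, map_pow, expand_X, expand_C]
  ring

theorem zcoeff_frobKernel_euler (m : ℤ) : (m : Polynomial ℂ_[p]) * zcoeff (frobKernel p π) m =
    Polynomial.C (3 * π) * zcoeff (frobKernel p π) (m - 3) +
      Polynomial.C π * Polynomial.X * zcoeff (frobKernel p π) (m - 1) -
    (Polynomial.C (3 * (p * π)) * zcoeff (frobKernel p π) (m - 3 * p) +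
      Polynomial.C (p * π) * Polynomial.X ^ p * zcoeff (frobKernel p π) (m - p)) := by
  have h := congrArg (fun f => zcoeff f m) (euler_frobKernel p π)
  simp only [zcoeff_euler, zcoeff_sub, zcoeff_add, zcoeff_C_mul, zcoeff_X_pow_mul] at h
  rw [h]
  push_cast
  rfl

theorem X_mul_derivative_coeff_frobKernel (m : ℕ) :
    Polynomial.X * Polynomial.derivative (coeff m (frobKernel p π)) =
    coeff m (C (Polynomial.C π * Polynomial.X) * (X ^ 1 * frobKernel p π) -
      C (Polynomial.C (p * π) * Polynomial.X ^ p) * (X ^ p * frobKernel p π)) := by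
  have h : C (Polynomial.C π * Polynomial.X) * (X ^ 1 * frobKernel p π) -
      C (Polynomial.C (p * π) * Polynomial.X ^ p) * (X ^ p * frobKernel p π) =
      expand 3 three_ne_zero (map Polynomial.C (thetaSeries p π)) *
      euler (rescale Polynomial.X (map Polynomial.C (thetaSeries p π))) := by
    rw [euler_rescale_thetaSeries, frobKernel]
    ring
  rw [h, coeff_expand_mul_eq_sum, coeff_frobKernel, Polynomial.derivative_sum, Finset.mul_sum]
  refine Finset.sum_congr rfl fun i _ => ?_
  rw [coeff_euler, coeff_map, coeff_rescale, coeff_map, coeff_thetaSeries, coeff_thetaSeries,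
    Polynomial.derivative_C_mul_X_pow]
  rcases Nat.eq_zero_or_pos (m - 3 * i) with h0 | h0
  · rw [h0]; simp
  · obtain ⟨j, hj⟩ : ∃ j, m - 3 * i = j + 1 := ⟨m - 3 * i - 1, by omega⟩
    rw [hj, Nat.add_sub_cancel]
    simp only [Polynomial.C_mul, map_natCast]
    ring

theorem derivative_zcoeff_frobKernel (m : ℤ) :
    Polynomial.derivative (zcoeff (frobKernel p π) m) =
      Polynomial.C π * zcoeff (frobKernel p π) (m - 1) -
      Polynomial.C (p * π) * Polynomial.X ^ (p - 1) * zcoeff (frobKernel p π) (m - p) := by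
  rcases lt_or_ge m 0 with hm | hm
  · rw [zcoeff_of_neg _ hm, zcoeff_of_neg _ (by omega), zcoeff_of_neg _ (by omega)]
    simp
  · lift m to ℕ using hm
    have h := X_mul_derivative_coeff_frobKernel p π m
    rw [← zcoeff_natCast, ← zcoeff_natCast, zcoeff_sub, zcoeff_C_mul, zcoeff_C_mul,
      zcoeff_X_pow_mul, zcoeff_X_pow_mul] at h
    refine mul_left_cancel₀ Polynomial.X_ne_zero (h.trans ?_)
    have hX : (Polynomial.X : Polynomial ℂ_[p]) ^ p = Polynomial.X * Polynomial.X ^ (p - 1) := by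
      rw [← pow_succ', Nat.sub_add_cancel hp.out.one_lt.le]
    rw [hX]
    push_cast
    ring

end FrobeniusKernel

section SplittingFunctionAnalytic

variable {p : ℕ} [hp : Fact p.Prime] {π : ℂ_[p]}

theorem hasPowerSeriesOn_theta (hπ : π ^ (p - 1) = -(p : ℂ_[p])) :
    HasPowerSeriesOn (theta p π 1) (thetaCoeff p π p) (splitRate p)⁻¹ := by
  have h : theta p π 1 = fun t => ∑' n, thetaCoeff p π p n * t ^ n := by
    funext t; rw [theta, pow_one]
  rw [h]
  refine .of_bound fun ρ h1 h2 => ⟨1, fun n => ?_⟩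
  calc _ ≤ splitRate p ^ n * ((splitRate p)⁻¹) ^ n := by
        have := splitRate_pos (p := p)
        gcongr
        exact norm_thetaCoeff_le hπ n
    _ = 1 := by rw [← mul_pow, mul_inv_cancel₀ splitRate_pos.ne', one_pow]

theorem thetaCoeff_zero (π : ℂ_[p]) : thetaCoeff p π p 0 = 1 := by
  simp [thetaCoeff]

theorem theta_zero (hπ : π ^ (p - 1) = -(p : ℂ_[p])) : theta p π 1 0 = 1 := by
  rw [(hasPowerSeriesOn_theta hπ).apply_zero (inv_pos.2 splitRate_pos), thetaCoeff_zero]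

theorem hasDerivAt_theta (hπ : π ^ (p - 1) = -(p : ℂ_[p])) {t : ℂ_[p]}
    (ht : ‖t‖ < (splitRate p)⁻¹) :
    HasDerivAt (theta p π 1) ((π - p * π * t ^ (p - 1)) * theta p π 1 t) t := by
  have hps := hasPowerSeriesOn_theta hπ
  have h := (hps.differentiableAt ht).hasDerivAt
  suffices hd : deriv (theta p π 1) t = (π - p * π * t ^ (p - 1)) * theta p π 1 t by rwa [hd] at h
  have h1 := hps.deriv.2 t ht
  have h2 := hps.2 t ht
  have h3 : HasSum (fun n => (if p - 1 ≤ n then thetaCoeff p π p (n - (p - 1)) * t ^ n else 0))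
      (t ^ (p - 1) * theta p π 1 t) := by
    have := h2.mul_left (t ^ (p - 1))
    have hinj : Function.Injective fun n : ℕ => n + (p - 1) := add_left_injective _
    rw [← hinj.hasSum_iff]
    · refine this.congr_fun fun n => ?_
      simp only [Function.comp_apply]
      rw [if_pos (Nat.le_add_left _ _), Nat.add_sub_cancel]
      ring
    · intro n hn
      rw [if_neg]
      intro hle
      exact hn ⟨n - (p - 1), Nat.sub_add_cancel hle⟩
  have h4 := (h2.mul_left π).sub (h3.mul_left (p * π))
  have h5 := h1.unique (h4.congr_fun fun n => ?_)
  · rw [h5]; ring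
  · have e := congrArg (PowerSeries.coeff (n + 1)) (euler_thetaSeries p π)
    rw [coeff_euler, sub_mul, map_sub, mul_assoc, mul_assoc, PowerSeries.coeff_C_mul,
      PowerSeries.coeff_C_mul, PowerSeries.coeff_succ_X_mul, PowerSeries.coeff_X_pow_mul',
      coeff_thetaSeries, coeff_thetaSeries] at e
    simp only [coeff_thetaSeries] at e
    simp only [e]
    have hp1 := hp.out.one_lt
    by_cases hle : p - 1 ≤ n
    · rw [if_pos (by omega), if_pos hle, show n + 1 - p = n - (p - 1) by omega]
      ring
    · rw [if_neg (by omega), if_neg hle]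
      ring

/-- Since `p` is odd, `t - t ^ p` is an odd function. -/
theorem theta_mul_theta_neg (hπ : π ^ (p - 1) = -(p : ℂ_[p])) (hp2 : p ≠ 2) {t : ℂ_[p]}
    (ht : ‖t‖ < (splitRate p)⁻¹) : theta p π 1 t * theta p π 1 (-t) = 1 := by
  have hodd : Odd p := hp.out.odd_of_ne_two hp2
  -- the formal identity `θ(X) θ(-X) = 1`
  have hformal : thetaSeries p π * PowerSeries.rescale (-1) (thetaSeries p π) = 1 := by
    have h1 : expPow (-π) p hp.out.ne_zero *
        PowerSeries.rescale (-1) (expPow (-π) p hp.out.ne_zero) = 1 := by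
      rw [rescale_expPow, hodd.neg_one_pow, expPow_mul_expPow]
      convert expPow_zero hp.out.ne_zero using 2
      ring
    have h2 : expPow π 1 one_ne_zero * PowerSeries.rescale (-1) (expPow π 1 one_ne_zero) = 1 := by
      rw [rescale_expPow, expPow_mul_expPow]
      convert expPow_zero (K := ℂ_[p]) one_ne_zero using 2
      ring
    rw [thetaSeries, map_mul]
    calc _ = (expPow (-π) p hp.out.ne_zero *
        PowerSeries.rescale (-1) (expPow (-π) p hp.out.ne_zero)) *
        (expPow π 1 one_ne_zero * PowerSeries.rescale (-1) (expPow π 1 one_ne_zero)) := by ring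
      _ = 1 := by rw [h1, h2, one_mul]
  have hps := hasPowerSeriesOn_theta hπ
  have s1 := summable_norm_of_forall_bound hps.1 ht
  have s2 := summable_norm_of_forall_bound hps.1 (a := -t) (by rwa [norm_neg])
  have h := tsum_mul_tsum_eq_tsum_sum_antidiagonal_of_summable_norm s1 s2
  rw [(hps.2 t ht).tsum_eq, (hps.2 (-t) (by rwa [norm_neg])).tsum_eq] at h
  rw [h]
  have hterm : ∀ n, ∑ x ∈ Finset.HasAntidiagonal.antidiagonal n, thetaCoeff p π p x.1 * t ^ x.1 *
      (thetaCoeff p π p x.2 * (-t) ^ x.2) = if n = 0 then 1 else 0 := by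
    intro n
    have := congrArg (PowerSeries.coeff n) hformal
    rw [PowerSeries.coeff_mul, PowerSeries.coeff_one] at this
    calc _ = t ^ n * ∑ x ∈ Finset.HasAntidiagonal.antidiagonal n,
          PowerSeries.coeff x.1 (thetaSeries p π) *
          PowerSeries.coeff x.2 (PowerSeries.rescale (-1) (thetaSeries p π)) := by
          rw [Finset.mul_sum]
          refine Finset.sum_congr rfl fun x hx => ?_
          rw [Finset.HasAntidiagonal.mem_antidiagonal] at hx
          rw [PowerSeries.coeff_rescale, coeff_thetaSeries, coeff_thetaSeries, ← hx, neg_pow t,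
            pow_add]
          ring
      _ = _ := by
          rw [this]
          split_ifs with h0 <;> simp [h0]
  simp only [hterm]
  exact tsum_ite_eq 0 _

end SplittingFunctionAnalytic


/-! ### Series of polynomials -/

section PolynomialSeries

open Polynomial

variable {K : Type*} [NontriviallyNormedField K]

/-- The Gauss norm of `P` on the disc of radius `ρ` is at most `C`. -/
def GaussBound (ρ : ℝ) (P : K[X]) (C : ℝ) : Prop := ∀ n, ‖P.coeff n‖ * ρ ^ n ≤ C

theorem GaussBound.nonneg {ρ C : ℝ} {P : K[X]} (h : GaussBound ρ P C) : 0 ≤ C :=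
  (by positivity : 0 ≤ ‖P.coeff 0‖ * ρ ^ 0).trans (h 0)

theorem GaussBound.mono {ρ C D : ℝ} {P : K[X]} (h : GaussBound ρ P C) (hCD : C ≤ D) :
    GaussBound ρ P D := fun n => (h n).trans hCD

theorem gaussBound_zero {ρ C : ℝ} (hC : 0 ≤ C) : GaussBound ρ (0 : K[X]) C := fun n => by
  simpa using hC

theorem gaussBound_C_mul_X_pow {ρ C : ℝ} (hC : 0 ≤ C) (c : K) (k : ℕ) (h : ‖c‖ * ρ ^ k ≤ C) :
    GaussBound ρ (Polynomial.C c * X ^ k) C := fun n => by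
  rw [coeff_C_mul_X_pow]
  split_ifs with hn
  · rwa [hn]
  · simpa using hC

theorem GaussBound.expand {ρ C : ℝ} {P : K[X]} {k : ℕ} (hk : 0 < k) (h : GaussBound (ρ ^ k) P C) :
    GaussBound ρ (Polynomial.expand K k P) C := fun n => by
  rw [coeff_expand hk]
  split_ifs with hn
  · obtain ⟨m, rfl⟩ := hn
    rw [Nat.mul_div_cancel_left _ hk, pow_mul]
    exact h m
  · simpa using h.nonneg

variable [IsUltrametricDist K]

theorem GaussBound.sub {ρ C : ℝ} (hρ : 0 ≤ ρ) {P Q : K[X]} (hP : GaussBound ρ P C)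
    (hQ : GaussBound ρ Q C) : GaussBound ρ (P - Q) C := fun n => by
  have := IsUltrametricDist.norm_add_le_max (P.coeff n) (-Q.coeff n)
  rw [norm_neg, ← sub_eq_add_neg] at this
  rw [coeff_sub]
  calc _ ≤ max ‖P.coeff n‖ ‖Q.coeff n‖ * ρ ^ n := by gcongr
    _ = max (‖P.coeff n‖ * ρ ^ n) (‖Q.coeff n‖ * ρ ^ n) := max_mul_of_nonneg _ _ (by positivity)
    _ ≤ _ := max_le (hP n) (hQ n)

theorem gaussBound_sum {ι : Type*} {ρ C : ℝ} (hρ : 0 < ρ) (hC : 0 ≤ C) (s : Finset ι)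
    (P : ι → K[X]) (h : ∀ i ∈ s, GaussBound ρ (P i) C) : GaussBound ρ (∑ i ∈ s, P i) C := by
  intro n
  rw [finsetSum_coeff, ← le_div_iff₀ (by positivity)]
  refine IsUltrametricDist.norm_sum_le_of_forall_le_of_nonneg (by positivity) fun i hi => ?_
  rw [le_div_iff₀ (by positivity)]
  exact h i hi n

theorem GaussBound.mul {ρ C D : ℝ} (hρ : 0 < ρ) {P Q : K[X]} (hP : GaussBound ρ P C)
    (hQ : GaussBound ρ Q D) : GaussBound ρ (P * Q) (C * D) := fun n => by
  have hC := hP.nonneg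
  have hD := hQ.nonneg
  rw [coeff_mul, ← le_div_iff₀ (by positivity)]
  refine IsUltrametricDist.norm_sum_le_of_forall_le_of_nonneg (by positivity) fun x hx => ?_
  rw [Finset.HasAntidiagonal.mem_antidiagonal] at hx
  rw [le_div_iff₀ (by positivity), norm_mul, ← hx, pow_add]
  calc _ = (‖P.coeff x.1‖ * ρ ^ x.1) * (‖Q.coeff x.2‖ * ρ ^ x.2) := by ring
    _ ≤ C * D := by gcongr; exacts [hP _, hQ _]

theorem GaussBound.derivative {ρ C : ℝ} (hρ : 0 < ρ) {P : K[X]} (hP : GaussBound ρ P C) :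
    GaussBound ρ (Polynomial.derivative P) (C / ρ) := fun n => by
  rw [coeff_derivative, le_div_iff₀ hρ, norm_mul]
  have h1 : ‖(n : K) + 1‖ ≤ 1 := by
    exact_mod_cast IsUltrametricDist.norm_natCast_le_one K (n + 1)
  calc _ ≤ ‖P.coeff (n + 1)‖ * 1 * ρ ^ n * ρ := by gcongr
    _ = ‖P.coeff (n + 1)‖ * ρ ^ (n + 1) := by ring
    _ ≤ C := hP _

theorem GaussBound.norm_eval_le {ρ C : ℝ} {P : K[X]} (hP : GaussBound ρ P C) {a : K}
    (ha : ‖a‖ ≤ ρ) : ‖P.eval a‖ ≤ C := by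
  rw [eval_eq_sum_range]
  refine IsUltrametricDist.norm_sum_le_of_forall_le_of_nonneg hP.nonneg fun n _ => ?_
  rw [norm_mul, norm_pow]
  exact le_trans (by gcongr) (hP n)

variable [CompleteSpace K]

/-- A series of polynomials that converges geometrically in every Gauss norm of radius `ρ < R`
sums to a power series on the disc of radius `R`. -/
theorem hasPowerSeriesOn_tsum_eval {P : ℕ → K[X]} {R : ℝ}
    (h : ∀ ρ : ℝ, 0 < ρ → ρ < R → ∃ C q : ℝ, 0 ≤ q ∧ q < 1 ∧ ∀ r, GaussBound ρ (P r) (C * q ^ r)) :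
    HasPowerSeriesOn (fun a => ∑' r, (P r).eval a) (fun n => ∑' r, (P r).coeff n) R := by
  refine ⟨fun ρ h1 h2 => ?_, fun a ha => ?_⟩
  · obtain ⟨C, q, hq0, hq1, hC⟩ := h ρ h1 h2
    have hC0 : 0 ≤ C := by simpa using (hC 0).nonneg
    refine ⟨C, fun n => ?_⟩
    rw [← le_div_iff₀ (by positivity)]
    refine IsUltrametricDist.norm_tsum_le_of_forall_le_of_nonneg (by positivity) fun r => ?_
    rw [le_div_iff₀ (by positivity)]
    exact (hC r n).trans (mul_le_of_le_one_right hC0 (pow_le_one₀ hq0 hq1.le))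
  · obtain ⟨ρ, h1, h2⟩ := exists_between ha
    have hρ : 0 < ρ := (norm_nonneg a).trans_lt h1
    obtain ⟨C, q, hq0, hq1, hC⟩ := h ρ hρ h2
    have hC0 : 0 ≤ C := by simpa using (hC 0).nonneg
    have hsum : Summable fun x : ℕ × ℕ => (P x.2).coeff x.1 * a ^ x.1 := by
      have hg1 := summable_geometric_of_lt_one (r := ‖a‖ / ρ) (by positivity) ((div_lt_one hρ).2 h1)
      have hg2 := (summable_geometric_of_lt_one hq0 hq1).mul_left C
      refine Summable.of_norm_bounded (hg1.mul_of_nonneg hg2 (fun _ => by positivity)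
        (fun _ => by positivity)) fun x => ?_
      rw [norm_mul, norm_pow, div_pow, div_mul_eq_mul_div, le_div_iff₀ (by positivity)]
      calc _ = (‖(P x.2).coeff x.1‖ * ρ ^ x.1) * ‖a‖ ^ x.1 := by ring
        _ ≤ (C * q ^ x.2) * ‖a‖ ^ x.1 :=
          mul_le_mul_of_nonneg_right (hC _ _) (by positivity)
        _ = _ := by ring
    have hfib : ∀ r, HasSum (fun n => (P r).coeff n * a ^ n) ((P r).eval a) := fun r => by
      rw [eval_eq_sum_range]
      refine hasSum_sum_of_ne_finset_zero fun n hn => ?_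
      rw [coeff_eq_zero_of_natDegree_lt (by simpa using hn), zero_mul]
    have hs' : Summable fun x : ℕ × ℕ => (P x.1).coeff x.2 * a ^ x.2 :=
      (Equiv.prodComm ℕ ℕ).summable_iff.1 hsum
    have e1 : ∑' r, (P r).eval a = ∑' x : ℕ × ℕ, (P x.2).coeff x.1 * a ^ x.1 := by
      rw [← (Equiv.prodComm ℕ ℕ).tsum_eq]
      exact (hs'.hasSum.prod_fiberwise hfib).tsum_eq
    simp only [e1]
    refine (hsum.hasSum.prod_fiberwise fun n => (hsum.prod_factor n).hasSum).congr_fun fun n => ?_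
    rw [← tsum_mul_right]

theorem hasDerivAt_tsum_eval {P : ℕ → K[X]} {R : ℝ}
    (h : ∀ ρ : ℝ, 0 < ρ → ρ < R → ∃ C q : ℝ, 0 ≤ q ∧ q < 1 ∧ ∀ r, GaussBound ρ (P r) (C * q ^ r))
    {a : K} (ha : ‖a‖ < R) :
    HasDerivAt (fun a => ∑' r, (P r).eval a) (∑' r, (derivative (P r)).eval a) a := by
  have h1 := hasPowerSeriesOn_tsum_eval h
  have h2 : HasPowerSeriesOn (fun a => ∑' r, (derivative (P r)).eval a)
      (fun n => ∑' r, (derivative (P r)).coeff n) R := by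
    refine hasPowerSeriesOn_tsum_eval fun ρ hρ hρR => ?_
    obtain ⟨C, q, hq0, hq1, hC⟩ := h ρ hρ hρR
    exact ⟨C / ρ, q, hq0, hq1, fun r => by
      simpa [div_mul_eq_mul_div] using (hC r).derivative hρ⟩
  have h3 := (h1.differentiableAt ha).hasDerivAt
  suffices e : _root_.deriv (fun a => ∑' r, (P r).eval a) a = ∑' r, (derivative (P r)).eval a by
    rwa [e] at h3
  refine (h1.deriv.2 a ha).unique ((h2.2 a ha).congr_fun fun n => ?_)
  simp only [coeff_derivative]
  rw [tsum_mul_right]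
  push_cast
  ring

end PolynomialSeries


/-! ### The dual cohomology and its Frobenius -/

section DualCohomology

open Polynomial

variable {p : ℕ} [hp : Fact p.Prime] {π : ℂ_[p]}

/-- The coefficients of the basis series `g_j^*(a)`, as polynomials in `a`. -/
noncomputable def dualBasisPoly (π : ℂ_[p]) (j : Fin 2) : ℕ → ℂ_[p][X]
  | 0 => 0
  | 1 => if j = 0 then 1 else 0
  | 2 => if j = 1 then 1 else 0
  | n + 3 => -(C (n / (3 * π)) * dualBasisPoly π j n) - C (1 / 3) * X * dualBasisPoly π j (n + 1)

/-- The induction principle matching the recursion for the coefficients of a dual cocycle, which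
involves the indices `n`, `n + 1` and `n + 3`. -/
theorem lacunaryInduction {P : ℕ → Prop} (case1 : P 0) (case2 : P 1) (case3 : P 2)
    (case4 : ∀ n, P n → P (n + 1) → P (n + 3)) (n : ℕ) : P n := by
  induction n using Nat.strong_induction_on with
  | _ n ih =>
    match n with
    | 0 => exact case1
    | 1 => exact case2
    | 2 => exact case3
    | n + 3 => exact case4 n (ih n (by omega)) (ih (n + 1) (by omega))

theorem eval_dualBasisPoly (π a : ℂ_[p]) (j : Fin 2) (n : ℕ) :
    (dualBasisPoly π j n).eval a = dualBasis p π a j n := by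
  induction n using lacunaryInduction with
  | case1 => simp [dualBasisPoly, dualBasis]
  | case2 => simp only [dualBasisPoly, dualBasis]; split_ifs <;> simp
  | case3 => simp only [dualBasisPoly, dualBasis]; split_ifs <;> simp
  | case4 n ih1 ih2 =>
    rw [dualBasisPoly, dualBasis, ← ih1, ← ih2]
    simp only [eval_sub, eval_neg, eval_mul, eval_C, eval_X]
    ring

theorem norm_three (hp5 : 5 ≤ p) : ‖(3 : ℂ_[p])‖ = 1 := by
  have := norm_natCast_of_not_dvd p (n := 3) (fun h => by
    have := Nat.le_of_dvd (by norm_num) h; omega)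
  simpa using this

theorem norm_two (hp5 : 5 ≤ p) : ‖(2 : ℂ_[p])‖ = 1 := by
  have := norm_natCast_of_not_dvd p (n := 2) (fun h => by
    have := Nat.le_of_dvd (by norm_num) h; omega)
  simpa using this

theorem gaussBound_dualBasisPoly (hp5 : 5 ≤ p) {β ρ : ℝ} (hβ : 1 ≤ β) (hρ0 : 0 < ρ)
    (hρ : ρ ≤ β ^ 2) (hπβ : ‖π‖⁻¹ ≤ β ^ 3) (j : Fin 2) (n : ℕ) :
    GaussBound ρ (dualBasisPoly π j n) (β ^ n) := by
  have h01 : ∀ (c : Prop) [Decidable c] (n : ℕ),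
      GaussBound ρ (if c then (1 : ℂ_[p][X]) else 0) (β ^ n) := by
    intro c _ n
    split_ifs
    · have := gaussBound_C_mul_X_pow (ρ := ρ) (C := β ^ n) (by positivity) (1 : ℂ_[p]) 0
        (by simpa using one_le_pow₀ hβ)
      simpa using this
    · exact gaussBound_zero (by positivity)
  induction n using lacunaryInduction with
  | case1 => exact gaussBound_zero (by positivity)
  | case2 => rw [dualBasisPoly]; exact h01 _ 1
  | case3 => rw [dualBasisPoly]; exact h01 _ 2
  | case4 n ih1 ih2 =>
    rw [dualBasisPoly]
    refine GaussBound.sub hρ0.le ?_ ?_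
    · have h1 := (gaussBound_C_mul_X_pow (ρ := ρ) (C := β ^ 3) (by positivity)
        (-((n : ℂ_[p]) / (3 * π))) 0 (by
          rw [norm_neg, norm_div, norm_mul, norm_three hp5, one_mul, pow_zero, mul_one]
          calc _ ≤ 1 / ‖π‖ := by gcongr; exact IsUltrametricDist.norm_natCast_le_one _ n
            _ ≤ β ^ 3 := by rwa [one_div])).mul hρ0 ih1
      rw [← pow_add, add_comm] at h1
      simpa using h1
    · have h1 := (gaussBound_C_mul_X_pow (ρ := ρ) (C := β ^ 2) (by positivity)
        (1 / 3 : ℂ_[p]) 1 (by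
          rw [norm_div, norm_three hp5, norm_one, div_one, one_mul, pow_one]
          exact hρ)).mul hρ0 ih2
      rw [← pow_add, show 2 + (n + 1) = n + 3 by ring, pow_one] at h1
      exact h1

theorem norm_dualBasis_le (hp5 : 5 ≤ p) {β : ℝ} (hβ : 1 ≤ β) (hπβ : ‖π‖⁻¹ ≤ β ^ 3) {a : ℂ_[p]}
    (ha : ‖a‖ ≤ β ^ 2) (j : Fin 2) (n : ℕ) : ‖dualBasis p π a j n‖ ≤ β ^ n := by
  rw [← eval_dualBasisPoly]
  exact (gaussBound_dualBasisPoly hp5 hβ (by positivity) le_rfl hπβ j n).norm_eval_le ha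

/-- The derivative in `a` of the basis series, that is, the connection on the dual space in the
basis `g_1^*, g_2^*`, up to constant terms. -/
theorem derivative_dualBasisPoly (hπ : π ≠ 0) (n : ℕ) :
    (1 ≤ n → derivative (dualBasisPoly π 0 n) =
      C π * dualBasisPoly π 0 (n + 1) + C (π / 3) * X * dualBasisPoly π 1 n) ∧
    (1 ≤ n → derivative (dualBasisPoly π 1 n) =
      C π * dualBasisPoly π 1 (n + 1) - C π * dualBasisPoly π 0 n) := by
  have hC : C π * C (1 / 3 : ℂ_[p]) = C (π / 3) := by rw [← C_mul]; congr 1; ring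
  have hC2 : ∀ n : ℕ, C π * C ((n : ℂ_[p]) / (3 * π)) = C ((n : ℂ_[p]) / 3) := fun n => by
    rw [← C_mul]; congr 1; field_simp
  induction n using lacunaryInduction with
  | case1 => simp
  | case2 => simp [dualBasisPoly]
  | case3 =>
    simp only [dualBasisPoly]
    refine ⟨fun _ => ?_, fun _ => ?_⟩
    · simp [← hC]; ring
    · simp
  | case4 n ih1 ih2 =>
    obtain ⟨ih1a, ih1b⟩ := ih1
    obtain ⟨ih2a, ih2b⟩ := ih2
    have e : ∀ j, dualBasisPoly π j (n + 3 + 1) = -(C (((n + 1 : ℕ) : ℂ_[p]) / (3 * π)) *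
        dualBasisPoly π j (n + 1)) - C (1 / 3) * X * dualBasisPoly π j (n + 2) :=
      fun j => by rw [dualBasisPoly]
    have hn1 : C π * C (((n + 1 : ℕ) : ℂ_[p]) / (3 * π)) =
        C π * C ((n : ℂ_[p]) / (3 * π)) + C (1 / 3) := by
      rw [hC2, hC2, ← C_add]; congr 1; push_cast; ring
    rcases Nat.eq_zero_or_pos n with rfl | hn
    · have h1 : C π * C π⁻¹ = 1 := by rw [← C_mul, mul_inv_cancel₀ hπ, C_1]
      refine ⟨fun _ => ?_, fun _ => ?_⟩
      · rw [e]
        simp only [dualBasisPoly, ← hC]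
        simp [← mul_assoc, h1]
      · rw [e]
        simp [dualBasisPoly]
    · refine ⟨fun _ => ?_, fun _ => ?_⟩
      · rw [e, dualBasisPoly, dualBasisPoly]
        simp only [derivative_sub, derivative_neg, derivative_mul,
          derivative_X, derivative_C, ih1a hn, ih2a (by omega)]
        linear_combination (dualBasisPoly π 0 (n + 1)) * hn1
      · rw [e, dualBasisPoly, dualBasisPoly]
        simp only [derivative_sub, derivative_neg, derivative_mul,
          derivative_X, derivative_C, ih1b hn, ih2b (by omega)]
        linear_combination (dualBasisPoly π 1 (n + 1)) * hn1

theorem dualD_dualBasis (hπ : π ≠ 0) (a : ℂ_[p]) (j : Fin 2) :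
    dualD p π a (dualBasis p π a j) = 0 := by
  funext n
  simp only [dualD, LinearMap.coe_mk, AddHom.coe_mk, Pi.zero_apply, dualBasis]
  field_simp
  ring

theorem dualD_oneSeries (a : ℂ_[p]) : dualD p π a (oneSeries p) = 0 := by
  funext n
  rcases n with _ | n <;> simp [dualD, oneSeries]

/-- A series killed by `D_a^*` is determined by its first three coefficients. -/
theorem eq_of_dualD_eq_zero (hπ : π ≠ 0) {a : ℂ_[p]} {B : ℕ → ℂ_[p]} (hB : dualD p π a B = 0) :
    B = B 0 • oneSeries p + (B 1 • dualBasis p π a 0 + B 2 • dualBasis p π a 1) := by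
  have h : ∀ n, B (n + 3) = -(n / (3 * π)) * B n - a / 3 * B (n + 1) := by
    intro n
    have := congrFun hB n
    simp only [dualD, LinearMap.coe_mk, AddHom.coe_mk, Pi.zero_apply] at this
    field_simp
    linear_combination this
  funext n
  induction n using lacunaryInduction with
  | case1 => simp [oneSeries, dualBasis]
  | case2 => simp [oneSeries, dualBasis]
  | case3 => simp [oneSeries, dualBasis]
  | case4 n ih1 ih2 =>
    rw [h]
    rcases n with _ | n
    · simp [oneSeries, dualBasis]
      ring
    · rw [ih1, ih2]
      simp [oneSeries, dualBasis]
      ring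

theorem linearIndependent_dualBasis (a : ℂ_[p]) :
    LinearIndependent ℂ_[p] ![oneSeries p, dualBasis p π a 0, dualBasis p π a 1] := by
  rw [Fintype.linearIndependent_iff]
  intro c hc
  simp only [Fin.sum_univ_three, Matrix.cons_val_zero, Matrix.cons_val_one,
    Matrix.cons_val] at hc
  have h0 := congrFun hc 0
  have h1 := congrFun hc 1
  have h2 := congrFun hc 2
  simp [oneSeries, dualBasis] at h0 h1 h2
  intro i
  fin_cases i <;> simp [h0, h1, h2]

theorem mem_dualCochain {b : ℝ} {B : ℕ → ℂ_[p]} {C : ℝ}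
    (h : ∀ n : ℕ, ‖B n‖ ≤ C * ((p : ℝ) ^ (b / 3)) ^ n) : B ∈ dualCochain p b := by
  refine ⟨C, fun n => (h n).trans (le_of_eq ?_)⟩
  rw [← Real.rpow_mul_natCast (Nat.cast_nonneg p)]
  ring_nf

theorem exists_bound_of_mem_dualCochain {b : ℝ} {B : ℕ → ℂ_[p]} (h : B ∈ dualCochain p b) :
    ∃ C : ℝ, ∀ n : ℕ, ‖B n‖ ≤ C * ((p : ℝ) ^ (b / 3)) ^ n := by
  obtain ⟨C, hC⟩ := h
  refine ⟨C, fun n => (hC n).trans (le_of_eq ?_)⟩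
  rw [← Real.rpow_mul_natCast (Nat.cast_nonneg p)]
  ring_nf

theorem span_dualBasis_eq (hp5 : 5 ≤ p) (hπ : π ≠ 0) {b : ℝ} (hb : 0 ≤ b)
    (hπβ : ‖π‖⁻¹ ≤ ((p : ℝ) ^ (b / 3)) ^ 3) {a : ℂ_[p]} (ha : ‖a‖ ≤ ((p : ℝ) ^ (b / 3)) ^ 2) :
    Submodule.span ℂ_[p] {oneSeries p, dualBasis p π a 0, dualBasis p π a 1} =
      dualKernel p π b a := by
  have hβ : 1 ≤ (p : ℝ) ^ (b / 3) :=
    Real.one_le_rpow (by exact_mod_cast hp.out.one_lt.le) (by positivity)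
  have hmem : ∀ j, dualBasis p π a j ∈ dualKernel p π b a := fun j =>
    ⟨mem_dualCochain (C := 1) fun n => by
      rw [one_mul]; exact norm_dualBasis_le hp5 hβ hπβ ha j n, dualD_dualBasis hπ a j⟩
  refine le_antisymm (Submodule.span_le.2 ?_) fun B hB => ?_
  · rintro B (rfl | rfl | rfl)
    · refine ⟨mem_dualCochain (C := 1) fun n => ?_, dualD_oneSeries a⟩
      rw [one_mul]
      refine le_trans ?_ (one_le_pow₀ hβ)
      rcases n with _ | n <;> simp [oneSeries]
    · exact hmem 0
    · exact hmem 1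
  · rw [eq_of_dualD_eq_zero hπ hB.2]
    refine add_mem (Submodule.smul_mem _ _ (Submodule.subset_span (by simp)))
      (add_mem (Submodule.smul_mem _ _ (Submodule.subset_span (by simp)))
        (Submodule.smul_mem _ _ (Submodule.subset_span (by simp))))

end DualCohomology


section DualFrobenius

open Polynomial

variable {p : ℕ} [hp : Fact p.Prime] {π : ℂ_[p]}

theorem frobTerm_eq (π a : ℂ_[p]) (B : ℕ → ℂ_[p]) (n r : ℕ) :
    (if n ≤ p * r then frobKernelCoeff p π a (p * r - n) * B r else 0) =
      (zcoeff (frobKernel p π) ((p : ℤ) * r - n)).eval a * B r := by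
  split_ifs with h
  · rw [← eval_coeff_frobKernel, ← zcoeff_natCast, Nat.cast_sub h, Nat.cast_mul]
  · rw [zcoeff_of_neg _ (by have : p * r < n := by omega
                            have : (p : ℤ) * r < n := by exact_mod_cast this
                            omega)]
    simp

theorem dualFrobenius_apply (π a : ℂ_[p]) (B : ℕ → ℂ_[p]) (n : ℕ) :
    dualFrobenius p π a B n =
      ∑' r : ℕ, (zcoeff (frobKernel p π) ((p : ℤ) * r - n)).eval a * B r := by
  simp only [dualFrobenius, frobTerm_eq]

/-- Numerical conditions on rates `ρ, σ` and `β`: for `‖a‖ ≤ ρ` the kernel coefficients decay like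
`σ ^ m`, and this beats growth like `β ^ r` after the substitution `x ↦ x ^ p`. -/
structure FrobRates (p : ℕ) (β ρ σ : ℝ) : Prop where
  one_le : 1 ≤ β
  rho_pos : 0 < ρ
  sigma_pos : 0 < σ
  rho_pow_le : ρ ^ p ≤ β ^ 2
  rate_le : splitRate p ≤ σ ^ 3
  rate_mul_le : splitRate p * ρ ≤ σ
  lt_one : σ ^ p * β < 1

/-- A term `x ^ k` of `θ(x ^ 3) θ(a x)` is a product of terms of degrees `i` and `j` in the two
factors, with `3 i + j = k`, so its coefficient is at most `τ ^ i (τ ρ) ^ j ≤ σ ^ k`. -/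
theorem gaussBound_frobKernel (hπ : π ^ (p - 1) = -(p : ℂ_[p])) {β ρ σ : ℝ}
    (h : FrobRates p β ρ σ) (k : ℤ) : GaussBound ρ (zcoeff (frobKernel p π) k) (σ ^ k) := by
  have hσ := h.sigma_pos
  have hρ := h.rho_pos
  have hτ := splitRate_pos (p := p)
  rcases lt_or_ge k 0 with hk | hk
  · rw [zcoeff_of_neg _ hk]
    exact gaussBound_zero (by positivity)
  · lift k to ℕ using hk
    rw [zcoeff_natCast, coeff_frobKernel, zpow_natCast]
    refine gaussBound_sum hρ (by positivity) _ _ fun i hi => ?_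
    refine gaussBound_C_mul_X_pow (by positivity) _ _ ?_
    have h1 : 3 * i + (k - 3 * i) = k := by rw [Finset.mem_range] at hi; omega
    rw [norm_mul]
    calc _ ≤ splitRate p ^ i * splitRate p ^ (k - 3 * i) * ρ ^ (k - 3 * i) := by
          gcongr <;> exact norm_thetaCoeff_le hπ _
      _ = splitRate p ^ i * (splitRate p * ρ) ^ (k - 3 * i) := by rw [mul_pow]; ring
      _ ≤ (σ ^ 3) ^ i * σ ^ (k - 3 * i) := by
          gcongr
          exacts [h.rate_le, h.rate_mul_le]
      _ = σ ^ k := by rw [← pow_mul, ← pow_add, h1]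

theorem norm_zcoeff_mul_le (hπ : π ^ (p - 1) = -(p : ℂ_[p])) {β ρ σ : ℝ}
    (h : FrobRates p β ρ σ) {a : ℂ_[p]} (ha : ‖a‖ ≤ ρ) {B : ℕ → ℂ_[p]} {C : ℝ}
    (hB : ∀ n, ‖B n‖ ≤ C * β ^ n) (k : ℤ) (r : ℕ) :
    ‖(zcoeff (frobKernel p π) ((p : ℤ) * r - k)).eval a * B r‖ ≤
      σ ^ (-k) * C * (σ ^ p * β) ^ r := by
  have hσ := h.sigma_pos
  rw [norm_mul]
  calc _ ≤ σ ^ ((p : ℤ) * r - k) * (C * β ^ r) := by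
        gcongr
        · exact (gaussBound_frobKernel hπ h _).norm_eval_le ha
        · exact hB r
    _ = _ := by
        rw [zpow_sub₀ hσ.ne', zpow_mul, zpow_neg, zpow_natCast, zpow_natCast, mul_pow]
        field_simp

theorem summable_frobTerm (hπ : π ^ (p - 1) = -(p : ℂ_[p])) {β ρ σ : ℝ}
    (h : FrobRates p β ρ σ) {a : ℂ_[p]} (ha : ‖a‖ ≤ ρ) {B : ℕ → ℂ_[p]} {C : ℝ}
    (hB : ∀ n, ‖B n‖ ≤ C * β ^ n) (k : ℤ) :
    Summable fun r : ℕ => (zcoeff (frobKernel p π) ((p : ℤ) * r - k)).eval a * B r := by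
  have := h.one_le
  have := h.sigma_pos
  exact Summable.of_norm_bounded
    ((summable_geometric_of_lt_one (by positivity) h.lt_one).mul_left _)
    fun r => norm_zcoeff_mul_le hπ h ha hB k r

theorem norm_dualFrobenius_le (hπ : π ^ (p - 1) = -(p : ℂ_[p])) {β ρ σ : ℝ}
    (h : FrobRates p β ρ σ) {a : ℂ_[p]} (ha : ‖a‖ ≤ ρ) {B : ℕ → ℂ_[p]} {C : ℝ}
    (hB : ∀ n, ‖B n‖ ≤ C * β ^ n) (n : ℕ) : ‖dualFrobenius p π a B n‖ ≤ C * β ^ n := by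
  have hσ := h.sigma_pos
  have hβ := h.one_le
  have hC : 0 ≤ C := by simpa using (norm_nonneg _).trans (hB 0)
  rw [dualFrobenius]
  refine IsUltrametricDist.norm_tsum_le_of_forall_le_of_nonneg (by positivity) fun r => ?_
  split_ifs with hn
  · have h1 := (gaussBound_frobKernel hπ h ((p * r - n : ℕ) : ℤ)).norm_eval_le ha
    rw [zcoeff_natCast, eval_coeff_frobKernel, zpow_natCast] at h1
    -- compare the `p`-th powers, using `σ ^ p ≤ β⁻¹`
    have h2 : σ ^ (p * r - n) * β ^ r ≤ β ^ n := by
      refine (pow_le_pow_iff_left₀ (by positivity) (by positivity) hp.out.ne_zero).1 ?_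
      have h3 : (σ ^ (p * r - n) * β ^ r) ^ p = (σ ^ p * β) ^ (p * r - n) * β ^ n := by
        have : p * r = (p * r - n) + n := by omega
        calc _ = (σ ^ p) ^ (p * r - n) * β ^ (p * r) := by ring
          _ = (σ ^ p) ^ (p * r - n) * (β ^ (p * r - n) * β ^ n) := by
              rw [← pow_add, ← this]
          _ = _ := by rw [mul_pow]; ring
      rw [h3]
      calc _ ≤ 1 * β ^ n := by
            gcongr
            exact pow_le_one₀ (by positivity) h.lt_one.le
        _ ≤ (β ^ n) ^ p := by
            rw [one_mul]
            exact le_self_pow₀ (one_le_pow₀ hβ) hp.out.ne_zero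
    rw [norm_mul]
    calc _ ≤ σ ^ (p * r - n) * (C * β ^ r) := by gcongr; exact hB r
      _ = C * (σ ^ (p * r - n) * β ^ r) := by ring
      _ ≤ _ := by gcongr
  · rw [norm_zero]; positivity

theorem tsum_frobTerm_shift (π a : ℂ_[p]) (B : ℕ → ℂ_[p]) (n m : ℕ)
    (hs : Summable fun r : ℕ => (zcoeff (frobKernel p π) ((p : ℤ) * r - (n + p * m))).eval a * B r) :
    ∑' r : ℕ, (zcoeff (frobKernel p π) ((p : ℤ) * r - (n + p * m))).eval a * B r =
      ∑' r : ℕ, (zcoeff (frobKernel p π) ((p : ℤ) * r - n)).eval a * B (r + m) := by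
  rw [← hs.sum_add_tsum_nat_add m, Finset.sum_eq_zero]
  · rw [zero_add]
    refine tsum_congr fun r => ?_
    congr 3
    push_cast
    ring
  · intro r hr
    rw [Finset.mem_range] at hr
    rw [zcoeff_of_neg]
    · simp
    · have h1 : (r : ℤ) < m := by exact_mod_cast hr
      have h2 : (0 : ℤ) < p := by exact_mod_cast hp.out.pos
      nlinarith

/-- `D_a^* ∘ α_a^* = p α_a^* ∘ D_{a^p}^*`, applied to a series killed by `D_{a^p}^*`. -/
theorem dualD_dualFrobenius (hπ : π ^ (p - 1) = -(p : ℂ_[p])) {β ρ σ : ℝ}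
    (h : FrobRates p β ρ σ) {a : ℂ_[p]} (ha : ‖a‖ ≤ ρ) {B : ℕ → ℂ_[p]} {C : ℝ}
    (hB : ∀ n, ‖B n‖ ≤ C * β ^ n) (hD : dualD p π (a ^ p) B = 0) :
    dualD p π a (dualFrobenius p π a B) = 0 := by
  have hβ := h.one_le
  have hC : 0 ≤ C := by simpa using (norm_nonneg _).trans (hB 0)
  have hs := summable_frobTerm hπ h ha hB
  funext n
  simp only [dualD, LinearMap.coe_mk, AddHom.coe_mk, Pi.zero_apply, dualFrobenius_apply]
  have hBr : ∀ n : ℕ, ‖(n : ℂ_[p]) * B n‖ ≤ C * β ^ n := fun n => by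
    rw [norm_mul]
    calc _ ≤ 1 * (C * β ^ n) := by
          gcongr
          · exact IsUltrametricDist.norm_natCast_le_one _ n
          · exact hB n
      _ = _ := one_mul _
  have hBs : ∀ m n, ‖B (n + m)‖ ≤ (C * β ^ m) * β ^ n := fun m n =>
    (hB _).trans (by rw [pow_add]; apply le_of_eq; ring)
  -- the differential equation of the kernel
  have key : ∀ r : ℕ, (n : ℂ_[p]) *
      ((zcoeff (frobKernel p π) ((p : ℤ) * r - n)).eval a * B r) +
      π * (3 * ((zcoeff (frobKernel p π) ((p : ℤ) * r - (n + 3 : ℕ))).eval a * B r) +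
        a * ((zcoeff (frobKernel p π) ((p : ℤ) * r - (n + 1 : ℕ))).eval a * B r)) =
      p * ((zcoeff (frobKernel p π) ((p : ℤ) * r - n)).eval a * (r * B r) +
      π * (3 * ((zcoeff (frobKernel p π) ((p : ℤ) * r - (n + p * (3 : ℕ)))).eval a * B r) +
        a ^ p * ((zcoeff (frobKernel p π) ((p : ℤ) * r - (n + p * (1 : ℕ)))).eval a * B r))) := by
    intro r
    have e := congrArg (eval a) (zcoeff_frobKernel_euler p π ((p : ℤ) * r - n))
    simp only [eval_mul, eval_add, eval_sub, eval_C, eval_X, eval_pow, eval_intCast] at e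
    rw [show (p : ℤ) * r - n - 3 = (p : ℤ) * r - (n + 3 : ℕ) by push_cast; ring,
      show (p : ℤ) * r - n - 1 = (p : ℤ) * r - (n + 1 : ℕ) by push_cast; ring,
      show (p : ℤ) * r - n - 3 * p = (p : ℤ) * r - (n + p * (3 : ℕ)) by push_cast; ring,
      show (p : ℤ) * r - n - p = (p : ℤ) * r - (n + p * (1 : ℕ)) by push_cast; ring] at e
    push_cast at e ⊢
    linear_combination (-B r) * e
  rw [← tsum_mul_left, ← tsum_mul_left, ← tsum_mul_left,
    ← Summable.tsum_add ((hs _).mul_left _) ((hs _).mul_left _), ← tsum_mul_left,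
    ← Summable.tsum_add ((hs _).mul_left _) ((((hs _).mul_left _).add ((hs _).mul_left _)).mul_left _),
    tsum_congr key, tsum_mul_left, Summable.tsum_add (summable_frobTerm hπ h ha hBr n)
      ((((hs _).mul_left _).add ((hs _).mul_left _)).mul_left _), tsum_mul_left,
    Summable.tsum_add ((hs _).mul_left _) ((hs _).mul_left _), tsum_mul_left, tsum_mul_left,
    tsum_frobTerm_shift π a B n 3 (hs _), tsum_frobTerm_shift π a B n 1 (hs _)]
  rw [← tsum_mul_left, ← tsum_mul_left,
    ← Summable.tsum_add ((summable_frobTerm hπ h ha (hBs 3) n).mul_left _)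
      ((summable_frobTerm hπ h ha (hBs 1) n).mul_left _), ← tsum_mul_left,
    ← Summable.tsum_add (summable_frobTerm hπ h ha hBr n)
      ((((summable_frobTerm hπ h ha (hBs 3) n).mul_left _).add
      ((summable_frobTerm hπ h ha (hBs 1) n).mul_left _)).mul_left _)]
  have hz : ∀ r : ℕ, (zcoeff (frobKernel p π) ((p : ℤ) * r - n)).eval a * (r * B r) +
      π * (3 * ((zcoeff (frobKernel p π) ((p : ℤ) * r - n)).eval a * B (r + 3)) +
        a ^ p * ((zcoeff (frobKernel p π) ((p : ℤ) * r - n)).eval a * B (r + 1))) = 0 := by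
    intro r
    have := congrFun hD r
    simp only [dualD, LinearMap.coe_mk, AddHom.coe_mk, Pi.zero_apply] at this
    linear_combination ((zcoeff (frobKernel p π) ((p : ℤ) * r - n)).eval a) * this
  simp only [hz, tsum_zero, mul_zero]

theorem dualFrobenius_oneSeries (π a : ℂ_[p]) :
    dualFrobenius p π a (oneSeries p) = oneSeries p := by
  funext n
  rw [dualFrobenius, tsum_eq_single 0]
  · rcases n with _ | n
    · simp [oneSeries, frobKernelCoeff, thetaCoeff_zero]
    · simp [oneSeries]
  · intro r hr
    simp [oneSeries, hr]

theorem isDualFrobeniusMatrix_frobMatrix (hp5 : 5 ≤ p) (hπ : π ^ (p - 1) = -(p : ℂ_[p])) {b : ℝ}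
    (hb : 0 ≤ b) (hπβ : ‖π‖⁻¹ ≤ ((p : ℝ) ^ (b / 3)) ^ 3) {ρ σ : ℝ}
    (h : FrobRates p ((p : ℝ) ^ (b / 3)) ρ σ) {a : ℂ_[p]} (ha : ‖a‖ ≤ ρ)
    (haβ : ‖a‖ ≤ ((p : ℝ) ^ (b / 3)) ^ 2) :
    IsDualFrobeniusMatrix p π b a (frobMatrix p π a) := by
  have hπ0 := pi_ne_zero hπ
  have hap : ‖a ^ p‖ ≤ ((p : ℝ) ^ (b / 3)) ^ 2 := by
    rw [norm_pow]
    exact (pow_le_pow_left₀ (norm_nonneg _) ha p).trans h.rho_pow_le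
  refine ⟨?_, ?_, dualFrobenius_oneSeries π a, ?_⟩
  · rintro t (rfl | rfl)
    · exact ⟨linearIndependent_dualBasis _, span_dualBasis_eq hp5 hπ0 hb hπβ haβ⟩
    · exact ⟨linearIndependent_dualBasis _, span_dualBasis_eq hp5 hπ0 hb hπβ hap⟩
  · intro B hB
    obtain ⟨C, hC⟩ := exists_bound_of_mem_dualCochain hB.1
    refine ⟨fun n => ?_, mem_dualCochain (norm_dualFrobenius_le hπ h ha hC),
      dualD_dualFrobenius hπ h ha hC hB.2⟩
    simp only [frobTerm_eq]
    exact summable_frobTerm hπ h ha hC n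
  · intro j
    have hD := dualD_dualFrobenius hπ h ha (B := dualBasis p π (a ^ p) j) (C := 1)
      (fun n => by rw [one_mul]; exact norm_dualBasis_le hp5 h.one_le hπβ hap j n)
      (dualD_dualBasis hπ0 _ j)
    have e := eq_of_dualD_eq_zero hπ0 hD
    rw [Submodule.mem_span_singleton]
    refine ⟨dualFrobenius p π a (dualBasis p π (a ^ p) j) 0, ?_⟩
    simp only [Fin.sum_univ_two, frobMatrix, Matrix.of_apply, Fin.val_zero, Fin.val_one, zero_add]
    rw [eq_sub_iff_add_eq]
    exact e.symm

/-- The entries of the Frobenius matrix as convergent series of polynomials in `a`. -/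
theorem dualFrobenius_dualBasis_eq (π : ℂ_[p]) (j : Fin 2) (n : ℕ) :
    (fun a => dualFrobenius p π a (dualBasis p π (a ^ p) j) n) = fun a => ∑' r : ℕ,
      (zcoeff (frobKernel p π) ((p : ℤ) * r - n) *
        Polynomial.expand ℂ_[p] p (dualBasisPoly π j r)).eval a := by
  funext a
  rw [dualFrobenius_apply]
  simp only [eval_mul, expand_eval, eval_dualBasisPoly]

theorem gaussBound_frobTerm (hp5 : 5 ≤ p) (hπ : π ^ (p - 1) = -(p : ℂ_[p])) {β ρ σ : ℝ}
    (hπβ : ‖π‖⁻¹ ≤ β ^ 3) (h : FrobRates p β ρ σ) (j : Fin 2) (n r : ℕ) :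
    GaussBound ρ (zcoeff (frobKernel p π) ((p : ℤ) * r - n) *
        Polynomial.expand ℂ_[p] p (dualBasisPoly π j r)) (σ ^ (-(n : ℤ)) * (σ ^ p * β) ^ r) := by
  have hσ := h.sigma_pos
  have hρ := h.rho_pos
  refine ((gaussBound_frobKernel hπ h _).mul hρ (GaussBound.expand hp.out.pos
    (gaussBound_dualBasisPoly hp5 h.one_le (pow_pos hρ p) h.rho_pow_le hπβ j r))).mono (le_of_eq ?_)
  rw [zpow_sub₀ hσ.ne', zpow_mul, zpow_neg, zpow_natCast, zpow_natCast, mul_pow]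
  field_simp

/-- The differential equation of the entries of the Frobenius. -/
theorem hasDerivAt_dualFrobenius (hp5 : 5 ≤ p) (hπ : π ^ (p - 1) = -(p : ℂ_[p])) {β R : ℝ}
    (hπβ : ‖π‖⁻¹ ≤ β ^ 3) (hR : ∀ ρ, 0 < ρ → ρ < R → ∃ σ, FrobRates p β ρ σ) {a : ℂ_[p]}
    (ha : ‖a‖ < R) {n : ℕ} (hn : n ≠ 0) :
    HasDerivAt (fun a => dualFrobenius p π a (dualBasis p π (a ^ p) 0) n)
      (π * dualFrobenius p π a (dualBasis p π (a ^ p) 0) (n + 1) +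
        p * a ^ (p - 1) * (π / 3 * a ^ p * dualFrobenius p π a (dualBasis p π (a ^ p) 1) n)) a ∧
    HasDerivAt (fun a => dualFrobenius p π a (dualBasis p π (a ^ p) 1) n)
      (π * dualFrobenius p π a (dualBasis p π (a ^ p) 1) (n + 1) +
        p * a ^ (p - 1) * (-π * dualFrobenius p π a (dualBasis p π (a ^ p) 0) n)) a := by
  have hπ0 := pi_ne_zero hπ
  have hbd : ∀ j ρ, 0 < ρ → ρ < R → ∃ C q : ℝ, 0 ≤ q ∧ q < 1 ∧ ∀ r : ℕ, GaussBound ρ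
      (zcoeff (frobKernel p π) ((p : ℤ) * r - n) *
        Polynomial.expand ℂ_[p] p (dualBasisPoly π j r)) (C * q ^ r) := by
    intro j ρ h1 h2
    obtain ⟨σ, hσ⟩ := hR ρ h1 h2
    have := hσ.sigma_pos
    have := hσ.one_le
    exact ⟨_, _, by positivity, hσ.lt_one, fun r => gaussBound_frobTerm hp5 hπ hπβ hσ j n r⟩
  obtain ⟨ρ, h1, h2⟩ := exists_between ha
  obtain ⟨σ, hr⟩ := hR ρ ((norm_nonneg _).trans_lt h1) h2
  have hap : ‖a ^ p‖ ≤ β ^ 2 := by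
    rw [norm_pow]
    exact (pow_le_pow_left₀ (norm_nonneg _) h1.le p).trans hr.rho_pow_le
  have hg : ∀ j n, ‖dualBasis p π (a ^ p) j n‖ ≤ 1 * β ^ n := fun j n => by
    rw [one_mul]; exact norm_dualBasis_le hp5 hr.one_le hπβ hap j n
  have hg1 : ∀ j n, ‖dualBasis p π (a ^ p) j (n + 1)‖ ≤ β * β ^ n := fun j n => by
    have := hg j (n + 1); rwa [one_mul, pow_succ, mul_comm] at this
  have hs := fun j k => summable_frobTerm hπ hr h1.le (hg j) k
  have hs1 := fun j k => summable_frobTerm hπ hr h1.le (hg1 j) k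
  -- term by term, the derivative is determined by the equations of the kernel and of the basis
  have hterm : ∀ (j : Fin 2) (r : ℕ), (derivative (zcoeff (frobKernel p π) ((p : ℤ) * r - n) *
        Polynomial.expand ℂ_[p] p (dualBasisPoly π j r))).eval a =
      π * ((zcoeff (frobKernel p π) ((p : ℤ) * r - (n + 1 : ℕ))).eval a *
        dualBasis p π (a ^ p) j r) -
      p * a ^ (p - 1) * π * ((zcoeff (frobKernel p π) ((p : ℤ) * r - (n + p * (1 : ℕ)))).eval a *
        dualBasis p π (a ^ p) j r) +
      p * a ^ (p - 1) * ((zcoeff (frobKernel p π) ((p : ℤ) * r - n)).eval a *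
        (derivative (dualBasisPoly π j r)).eval (a ^ p)) := by
    intro j r
    rw [derivative_mul, derivative_expand, derivative_zcoeff_frobKernel]
    simp only [eval_add, eval_sub, eval_mul, eval_C, eval_pow, eval_X, expand_eval,
      eval_dualBasisPoly, eval_natCast]
    rw [show (p : ℤ) * r - n - 1 = (p : ℤ) * r - (n + 1 : ℕ) by push_cast; ring,
      show (p : ℤ) * r - n - p = (p : ℤ) * r - (n + p * (1 : ℕ)) by push_cast; ring]
    ring
  have hzero : ∀ x : ℂ_[p], (zcoeff (frobKernel p π) ((p : ℤ) * (0 : ℕ) - n)).eval a * x = 0 := by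
    intro x
    rw [zcoeff_of_neg]
    · simp
    · have : 0 < n := Nat.pos_of_ne_zero hn
      push_cast
      omega
  have hd0 : ∀ r : ℕ, (zcoeff (frobKernel p π) ((p : ℤ) * r - n)).eval a *
        (derivative (dualBasisPoly π 0 r)).eval (a ^ p) =
      π * ((zcoeff (frobKernel p π) ((p : ℤ) * r - n)).eval a * dualBasis p π (a ^ p) 0 (r + 1)) +
      π / 3 * a ^ p * ((zcoeff (frobKernel p π) ((p : ℤ) * r - n)).eval a *
        dualBasis p π (a ^ p) 1 r) := by
    intro r
    rcases Nat.eq_zero_or_pos r with rfl | hr0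
    · simp only [hzero]; ring
    · rw [(derivative_dualBasisPoly hπ0 r).1 hr0]
      simp only [eval_add, eval_mul, eval_C, eval_X, eval_dualBasisPoly]
      ring
  have hd1 : ∀ r : ℕ, (zcoeff (frobKernel p π) ((p : ℤ) * r - n)).eval a *
        (derivative (dualBasisPoly π 1 r)).eval (a ^ p) =
      π * ((zcoeff (frobKernel p π) ((p : ℤ) * r - n)).eval a * dualBasis p π (a ^ p) 1 (r + 1)) +
      -π * ((zcoeff (frobKernel p π) ((p : ℤ) * r - n)).eval a * dualBasis p π (a ^ p) 0 r) := by
    intro r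
    rcases Nat.eq_zero_or_pos r with rfl | hr0
    · simp only [hzero]; ring
    · rw [(derivative_dualBasisPoly hπ0 r).2 hr0]
      simp only [eval_sub, eval_mul, eval_C, eval_dualBasisPoly]
      ring
  refine ⟨?_, ?_⟩
  · have := hasDerivAt_tsum_eval (hbd 0) ha
    rw [← dualFrobenius_dualBasis_eq] at this
    refine this.congr_deriv ?_
    simp only [hterm, hd0, dualFrobenius_apply]
    rw [Summable.tsum_add (((hs _ _).mul_left _).sub ((hs _ _).mul_left _))
      ((((hs1 _ _).mul_left _).add ((hs _ _).mul_left _)).mul_left _),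
      Summable.tsum_sub ((hs _ _).mul_left _) ((hs _ _).mul_left _), tsum_mul_left, tsum_mul_left,
      tsum_mul_left, Summable.tsum_add ((hs1 _ _).mul_left _) ((hs _ _).mul_left _),
      tsum_mul_left, tsum_mul_left, tsum_frobTerm_shift π a _ n 1 (hs _ _)]
    ring
  · have := hasDerivAt_tsum_eval (hbd 1) ha
    rw [← dualFrobenius_dualBasis_eq] at this
    refine this.congr_deriv ?_
    simp only [hterm, hd1, dualFrobenius_apply]
    rw [Summable.tsum_add (((hs _ _).mul_left _).sub ((hs _ _).mul_left _))
      ((((hs1 _ _).mul_left _).add ((hs _ _).mul_left _)).mul_left _),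
      Summable.tsum_sub ((hs _ _).mul_left _) ((hs _ _).mul_left _), tsum_mul_left, tsum_mul_left,
      tsum_mul_left, Summable.tsum_add ((hs1 _ _).mul_left _) ((hs _ _).mul_left _),
      tsum_mul_left, tsum_mul_left, tsum_frobTerm_shift π a _ n 1 (hs _ _)]
    ring

end DualFrobenius


/-! ### Admissible rates -/

section Rates

variable {p : ℕ} [hp : Fact p.Prime] {π : ℂ_[p]} {b : ℝ}

theorem norm_pi_inv_le (hπ : π ^ (p - 1) = -(p : ℂ_[p])) (hb₁ : 1 / ((p : ℝ) - 1) < b) :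
    ‖π‖⁻¹ ≤ ((p : ℝ) ^ (b / 3)) ^ 3 := by
  have h1 : (1 : ℝ) < p := by exact_mod_cast hp.out.one_lt
  rw [norm_pi_eq_rpow hπ, ← Real.rpow_neg (by linarith), neg_neg, ← Real.rpow_mul_natCast (by linarith)]
  refine Real.rpow_le_rpow_of_exponent_le h1.le ?_
  push_cast
  linarith

theorem pos_of_one_div_lt (p : ℕ) [hp : Fact p.Prime] (hb₁ : 1 / ((p : ℝ) - 1) < b) : 0 < b := by
  have h1 : (1 : ℝ) < p := by exact_mod_cast hp.out.one_lt
  exact (one_div_pos.2 (by linarith)).trans hb₁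

/-- Admissible rates exist for `ρ < p ^ (2 b / (3 p))`: `σ = max (τ ^ (1/3)) (τ ρ)`, where `τ` is the
rate of decay of the coefficients of the splitting function. -/
theorem exists_frobRates (hb₀ : 0 < b) (hb₂ : b < ((p : ℝ) - 1) / p)
    {ρ : ℝ} (h0 : 0 < ρ) (hρ : ρ < (p : ℝ) ^ (2 * (b / p) / 3)) :
    ∃ σ, FrobRates p ((p : ℝ) ^ (b / 3)) ρ σ := by
  have h1 : (1 : ℝ) < p := by exact_mod_cast hp.out.one_lt
  have hp0 : (0 : ℝ) < p := by linarith
  have hτ := splitRate_pos (p := p)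
  have hρp : ρ ^ p ≤ ((p : ℝ) ^ (b / 3)) ^ 2 := by
    calc _ ≤ ((p : ℝ) ^ (2 * (b / p) / 3)) ^ p := by gcongr
      _ = _ := by
        rw [← Real.rpow_mul_natCast hp0.le, ← Real.rpow_mul_natCast hp0.le]
        congr 1
        push_cast
        field_simp
  -- the two bounds on `σ ^ p` both reduce to `b < (p - 1) / p`
  have hlt : (p : ℝ) ^ (-(((p : ℝ) - 1) / p)) * (p : ℝ) ^ b < 1 := by
    rw [← Real.rpow_add hp0]
    exact Real.rpow_lt_one_of_one_lt_of_neg h1 (by linarith)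
  have hτp : splitRate p ^ p = (p : ℝ) ^ (-(((p : ℝ) - 1) / p)) := by
    rw [splitRate, ← Real.rpow_mul_natCast hp0.le]
    congr 1
    field_simp
  have hβ3 : ((p : ℝ) ^ (b / 3)) ^ 3 = (p : ℝ) ^ b := by
    rw [← Real.rpow_mul_natCast hp0.le]
    congr 1
    push_cast
    ring
  have hc3 : (splitRate p ^ (1 / 3 : ℝ)) ^ 3 = splitRate p := by
    rw [← Real.rpow_mul_natCast hτ.le]
    norm_num
  have hc0 : 0 < splitRate p ^ (1 / 3 : ℝ) := Real.rpow_pos_of_pos hτ _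
  have hβ0 : 0 < (p : ℝ) ^ (b / 3) := Real.rpow_pos_of_pos hp0 _
  refine ⟨max (splitRate p ^ (1 / 3 : ℝ)) (splitRate p * ρ), Real.one_le_rpow h1.le (by positivity),
    h0, lt_max_of_lt_left hc0, hρp, ?_, le_max_right _ _, ?_⟩
  · calc splitRate p = (splitRate p ^ (1 / 3 : ℝ)) ^ 3 := hc3.symm
      _ ≤ _ := by gcongr; exact le_max_left _ _
  · rcases max_choice (splitRate p ^ (1 / 3 : ℝ)) (splitRate p * ρ) with e | e <;> rw [e]
    · refine (pow_lt_one_iff_of_nonneg (by positivity) three_ne_zero).1 ?_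
      calc _ = ((splitRate p ^ (1 / 3 : ℝ)) ^ 3) ^ p * ((p : ℝ) ^ (b / 3)) ^ 3 := by ring
        _ < 1 := by rw [hc3, hτp, hβ3]; exact hlt
    · calc _ = splitRate p ^ p * (ρ ^ p * (p : ℝ) ^ (b / 3)) := by ring
        _ ≤ splitRate p ^ p * (((p : ℝ) ^ (b / 3)) ^ 2 * (p : ℝ) ^ (b / 3)) := by gcongr
        _ = splitRate p ^ p * ((p : ℝ) ^ (b / 3)) ^ 3 := by ring
        _ < 1 := by rw [hτp, hβ3]; exact hlt

theorem sq_lt_of_lt {p : ℕ} {b : ℝ} {ρ : ℝ} (h0 : 0 ≤ ρ) (hρ : ρ < (p : ℝ) ^ (b / p / 3)) :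
    ρ ^ 2 < (p : ℝ) ^ (2 * (b / p) / 3) := by
  calc _ < ((p : ℝ) ^ (b / p / 3)) ^ 2 := by gcongr
    _ = _ := by
      rw [← Real.rpow_mul_natCast (Nat.cast_nonneg p)]
      congr 1
      push_cast
      ring

theorem pow_three_lt_inv_splitRate (hb₂ : b < ((p : ℝ) - 1) / p) {ρ : ℝ} (h0 : 0 ≤ ρ)
    (hρ : ρ < (p : ℝ) ^ (b / p / 3)) : ρ ^ 3 < (splitRate p)⁻¹ := by
  have h1 : (1 : ℝ) < p := by exact_mod_cast hp.out.one_lt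
  have hp0 : (0 : ℝ) < p := by linarith
  calc _ < ((p : ℝ) ^ (b / p / 3)) ^ 3 := by gcongr
    _ = (p : ℝ) ^ (b / p) := by
      rw [← Real.rpow_mul_natCast (Nat.cast_nonneg p)]
      congr 1
      push_cast
      ring
    _ ≤ _ := by
      rw [splitRate, ← Real.rpow_neg hp0.le, neg_neg]
      refine Real.rpow_le_rpow_of_exponent_le h1.le ?_
      rw [pow_two, ← div_div]
      gcongr

theorem pow_three_mul_lt (hb₂ : b < ((p : ℝ) - 1) / p) {ρ : ℝ} (h0 : 0 ≤ ρ)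
    (hρ : ρ < (p : ℝ) ^ (b / p / 3)) : ρ ^ (3 * p) < p := by
  have h1 : (1 : ℝ) < p := by exact_mod_cast hp.out.one_lt
  have hp0 : (0 : ℝ) < p := by linarith
  have hb1 : ((p : ℝ) - 1) / p ≤ 1 := by rw [div_le_one hp0]; linarith
  calc _ < ((p : ℝ) ^ (b / p / 3)) ^ (3 * p) := by
        gcongr
        exact mul_ne_zero three_ne_zero hp.out.ne_zero
    _ = (p : ℝ) ^ b := by
      rw [← Real.rpow_mul_natCast (Nat.cast_nonneg p)]
      congr 1
      push_cast
      field_simp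
    _ ≤ (p : ℝ) ^ (1 : ℝ) := Real.rpow_le_rpow_of_exponent_le h1.le (by linarith)
    _ = p := Real.rpow_one _

end Rates

section ProductOfSeries

variable {K : Type*} [NontriviallyNormedField K] [IsUltrametricDist K]

theorem HasPowerSeriesOn.sub {f g : K → K} {c d : ℕ → K} {R : ℝ} (hf : HasPowerSeriesOn f c R)
    (hg : HasPowerSeriesOn g d R) : HasPowerSeriesOn (fun a => f a - g a)
      (fun n => c n - d n) R := by
  refine ⟨fun ρ h1 h2 => ?_, fun a ha => ?_⟩
  · obtain ⟨C, hC⟩ := hf.1 ρ h1 h2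
    obtain ⟨D, hD⟩ := hg.1 ρ h1 h2
    refine ⟨C + D, fun n => ?_⟩
    calc _ ≤ (‖c n‖ + ‖d n‖) * ρ ^ n := by gcongr; exact norm_sub_le _ _
      _ ≤ C + D := by rw [add_mul]; exact add_le_add (hC n) (hD n)
  · simp only [sub_mul]
    exact (hf.2 a ha).sub (hg.2 a ha)

variable [CompleteSpace K]

theorem HasPowerSeriesOn.mul {f g : K → K} {c d : ℕ → K} {R : ℝ} (hf : HasPowerSeriesOn f c R)
    (hg : HasPowerSeriesOn g d R) : HasPowerSeriesOn (fun a => f a * g a)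
      (fun n => ∑ ij ∈ Finset.HasAntidiagonal.antidiagonal n, c ij.1 * d ij.2) R := by
  refine ⟨fun ρ h1 h2 => ?_, fun a ha => ?_⟩
  · obtain ⟨C, hC⟩ := hf.1 ρ h1 h2
    obtain ⟨D, hD⟩ := hg.1 ρ h1 h2
    have hC0 : 0 ≤ C := (by positivity : 0 ≤ ‖c 0‖ * ρ ^ 0).trans (hC 0)
    have hD0 : 0 ≤ D := (by positivity : 0 ≤ ‖d 0‖ * ρ ^ 0).trans (hD 0)
    refine ⟨C * D, fun n => ?_⟩
    rw [← le_div_iff₀ (by positivity)]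
    refine IsUltrametricDist.norm_sum_le_of_forall_le_of_nonneg (by positivity) fun ij hij => ?_
    rw [Finset.HasAntidiagonal.mem_antidiagonal] at hij
    rw [le_div_iff₀ (by positivity), ← hij, norm_mul, pow_add]
    calc _ = (‖c ij.1‖ * ρ ^ ij.1) * (‖d ij.2‖ * ρ ^ ij.2) := by ring
      _ ≤ C * D := by gcongr; exacts [hC _, hD _]
  · have h1 := summable_norm_of_forall_bound hf.1 ha
    have h2 := summable_norm_of_forall_bound hg.1 ha
    have h3 := (summable_norm_sum_mul_antidiagonal_of_summable_norm h1 h2).of_norm.hasSum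
    rw [← tsum_mul_tsum_eq_tsum_sum_antidiagonal_of_summable_norm h1 h2, (hf.2 a ha).tsum_eq,
      (hg.2 a ha).tsum_eq] at h3
    refine h3.congr_fun fun n => ?_
    rw [Finset.sum_mul]
    refine Finset.sum_congr rfl fun ij hij => ?_
    rw [Finset.HasAntidiagonal.mem_antidiagonal] at hij
    rw [← hij, pow_add]
    ring

end ProductOfSeries

/-! ### The Frobenius structure of the Airy system -/

section FrobeniusMatrix

variable {p : ℕ} [hp : Fact p.Prime] {π : ℂ_[p]} {β R : ℝ}

theorem exists_hasPowerSeriesOn_dualFrobenius (hp5 : 5 ≤ p) (hπ : π ^ (p - 1) = -(p : ℂ_[p]))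
    (hπβ : ‖π‖⁻¹ ≤ β ^ 3) (hR : ∀ ρ, 0 < ρ → ρ < R → ∃ σ, FrobRates p β ρ σ) (j : Fin 2) (n : ℕ) :
    ∃ c, HasPowerSeriesOn (fun a => dualFrobenius p π a (dualBasis p π (a ^ p) j) n) c R := by
  rw [dualFrobenius_dualBasis_eq]
  refine ⟨_, hasPowerSeriesOn_tsum_eval fun ρ h1 h2 => ?_⟩
  obtain ⟨σ, hσ⟩ := hR ρ h1 h2
  have := hσ.sigma_pos
  have := hσ.one_le
  exact ⟨_, _, by positivity, hσ.lt_one, fun r => gaussBound_frobTerm hp5 hπ hπβ hσ j n r⟩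

/-- The coefficient matrix `N(a)` of the Airy system in the original variable. -/
noncomputable def airyBase (π a : ℂ_[p]) : Matrix (Fin 2) (Fin 2) ℂ_[p] := !![0, π; -(π * a / 3), 0]

/-- The Frobenius matrix is horizontal: `𝔄' = N(a) 𝔄 - p a ^ (p - 1) 𝔄 N(a ^ p)`. -/
theorem hasDerivAt_frobMatrix (hp5 : 5 ≤ p) (hπ : π ^ (p - 1) = -(p : ℂ_[p]))
    (hπβ : ‖π‖⁻¹ ≤ β ^ 3) (hR : ∀ ρ, 0 < ρ → ρ < R → ∃ σ, FrobRates p β ρ σ) {a : ℂ_[p]}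
    (ha : ‖a‖ < R) (i j : Fin 2) :
    HasDerivAt (fun a => frobMatrix p π a i j) ((airyBase π a * frobMatrix p π a -
      ((p : ℂ_[p]) * a ^ (p - 1)) • (frobMatrix p π a * airyBase π (a ^ p))) i j) a := by
  obtain ⟨ρ, h1, h2⟩ := exists_between ha
  obtain ⟨σ, hr⟩ := hR ρ ((norm_nonneg _).trans_lt h1) h2
  have hap : ‖a ^ p‖ ≤ β ^ 2 := by
    rw [norm_pow]
    exact (pow_le_pow_left₀ (norm_nonneg _) h1.le p).trans hr.rho_pow_le
  -- the kernel equation expresses the coefficient of `x ^ (-3)` through that of `x ^ (-1)`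
  have h3 : ∀ j, dualFrobenius p π a (dualBasis p π (a ^ p) j) 3 =
      -(a / 3) * dualFrobenius p π a (dualBasis p π (a ^ p) j) 1 := fun j => by
    have hD := dualD_dualFrobenius hπ hr h1.le (B := dualBasis p π (a ^ p) j) (C := 1)
      (fun n => by rw [one_mul]; exact norm_dualBasis_le hp5 hr.one_le hπβ hap j n)
      (dualD_dualBasis (pi_ne_zero hπ) _ j)
    have := congrFun hD 0
    simp only [dualD, LinearMap.coe_mk, AddHom.coe_mk, Pi.zero_apply, Nat.cast_zero, zero_mul,
      zero_add, mul_eq_zero, pi_ne_zero hπ, false_or] at this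
    linear_combination this / 3
  have d1 := hasDerivAt_dualFrobenius hp5 hπ hπβ hR ha one_ne_zero
  have d2 := hasDerivAt_dualFrobenius hp5 hπ hπβ hR ha two_ne_zero
  simp only [Nat.reduceAdd] at d1 d2
  have h30 := h3 0
  have h31 := h3 1
  fin_cases i <;> fin_cases j <;> simp only [frobMatrix, airyBase, Matrix.of_apply, Matrix.sub_apply,
    Matrix.smul_apply, Matrix.mul_apply, Fin.sum_univ_two, Fin.zero_eta, Fin.mk_one, Fin.val_zero,
    Fin.val_one, zero_add, one_add_one_eq_two, Matrix.cons_val_zero, Matrix.cons_val_one,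
    Matrix.cons_val', Matrix.cons_val_fin_one, smul_eq_mul]
  · exact d1.1.congr_deriv (by ring)
  · exact d1.2.congr_deriv (by ring)
  · exact d2.1.congr_deriv (by rw [h30]; ring)
  · exact d2.2.congr_deriv (by rw [h31]; ring)

theorem exists_hasPowerSeriesOn_frobMatrix (hp5 : 5 ≤ p) (hπ : π ^ (p - 1) = -(p : ℂ_[p]))
    (hπβ : ‖π‖⁻¹ ≤ β ^ 3) (hR : ∀ ρ, 0 < ρ → ρ < R → ∃ σ, FrobRates p β ρ σ) (i j : Fin 2) :
    ∃ c, HasPowerSeriesOn (fun a => frobMatrix p π a i j) c R :=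
  exists_hasPowerSeriesOn_dualFrobenius hp5 hπ hπβ hR j (i + 1)

/-- The Airy system has trace zero, so the Frobenius matrix has constant determinant. -/
theorem det_frobMatrix_eq (hp5 : 5 ≤ p) (hπ : π ^ (p - 1) = -(p : ℂ_[p]))
    (hπβ : ‖π‖⁻¹ ≤ β ^ 3) (hR : ∀ ρ, 0 < ρ → ρ < R → ∃ σ, FrobRates p β ρ σ) {a : ℂ_[p]}
    (ha : ‖a‖ < R) : (frobMatrix p π a).det = (frobMatrix p π 0).det := by
  have hd : ∀ x : ℂ_[p], ‖x‖ < R → HasDerivAt (fun a => (frobMatrix p π a).det) 0 x := by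
    intro x hx
    have d := fun i j => hasDerivAt_frobMatrix hp5 hπ hπβ hR hx i j
    simp only [Matrix.det_fin_two]
    refine (((d 0 0).fun_mul (d 1 1)).fun_sub ((d 0 1).fun_mul (d 1 0))).congr_deriv ?_
    simp only [airyBase, Matrix.of_apply, Matrix.sub_apply,
      Matrix.smul_apply, Matrix.mul_apply, Fin.sum_univ_two, Matrix.cons_val_zero,
      Matrix.cons_val_one, Matrix.cons_val', Matrix.cons_val_fin_one, smul_eq_mul]
    ring
  have hps := fun i j => exists_hasPowerSeriesOn_frobMatrix hp5 hπ hπβ hR i j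
  choose c hc using hps
  have hdet := ((hc 0 0).mul (hc 1 1)).sub ((hc 0 1).mul (hc 1 0))
  simp only [← Matrix.det_fin_two] at hdet
  exact eq_of_deriv_eq_zero hdet (fun x _ hx => (hd x hx).deriv) ha

end FrobeniusMatrix


/-! ### Wilson products -/

section UnitProducts

/-- The product of the natural numbers up to `L` that are not divisible by `p`. -/
def unitProd (p L : ℕ) : ℕ := ∏ n ∈ Finset.range (L + 1), if p ∣ n then 1 else n

theorem unitProd_succ (p L : ℕ) :
    unitProd p (L + 1) = unitProd p L * if p ∣ L + 1 then 1 else (L + 1) := by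
  rw [unitProd, Finset.prod_range_succ, unitProd]

theorem factorial_eq_mul_unitProd (p L : ℕ) :
    L.factorial = p ^ (L / p) * (L / p).factorial * unitProd p L := by
  induction L with
  | zero => simp [unitProd]
  | succ L ih =>
    rw [unitProd_succ, Nat.factorial_succ, ih, Nat.succ_div]
    split_ifs with h
    · have h1 : p * (L / p + 1) = L + 1 := by
        have := Nat.mul_div_cancel' h
        rwa [Nat.succ_div, if_pos h] at this
      rw [Nat.factorial_succ, ← h1, pow_succ]
      ring
    · rw [add_zero]
      ring

theorem prod_range_neg_one_units (R : Type*) [CommRing R] (p L : ℕ) :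
    ∏ k ∈ Finset.range L, (if p ∣ k + 1 then (1 : R) else -1) = (-1) ^ (L + L / p) := by
  induction L with
  | zero => simp
  | succ L ih =>
    rw [Finset.prod_range_succ, ih, Nat.succ_div]
    split_ifs
    · rw [show L + 1 + (L / p + 1) = L + L / p + 2 by ring, pow_add _ _ 2]
      simp
    · rw [add_zero, show L + 1 + L / p = L + L / p + 1 by ring, pow_succ]

variable {p : ℕ} [hp : Fact p.Prime]

/-- Wilson's theorem for a power of an odd prime. -/
theorem prod_units_zmod_prime_pow (hp2 : p ≠ 2) {s : ℕ} (hs : s ≠ 0) :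
    ∏ u : (ZMod (p ^ s))ˣ, u = -1 := by
  have hodd : Odd p := hp.out.odd_of_ne_two hp2
  have : Fact (1 < p ^ s) := ⟨Nat.one_lt_pow hs hp.out.one_lt⟩
  rw [← Finset.mul_prod_erase _ _ (Finset.mem_univ (-1 : (ZMod (p ^ s))ˣ)),
    Finset.prod_involution (fun u _ => u⁻¹), mul_one]
  · exact fun u _ => mul_inv_cancel u
  · intro u hu hu1 huu
    refine hu1 ?_
    -- the only square roots of one are `1` and `-1`
    have hsq : (u : ZMod (p ^ s)) * u = 1 := by
      rw [← Units.val_mul]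
      nth_rewrite 2 [← huu]
      rw [mul_inv_cancel, Units.val_one]
    have hne : (u : ZMod (p ^ s)) ≠ -1 := fun h => (Finset.mem_erase.1 hu).1 (Units.ext h)
    obtain ⟨v, hv⟩ := ZMod.intCast_surjective (u : ZMod (p ^ s))
    have hdvd : ((p ^ s : ℕ) : ℤ) ∣ (v - 1) * (v + 1) := by
      rw [← ZMod.intCast_zmod_eq_zero_iff_dvd]
      push_cast
      rw [hv]
      linear_combination hsq
    have hnd : ¬ ((p ^ s : ℕ) : ℤ) ∣ v + 1 := by
      rw [← ZMod.intCast_zmod_eq_zero_iff_dvd]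
      push_cast
      rw [hv]
      exact fun h => hne (eq_neg_of_add_eq_zero_left h)
    have hpp : Prime (p : ℤ) := Nat.prime_iff_prime_int.1 hp.out
    have h2 : ¬ (p : ℤ) ∣ 2 := by
      intro h
      have := (Nat.prime_dvd_prime_iff_eq hp.out Nat.prime_two).1 (by exact_mod_cast h)
      exact hp2 this
    by_cases h1 : (p : ℤ) ∣ v - 1
    · have h3 : ¬ (p : ℤ) ∣ v + 1 := fun h => h2 (by
        have := dvd_sub h h1
        rwa [show v + 1 - (v - 1) = 2 by ring] at this)
      have hc : IsCoprime ((p ^ s : ℕ) : ℤ) (v + 1) := by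
        push_cast
        exact ((Prime.coprime_iff_not_dvd hpp).2 h3).pow_left
      have h4 := hc.dvd_of_dvd_mul_right hdvd
      rw [← ZMod.intCast_zmod_eq_zero_iff_dvd] at h4
      push_cast at h4
      rw [hv] at h4
      exact Units.ext (sub_eq_zero.1 h4)
    · have hc : IsCoprime ((p ^ s : ℕ) : ℤ) (v - 1) := by
        push_cast
        exact ((Prime.coprime_iff_not_dvd hpp).2 h1).pow_left
      exact absurd (hc.dvd_of_dvd_mul_left hdvd) hnd
  · intro u hu
    rw [Finset.mem_erase] at hu ⊢
    refine ⟨fun h => hu.1 ?_, Finset.mem_univ _⟩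
    rw [← inv_inv u, h, inv_neg, inv_one]
  · intro u _
    exact inv_inv u

theorem prod_range_units_prime_pow (hp2 : p ≠ 2) {s : ℕ} (hs : s ≠ 0) :
    ∏ n ∈ Finset.range (p ^ s), (if p ∣ n then 1 else (n : ZMod (p ^ s))) = -1 := by
  have h1 := congrArg (Units.val) (prod_units_zmod_prime_pow hp2 hs)
  have : NeZero (p ^ s) := ⟨pow_ne_zero _ hp.out.ne_zero⟩
  have hcop : ∀ n : ℕ, n.Coprime (p ^ s) ↔ ¬ p ∣ n := fun n => by
    rw [Nat.coprime_pow_right_iff (Nat.pos_of_ne_zero hs), Nat.coprime_comm,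
      Nat.Prime.coprime_iff_not_dvd hp.out]
  rw [Units.coe_prod, Units.val_neg, Units.val_one] at h1
  rw [← h1]
  simp only [← ite_not (p ∣ _)]
  rw [← Finset.prod_filter]
  symm
  refine Finset.prod_nbij (fun u => (u : ZMod (p ^ s)).val) ?_ ?_ ?_ ?_
  · intro u _
    rw [Finset.mem_filter, Finset.mem_range, ← hcop]
    exact ⟨ZMod.val_lt _, ZMod.val_coe_unit_coprime u⟩
  · intro u _ v _ h
    exact Units.ext (ZMod.val_injective _ h)
  · intro n hn
    rw [Finset.mem_coe, Finset.mem_filter, Finset.mem_range, ← hcop] at hn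
    refine ⟨ZMod.unitOfCoprime n hn.2, Finset.mem_univ _, ?_⟩
    simp [ZMod.val_natCast_of_lt hn.1]
  · intro u _
    simp

theorem unitProd_mul_unitProd (hp2 : p ≠ 2) {s L₁ L₂ : ℕ} (hs : s ≠ 0)
    (h : L₁ + 1 + L₂ = p ^ s) :
    (unitProd p L₁ * unitProd p L₂ : ZMod (p ^ s)) = -(-1) ^ (L₂ + L₂ / p) := by
  have h1 := prod_range_units_prime_pow hp2 hs
  rw [← prod_range_neg_one_units]
  set ε := ∏ k ∈ Finset.range L₂, (if p ∣ k + 1 then (1 : ZMod (p ^ s)) else -1) with hε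
  have h0 : ((p ^ s : ℕ) : ZMod (p ^ s)) = 0 := ZMod.natCast_self _
  have hd : p ∣ p ^ s := dvd_pow_self p hs
  have hcast : ∀ L, (unitProd p L : ZMod (p ^ s)) =
      ∏ n ∈ Finset.range (L + 1), if p ∣ n then 1 else (n : ZMod (p ^ s)) := fun L => by
    rw [unitProd, Nat.cast_prod]
    exact Finset.prod_congr rfl fun n _ => by split_ifs <;> simp
  -- reflect the upper part of the product by `n ↦ p ^ s - n`
  have h2 : (unitProd p L₁ : ZMod (p ^ s)) * (ε * unitProd p L₂) = -1 := by
    rw [← h1, show Finset.range (p ^ s) = Finset.range (L₁ + 1 + L₂) by rw [h],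
      Finset.prod_range_add, ← hcast]
    congr 1
    rw [hcast, Finset.prod_range_succ', hε]
    simp only [dvd_zero, if_true, mul_one]
    rw [← Finset.prod_mul_distrib, ← Finset.prod_range_reflect (fun x => if p ∣ L₁ + 1 + x then
      (1 : ZMod (p ^ s)) else ((L₁ + 1 + x : ℕ) : ZMod (p ^ s)))]
    refine Finset.prod_congr rfl fun k hk => ?_
    rw [Finset.mem_range] at hk
    have h3 : L₁ + 1 + (L₂ - 1 - k) + (k + 1) = p ^ s := by omega
    have h4 : p ∣ L₁ + 1 + (L₂ - 1 - k) ↔ p ∣ k + 1 := by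
      rw [← h3] at hd
      exact ⟨fun h => (Nat.dvd_add_right h).1 hd, fun h => (Nat.dvd_add_left h).1 hd⟩
    have h5 : ((L₁ + 1 + (L₂ - 1 - k) : ℕ) : ZMod (p ^ s)) = -((k + 1 : ℕ) : ZMod (p ^ s)) := by
      rw [eq_neg_iff_add_eq_zero, ← Nat.cast_add, h3, h0]
    simp only [h4, h5]
    split_ifs <;> simp
  have h3 : ε * ε = 1 := by
    rw [hε, ← Finset.prod_mul_distrib]
    exact Finset.prod_eq_one fun k _ => by split_ifs <;> simp
  linear_combination ε * h2 - (unitProd p L₁ * unitProd p L₂ : ZMod (p ^ s)) * h3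

theorem norm_unitProd_mul_add_le (hp2 : p ≠ 2) {s L₁ L₂ : ℕ} (hs : s ≠ 0)
    (h : L₁ + 1 + L₂ = p ^ s) :
    ‖((unitProd p L₁ * unitProd p L₂ : ℕ) : ℂ_[p]) + (-1) ^ (L₂ + L₂ / p)‖ ≤ ((p : ℝ)⁻¹) ^ s := by
  have h1 := unitProd_mul_unitProd hp2 hs h
  have h2 : ((p ^ s : ℕ) : ℤ) ∣ (unitProd p L₁ * unitProd p L₂ : ℕ) + (-1) ^ (L₂ + L₂ / p) := by
    rw [← ZMod.intCast_zmod_eq_zero_iff_dvd]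
    push_cast
    rw [h1]
    ring
  obtain ⟨k, hk⟩ := h2
  have h3 := congrArg (Int.cast : ℤ → ℂ_[p]) hk
  push_cast at h3 ⊢
  rw [h3, norm_mul, norm_pow, norm_p_complex]
  refine mul_le_of_le_one_right (by positivity) (IsUltrametricDist.norm_intCast_le_one _ k)

end UnitProducts


/-! ### The determinant of the Frobenius matrix -/

section FrobeniusAtZero

variable {p : ℕ} [hp : Fact p.Prime] {π : ℂ_[p]}

/-- The entries of the Frobenius matrix at `a = 0`, as functions of the exponent `x`:
`∑ θ_{m + p k} (x)_k (-π) ^ (-k)`. -/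
noncomputable def frobSum (π : ℂ_[p]) (m : ℕ) (x : ℂ_[p]) : ℂ_[p] :=
  ∑' k : ℕ, thetaCoeff p π p (m + p * k) * ((ascPochhammer ℂ_[p] k).eval x / (-π) ^ k)

theorem norm_ascPochhammer_eval_le {x : ℂ_[p]} (hx : ‖x‖ ≤ 1) (k : ℕ) :
    ‖(ascPochhammer ℂ_[p] k).eval x‖ ≤ 1 := by
  induction k with
  | zero => simp
  | succ k ih =>
    rw [ascPochhammer_succ_eval, norm_mul]
    refine mul_le_one₀ ih (norm_nonneg _) ?_
    exact (IsUltrametricDist.norm_add_le_max _ _).trans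
      (max_le hx (IsUltrametricDist.norm_natCast_le_one _ k))

theorem splitRate_pow_lt_norm_pi (hp5 : 5 ≤ p) (hπ : π ^ (p - 1) = -(p : ℂ_[p])) :
    splitRate p ^ p < ‖π‖ := by
  have h5 : (5 : ℝ) ≤ p := by exact_mod_cast hp5
  have h0 : (0 : ℝ) < p := by linarith
  rw [norm_pi_eq_rpow hπ, splitRate, ← Real.rpow_mul_natCast h0.le]
  refine Real.rpow_lt_rpow_of_exponent_lt (by linarith) ?_
  have : -(((p : ℝ) - 1) / (p : ℝ) ^ 2) * p = -(((p : ℝ) - 1) / p) := by field_simp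
  rw [this, neg_lt_neg_iff, div_lt_div_iff₀ (by linarith) h0]
  nlinarith

theorem tendsto_frobSum (hp5 : 5 ≤ p) (hπ : π ^ (p - 1) = -(p : ℂ_[p])) (m : ℕ) {x : ℂ_[p]}
    {u : ℕ → ℂ_[p]} (hu : ∀ n, ‖u n‖ ≤ 1) (h : Tendsto u atTop (𝓝 x)) :
    Tendsto (fun n => frobSum π m (u n)) atTop (𝓝 (frobSum π m x)) := by
  have hπ0 := norm_pi_pos hπ
  have hτ := splitRate_pos (p := p)
  have hq : splitRate p ^ p / ‖π‖ < 1 := (div_lt_one hπ0).2 (splitRate_pow_lt_norm_pi hp5 hπ)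
  refine tendsto_tsum_of_dominated_convergence
    (bound := fun k => splitRate p ^ m * (splitRate p ^ p / ‖π‖) ^ k)
    ((summable_geometric_of_lt_one (by positivity) hq).mul_left _) (fun k => ?_)
    (Eventually.of_forall fun n k => ?_)
  · exact (((Polynomial.continuous _).tendsto x).comp h |>.div_const _).const_mul _
  · rw [norm_mul, norm_div, norm_pow, norm_neg]
    calc _ ≤ splitRate p ^ (m + p * k) * (1 / ‖π‖ ^ k) := by
          gcongr
          · exact norm_thetaCoeff_le hπ _
          · exact norm_ascPochhammer_eval_le (hu n) k
      _ = _ := by rw [pow_add, pow_mul, div_pow]; ring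

/-- At a negative integer the series collapses to a single term. -/
theorem frobSum_neg (hπ : π ^ (p - 1) = -(p : ℂ_[p])) {m : ℕ} (hm : m < p) (N : ℕ) :
    frobSum π m (-(N : ℂ_[p])) =
      π ^ m * (-(p : ℂ_[p])) ^ N * N.factorial / ((m + p * N).factorial : ℂ_[p]) := by
  have hπ0 := pi_ne_zero hπ
  have hp0 := hp.out.pos
  have hfac : ∀ n : ℕ, (n.factorial : ℂ_[p]) ≠ 0 := fun n => Nat.cast_ne_zero.2 n.factorial_ne_zero
  rw [frobSum, tsum_eq_sum (s := Finset.range (N + 1))]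
  swap
  · intro k hk
    rw [Finset.mem_range, not_lt] at hk
    rw [ascPochhammer_eval_neg_coe_nat_of_lt (by omega)]
    simp
  let f : ℕ → ℕ → ℂ_[p] := fun l j => π ^ (m + p * l) / ((m + p * l).factorial : ℂ_[p]) *
    ((-π) ^ j / (j.factorial : ℂ_[p])) *
    ((-1) ^ (l + j) * (N.descFactorial (l + j) : ℂ_[p]) / (-π) ^ (l + j))
  have h1 : ∀ k, thetaCoeff p π p (m + p * k) *
      ((ascPochhammer ℂ_[p] k).eval (-(N : ℂ_[p])) / (-π) ^ k) =
      ∑ l ∈ Finset.range (k + 1), f l (k - l) := by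
    intro k
    rw [ascPochhammer_eval_neg_eq_descPochhammer, descPochhammer_eval_eq_descFactorial, thetaCoeff,
      Nat.add_mul_div_left _ _ hp0, Nat.div_eq_of_lt hm, zero_add, ← Finset.sum_flip,
      Finset.sum_mul]
    refine Finset.sum_congr rfl fun l hl => ?_
    have hl' : l ≤ k := by rw [Finset.mem_range] at hl; omega
    have h2 : m + p * k - p * (k - l) = m + p * l := by
      rw [Nat.mul_sub]
      have := Nat.mul_le_mul_left p hl'
      omega
    simp only [f]
    rw [h2, Nat.add_sub_cancel' hl']
  have h2 : ∀ l ∈ Finset.range (N + 1), ∑ j ∈ Finset.range (N + 1 - l), f l j =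
      if l = N then π ^ m * (-(p : ℂ_[p])) ^ N * N.factorial /
        ((m + p * N).factorial : ℂ_[p]) else 0 := by
    intro l hl
    have hl' : l ≤ N := by rw [Finset.mem_range] at hl; omega
    -- the inner sum is an alternating sum of binomial coefficients
    have h3 : ∀ j, f l j = π ^ (m + p * l) / ((m + p * l).factorial : ℂ_[p]) / π ^ l *
        N.descFactorial l * (((-1) ^ j * ((N - l).choose j : ℤ) : ℤ) : ℂ_[p]) := by
      intro j
      have e1 : N.descFactorial (l + j) = (j.factorial * (N - l).choose j) * N.descFactorial l := by
        rw [← Nat.descFactorial_eq_factorial_mul_choose,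
          ← Nat.descFactorial_mul_descFactorial (Nat.le_add_right l j), Nat.add_sub_cancel_left]
      simp only [f, e1]
      push_cast
      have := hfac j
      have := hfac (m + p * l)
      rw [neg_pow π j, neg_pow π (l + j), pow_add π l j]
      have e2 : ((-1 : ℂ_[p]) ^ (l + j)) ≠ 0 := pow_ne_zero _ (by simp)
      field_simp
    rw [Finset.sum_congr rfl fun j _ => h3 j, ← Finset.mul_sum, ← Int.cast_sum,
      show N + 1 - l = (N - l) + 1 by omega, Int.alternating_sum_range_choose]
    by_cases hlN : l = N
    · subst hlN
      have e3 : π ^ (m + p * l) = π ^ m * (π ^ (p - 1)) ^ l * π ^ l := by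
        rw [mul_assoc, ← pow_mul, ← pow_add, ← pow_add]
        congr 2
        rw [Nat.sub_mul, one_mul, Nat.sub_add_cancel (Nat.le_mul_of_pos_left l hp0)]
      rw [if_pos (Nat.sub_self l), if_pos rfl, e3, hπ, Nat.descFactorial_self]
      have := hfac (m + p * l)
      push_cast
      field_simp
    · rw [if_neg (by omega), if_neg hlN]
      simp
  rw [Finset.sum_congr rfl fun k _ => h1 k, Finset.sum_range_diag_flip, Finset.sum_congr rfl h2,
    Finset.sum_ite_eq' (Finset.range (N + 1)) N, if_pos (by simp)]

/-- The product formula behind the determinant: the factorials cancel up to their prime-to-`p`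
parts. -/
theorem frobSum_neg_mul (hπ : π ^ (p - 1) = -(p : ℂ_[p])) {m₁ m₂ N₁ N₂ : ℕ}
    (hm : m₁ + m₂ = p - 1) (hN : Even (N₁ + N₂)) :
    frobSum π m₁ (-(N₁ : ℂ_[p])) * frobSum π m₂ (-(N₂ : ℂ_[p])) *
      ((unitProd p (m₁ + p * N₁) * unitProd p (m₂ + p * N₂) : ℕ) : ℂ_[p]) = -p := by
  have hp1 := hp.out.one_lt
  have hfac : ∀ n : ℕ, (n.factorial : ℂ_[p]) ≠ 0 := fun n => Nat.cast_ne_zero.2 n.factorial_ne_zero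
  have hdiv : ∀ m N : ℕ, m < p → (m + p * N) / p = N := fun m N h => by
    rw [Nat.add_mul_div_left _ _ hp.out.pos, Nat.div_eq_of_lt h, zero_add]
  have hm₁ : m₁ < p := by omega
  have hm₂ : m₂ < p := by omega
  have e : ∀ m N : ℕ, m < p → ((m + p * N).factorial : ℂ_[p]) =
      (p : ℂ_[p]) ^ N * N.factorial * unitProd p (m + p * N) := fun m N h => by
    have := factorial_eq_mul_unitProd p (m + p * N)
    rw [hdiv m N h] at this
    exact_mod_cast this
  have u0 : ∀ m N : ℕ, m < p → (unitProd p (m + p * N) : ℂ_[p]) ≠ 0 := fun m N h h0 => by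
    have := e m N h
    rw [h0, mul_zero] at this
    exact hfac _ this
  have hp0 : (p : ℂ_[p]) ≠ 0 := Nat.cast_ne_zero.2 hp.out.ne_zero
  rw [frobSum_neg hπ hm₁, frobSum_neg hπ hm₂, e _ _ hm₁, e _ _ hm₂]
  have e1 := u0 _ N₁ hm₁
  have e2 := u0 _ N₂ hm₂
  have e3 : (-(p : ℂ_[p])) ^ N₁ * (-(p : ℂ_[p])) ^ N₂ = (p : ℂ_[p]) ^ N₁ * (p : ℂ_[p]) ^ N₂ := by
    rw [← pow_add, ← pow_add, hN.neg_pow]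
  have e4 : π ^ m₁ * π ^ m₂ = -p := by rw [← pow_add, hm, hπ]
  have := hfac N₁
  have := hfac N₂
  push_cast
  field_simp
  linear_combination (-(p : ℂ_[p])) ^ N₁ * (-(p : ℂ_[p])) ^ N₂ * e4 - p * e3

/-- Approximating `1/3` and `2/3` by the negative integers `(1 - p ^ (2k)) / 3` and
`2 (1 - p ^ (2k)) / 3` turns Wilson's theorem into an evaluation of a product of two entries. -/
theorem frobSum_third_mul (hp5 : 5 ≤ p) (hπ : π ^ (p - 1) = -(p : ℂ_[p])) {m₁ m₂ : ℕ}
    (hm : m₁ + m₂ = p - 1) :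
    frobSum π m₁ (1 / 3) * frobSum π m₂ (2 / 3) * (-1) ^ m₂ = p := by
  have hp0 : (0 : ℝ) < (p : ℝ)⁻¹ := by have := hp.out.pos; positivity
  have hp1 : (p : ℝ)⁻¹ < 1 := inv_lt_one_of_one_lt₀ (by exact_mod_cast hp.out.one_lt)
  have hp3 : ¬ 3 ∣ p := fun h => by
    have := (Nat.prime_dvd_prime_iff_eq Nat.prime_three hp.out).1 h
    omega
  have hmod : ∀ k, p ^ (2 * k) % 3 = 1 := fun k => by
    rw [pow_mul, Nat.pow_mod]
    have : p ^ 2 % 3 = 1 := by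
      rw [Nat.pow_mod]
      have : p % 3 = 1 ∨ p % 3 = 2 := by omega
      rcases this with h | h <;> rw [h]
    rw [this, one_pow, Nat.one_mod]
  choose N hN using fun k => (show ∃ N, 3 * N + 1 = p ^ (2 * k) from
    ⟨p ^ (2 * k) / 3, by have := hmod k; omega⟩)
  have hNc : ∀ k, 3 * (N k : ℂ_[p]) + 1 = (p : ℂ_[p]) ^ (2 * k) := fun k => by exact_mod_cast hN k
  have hlim : Tendsto (fun k => ((p : ℝ)⁻¹) ^ (2 * k)) atTop (𝓝 0) :=
    (tendsto_pow_atTop_nhds_zero_of_lt_one hp0.le hp1).comp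
      (tendsto_id.const_mul_atTop' two_pos)
  have h1 : Tendsto (fun k => -((N k : ℕ) : ℂ_[p])) atTop (𝓝 (1 / 3)) := by
    rw [tendsto_iff_norm_sub_tendsto_zero]
    refine hlim.congr fun k => ?_
    rw [show -((N k : ℕ) : ℂ_[p]) - 1 / 3 = -(p : ℂ_[p]) ^ (2 * k) / 3 by rw [← hNc]; ring,
      norm_div, norm_neg, norm_pow, norm_p_complex, norm_three hp5, div_one]
  have h2 : Tendsto (fun k => -((2 * N k : ℕ) : ℂ_[p])) atTop (𝓝 (2 / 3)) := by
    have := h1.const_mul 2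
    rw [mul_one_div] at this
    refine this.congr fun k => ?_
    push_cast
    ring
  have hle : ∀ n : ℕ, ‖-(n : ℂ_[p])‖ ≤ 1 := fun n => by
    rw [norm_neg]; exact IsUltrametricDist.norm_natCast_le_one _ n
  have t1 := tendsto_frobSum hp5 hπ m₁ (fun k => hle (N k)) h1
  have t2 := tendsto_frobSum hp5 hπ m₂ (fun k => hle (2 * N k)) h2
  have t3 : Tendsto (fun k => ((unitProd p (m₁ + p * N k) *
      unitProd p (m₂ + p * (2 * N k)) : ℕ) : ℂ_[p])) atTop (𝓝 (-(-1) ^ m₂)) := by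
    rw [tendsto_iff_norm_sub_tendsto_zero]
    refine squeeze_zero (fun _ => norm_nonneg _) (fun k => ?_) hlim
    have h3 : m₁ + p * N k + 1 + (m₂ + p * (2 * N k)) = p ^ (2 * k + 1) := by
      have : p * (3 * N k + 1) = p ^ (2 * k + 1) := by rw [hN, pow_succ, mul_comm]
      rw [← this]
      have := hp.out.one_lt
      have h4 : m₁ + m₂ + 1 = p := by omega
      linarith
    have h4 := norm_unitProd_mul_add_le (p := p) (by omega) (by omega) h3
    rw [Nat.add_mul_div_left _ _ hp.out.pos, Nat.div_eq_of_lt (show m₂ < p by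
      have := hp.out.one_lt; omega), zero_add, add_assoc, pow_add (-1 : ℂ_[p]) m₂,
      Even.neg_one_pow (n := p * (2 * N k) + 2 * N k) ⟨p * N k + N k, by ring⟩, mul_one] at h4
    rw [sub_neg_eq_add]
    refine h4.trans (pow_le_pow_of_le_one hp0.le hp1.le (by omega))
  have h5 := tendsto_nhds_unique ((t1.mul t2).mul t3) (tendsto_const_nhds.congr fun k =>
    (frobSum_neg_mul hπ hm (N₁ := N k) (N₂ := 2 * N k) (by
      have hodd := hp.out.odd_of_ne_two (by omega)
      have h6 : N k + 2 * N k + 1 = p ^ (2 * k) := by rw [← hN]; ring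
      have h7 : Odd (N k + 2 * N k + 1) := by rw [h6]; exact hodd.pow
      have := Nat.odd_add_one.1 h7
      exact Nat.not_odd_iff_even.1 this)).symm)
  linear_combination -h5

theorem frobKernelCoeff_zero (π : ℂ_[p]) (m : ℕ) :
    frobKernelCoeff p π 0 m = if 3 ∣ m then thetaCoeff p π p (m / 3) else 0 := by
  rw [frobKernelCoeff]
  split_ifs with h
  · rw [Finset.sum_eq_single (m / 3)]
    · rw [Nat.mul_div_cancel' h]
      simp [thetaCoeff_zero]
    · intro i hi hne
      rw [Finset.mem_range] at hi
      rw [zero_pow (by omega), mul_zero]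
    · intro h1
      exact absurd (Finset.mem_range.2 (Nat.lt_succ_self _)) h1
  · refine Finset.sum_eq_zero fun i hi => ?_
    rw [Finset.mem_range] at hi
    rw [zero_pow (by omega), mul_zero]

theorem dualBasis_zero_of_mod (π : ℂ_[p]) (j : Fin 2) (n : ℕ) (hn : n % 3 ≠ j + 1) :
    dualBasis p π 0 j n = 0 := by
  induction n using lacunaryInduction with
  | case1 => rw [dualBasis]
  | case2 => fin_cases j <;> simp_all [dualBasis]
  | case3 => fin_cases j <;> simp_all [dualBasis]
  | case4 n h1 h2 =>
    rw [dualBasis, h1 (by rwa [Nat.add_mod_right] at hn)]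
    simp

theorem dualBasis_zero_eq (π : ℂ_[p]) (j : Fin 2) (k : ℕ) :
    dualBasis p π 0 j (3 * k + (j + 1)) =
      (ascPochhammer ℂ_[p] k).eval (((j : ℕ) + 1 : ℂ_[p]) / 3) / (-π) ^ k := by
  induction k with
  | zero => fin_cases j <;> simp [dualBasis]
  | succ k ih =>
    rw [show 3 * (k + 1) + ((j : ℕ) + 1) = 3 * k + (j + 1) + 3 by ring, dualBasis, ih,
      ascPochhammer_succ_eval, pow_succ]
    push_cast
    rw [div_mul_eq_div_div_swap, neg_eq_neg_one_mul π, mul_pow, div_mul_eq_div_div]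
    ring

theorem dualFrobenius_zero_eq {i : ℕ} {j : Fin 2} {m : ℕ} (h : p * (j + 1) = 3 * m + i) :
    dualFrobenius p π 0 (dualBasis p π (0 ^ p) j) i =
      frobSum π m (((j : ℕ) + 1 : ℂ_[p]) / 3) := by
  rw [zero_pow hp.out.ne_zero, dualFrobenius, frobSum,
    ← Function.Injective.tsum_eq (g := fun k => 3 * k + ((j : ℕ) + 1))]
  · refine tsum_congr fun k => ?_
    have h1 : p * (3 * k + (j + 1)) = 3 * (m + p * k) + i := by rw [mul_add, h]; ring
    rw [h1, if_pos (Nat.le_add_left _ _), Nat.add_sub_cancel, frobKernelCoeff_zero,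
      if_pos (dvd_mul_right _ _), Nat.mul_div_cancel_left _ three_pos, dualBasis_zero_eq]
  · intro a b hab
    simpa using hab
  · intro r hr
    by_contra hne
    refine hr ?_
    simp only
    rw [dualBasis_zero_of_mod, mul_zero, ite_self]
    intro h1
    exact hne ⟨r / 3, by simp only; omega⟩

theorem dualFrobenius_zero_eq_zero {i : ℕ} {j : Fin 2} (h : p * (j + 1) % 3 ≠ i % 3) :
    dualFrobenius p π 0 (dualBasis p π (0 ^ p) j) i = 0 := by
  rw [zero_pow hp.out.ne_zero, dualFrobenius]
  refine (tsum_congr fun r => ?_).trans tsum_zero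
  by_cases hr : r % 3 = j + 1
  · split_ifs with hi
    · rw [frobKernelCoeff_zero, if_neg, zero_mul]
      intro h1
      refine h ?_
      have h2 : p * r % 3 = p * (j + 1) % 3 := by
        rw [Nat.mul_mod, hr, Nat.mul_mod p]
        congr 2
        have := j.2
        omega
      omega
    · rfl
  · rw [dualBasis_zero_of_mod _ _ _ hr, mul_zero, ite_self]

/-- At `a = 0` the Frobenius matrix is diagonal if `p ≡ 1 mod 3` and antidiagonal if `p ≡ 2 mod 3`;
in both cases the product of its nonzero entries is an instance of `frobSum_third_mul`. -/
theorem det_frobMatrix_zero (hp5 : 5 ≤ p) (hπ : π ^ (p - 1) = -(p : ℂ_[p])) :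
    (frobMatrix p π 0).det = p := by
  have hp3 : ¬ 3 ∣ p := fun h => by
    have := (Nat.prime_dvd_prime_iff_eq Nat.prime_three hp.out).1 h
    omega
  have hodd := Nat.odd_iff.1 (hp.out.odd_of_ne_two (by omega))
  have c0 : (((0 : Fin 2) : ℕ) + 1 : ℂ_[p]) / 3 = 1 / 3 := by simp
  have c1 : (((1 : Fin 2) : ℕ) + 1 : ℂ_[p]) / 3 = 2 / 3 := by
    rw [Fin.val_one]; norm_num
  rw [Matrix.det_fin_two]
  simp only [frobMatrix, Matrix.of_apply, Fin.val_zero, Fin.val_one, zero_add]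
  have : p % 3 = 1 ∨ p % 3 = 2 := by omega
  rcases this with h | h
  · rw [dualFrobenius_zero_eq (i := 1) (j := 0) (m := (p - 1) / 3) (by simp; omega),
      dualFrobenius_zero_eq (i := 1 + 1) (j := 1) (m := 2 * (p - 1) / 3) (by simp; omega),
      dualFrobenius_zero_eq_zero (i := 1) (j := 1) (by simp; omega), c0, c1, zero_mul, sub_zero]
    have e := frobSum_third_mul hp5 hπ (m₁ := (p - 1) / 3) (m₂ := 2 * (p - 1) / 3) (by omega)
    rwa [Even.neg_one_pow ⟨(p - 1) / 3, by omega⟩, mul_one] at e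
  · rw [dualFrobenius_zero_eq (i := 1 + 1) (j := 0) (m := (p - 2) / 3) (by simp; omega),
      dualFrobenius_zero_eq (i := 1) (j := 1) (m := (2 * p - 1) / 3) (by simp; omega),
      dualFrobenius_zero_eq_zero (i := 1) (j := 0) (by simp; omega), c0, c1, zero_mul, zero_sub]
    have e := frobSum_third_mul hp5 hπ (m₁ := (p - 2) / 3) (m₂ := (2 * p - 1) / 3) (by omega)
    rw [Odd.neg_one_pow (Nat.odd_iff.2 (by omega))] at e
    linear_combination e

end FrobeniusAtZero


/-! ### The exponential function and the splitting function of level two -/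

section CompositionWithMonomials

variable {K : Type*} [NontriviallyNormedField K]

/-- Substitution of a monomial in a power series. -/
theorem HasPowerSeriesOn.comp_mul_pow {f : K → K} {c : ℕ → K} {S : ℝ} (hf : HasPowerSeriesOn f c S)
    {R : ℝ} (l : K) {k : ℕ} (hk : k ≠ 0) (h : ∀ ρ : ℝ, 0 ≤ ρ → ρ < R → ‖l‖ * ρ ^ k < S) :
    HasPowerSeriesOn (fun a => f (l * a ^ k))
      (fun n => if k ∣ n then c (n / k) * l ^ (n / k) else 0) R := by
  have hk' : 0 < k := Nat.pos_of_ne_zero hk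
  have hinj : Function.Injective fun n : ℕ => k * n := mul_right_injective₀ hk
  refine ⟨fun ρ h1 h2 => ?_, fun a ha => ?_⟩
  · obtain ⟨σ, hσ1, hσ2⟩ := exists_between (h ρ h1.le h2)
    have hσ : 0 < σ := (by positivity : 0 ≤ ‖l‖ * ρ ^ k).trans_lt hσ1
    obtain ⟨C, hC⟩ := hf.1 σ hσ hσ2
    have C0 : 0 ≤ C := (by positivity : 0 ≤ ‖c 0‖ * σ ^ 0).trans (hC 0)
    refine ⟨C, fun n => ?_⟩
    simp only
    split_ifs with hn
    · obtain ⟨m, rfl⟩ := hn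
      rw [Nat.mul_div_cancel_left _ hk', norm_mul, norm_pow, pow_mul]
      calc _ = ‖c m‖ * (‖l‖ * ρ ^ k) ^ m := by rw [mul_pow]; ring
        _ ≤ ‖c m‖ * σ ^ m := by gcongr
        _ ≤ C := hC m
    · simpa using C0
  · have hs := hf.2 (l * a ^ k) (by rw [norm_mul, norm_pow]; exact h _ (norm_nonneg _) ha)
    rw [← hinj.hasSum_iff (fun n hn => by
      beta_reduce
      rw [if_neg (fun ⟨m, hm⟩ => hn ⟨m, hm.symm⟩), zero_mul])]
    refine hs.congr_fun fun m => ?_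
    simp only [Function.comp_apply]
    rw [if_pos (dvd_mul_right _ _), Nat.mul_div_cancel_left _ hk', mul_pow, pow_mul]
    ring

theorem hasPowerSeriesOn_one (R : ℝ) :
    HasPowerSeriesOn (fun _ : K => (1 : K)) (fun n => if n = 0 then 1 else 0) R := by
  refine ⟨fun ρ _ _ => ⟨1, fun n => ?_⟩, fun a _ => ?_⟩
  · rcases eq_or_ne n 0 with rfl | hn
    · simp
    · simp [hn]
  · refine (hasSum_ite_eq 0 (1 : K)).congr_fun fun n => ?_
    rcases eq_or_ne n 0 with rfl | hn
    · simp
    · simp [hn]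

theorem HasPowerSeriesOn.mono {f : K → K} {c : ℕ → K} {R S : ℝ} (hf : HasPowerSeriesOn f c R)
    (h : S ≤ R) : HasPowerSeriesOn f c S :=
  ⟨fun ρ h1 h2 => hf.1 ρ h1 (h2.trans_le h), fun a ha => hf.2 a (ha.trans_le h)⟩

variable [IsUltrametricDist K] [CompleteSpace K]

theorem HasPowerSeriesOn.exists_pow {f : K → K} {c : ℕ → K} {R : ℝ} (hf : HasPowerSeriesOn f c R)
    (n : ℕ) : ∃ d, HasPowerSeriesOn (fun a => f a ^ n) d R := by
  induction n with
  | zero => exact ⟨_, by simpa using hasPowerSeriesOn_one R⟩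
  | succ n ih =>
    obtain ⟨d, hd⟩ := ih
    exact ⟨_, by simpa only [pow_succ] using hd.mul hf⟩

end CompositionWithMonomials

section Exponential

variable {p : ℕ} [hp : Fact p.Prime] {π : ℂ_[p]}

theorem hasPowerSeriesOn_exp (hπ : π ^ (p - 1) = -(p : ℂ_[p])) :
    HasPowerSeriesOn (NormedSpace.exp : ℂ_[p] → ℂ_[p]) (fun n => ((n.factorial : ℂ_[p]))⁻¹) ‖π‖ := by
  have e : (NormedSpace.exp : ℂ_[p] → ℂ_[p]) = fun a => ∑' n : ℕ, ((n.factorial : ℂ_[p]))⁻¹ * a ^ n := by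
    rw [NormedSpace.exp_eq_tsum_div]
    funext a
    exact tsum_congr fun n => by rw [div_eq_inv_mul]
  rw [e]
  refine HasPowerSeriesOn.of_bound fun ρ h1 h2 => ⟨1, fun n => ?_⟩
  have hπ0 := norm_pi_pos hπ
  rw [norm_inv]
  calc _ ≤ (‖π‖ ^ n)⁻¹ * ‖π‖ ^ n := by
        gcongr
        exact norm_pi_pow_le_norm_factorial hπ n
    _ = 1 := inv_mul_cancel₀ (by positivity)

theorem mem_ball_radius_exp (hπ : π ^ (p - 1) = -(p : ℂ_[p])) {x : ℂ_[p]} (hx : ‖x‖ < ‖π‖) :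
    x ∈ Metric.eball 0 (NormedSpace.expSeries ℂ_[p] ℂ_[p]).radius := by
  obtain ⟨ρ, h1, h2⟩ := exists_between hx
  have h0 : 0 < ρ := (norm_nonneg _).trans_lt h1
  lift ρ to NNReal using h0.le
  have h := ((hasPowerSeriesOn_exp hπ).hasFPowerSeriesOnBall (by exact_mod_cast h0) h2).r_le
  rw [← NormedSpace.expSeries_eq_ofScalars ℂ_[p] ℂ_[p]] at h
  refine Metric.eball_subset_eball h ?_
  rw [Metric.eball_coe, mem_ball_zero_iff]
  exact h1

theorem exp_add_of_norm_lt (hπ : π ^ (p - 1) = -(p : ℂ_[p])) {x y : ℂ_[p]} (hx : ‖x‖ < ‖π‖)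
    (hy : ‖y‖ < ‖π‖) : NormedSpace.exp (x + y) = NormedSpace.exp x * NormedSpace.exp y :=
  NormedSpace.exp_add_of_mem_ball (mem_ball_radius_exp hπ hx) (mem_ball_radius_exp hπ hy)

theorem exp_mul_exp_neg (hπ : π ^ (p - 1) = -(p : ℂ_[p])) {x : ℂ_[p]} (hx : ‖x‖ < ‖π‖) :
    NormedSpace.exp x * NormedSpace.exp (-x) = 1 := by
  rw [← exp_add_of_norm_lt hπ hx (by rwa [norm_neg]), add_neg_cancel, NormedSpace.exp_zero]

theorem exp_ne_zero_of_norm_lt (hπ : π ^ (p - 1) = -(p : ℂ_[p])) {x : ℂ_[p]} (hx : ‖x‖ < ‖π‖) :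
    NormedSpace.exp x ≠ 0 :=
  left_ne_zero_of_mul_eq_one (exp_mul_exp_neg hπ hx)

theorem hasDerivAt_exp_of_norm_lt (hπ : π ^ (p - 1) = -(p : ℂ_[p])) {x : ℂ_[p]} (hx : ‖x‖ < ‖π‖) :
    HasDerivAt (NormedSpace.exp : ℂ_[p] → ℂ_[p]) (NormedSpace.exp x) x := by
  have h := hasPowerSeriesOn_exp hπ
  refine (h.differentiableAt hx).hasDerivAt.congr_deriv ((h.deriv.2 x hx).unique ?_)
  refine (h.2 x hx).congr_fun fun n => ?_
  have := n.cast_add_one_ne_zero (R := ℂ_[p])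
  beta_reduce
  rw [Nat.factorial_succ]
  push_cast
  rw [mul_inv, ← mul_assoc, mul_inv_cancel₀ this, one_mul]

theorem inv_splitRate_pow_le (p : ℕ) [hp : Fact p.Prime] : ((splitRate p)⁻¹) ^ p ≤ p := by
  have h1 : (1 : ℝ) < p := by exact_mod_cast hp.out.one_lt
  have h0 : (0 : ℝ) < p := by linarith
  rw [splitRate, ← Real.rpow_neg h0.le, neg_neg, ← Real.rpow_mul_natCast h0.le]
  nth_rewrite 5 [← Real.rpow_one (p : ℝ)]
  refine Real.rpow_le_rpow_of_exponent_le h1.le ?_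
  rw [div_mul_eq_mul_div, div_le_one (by positivity)]
  nlinarith

theorem one_lt_inv_splitRate (p : ℕ) [hp : Fact p.Prime] : 1 < (splitRate p)⁻¹ :=
  (one_lt_inv₀ splitRate_pos).2 splitRate_lt_one

/-- `θ(t) ^ p = exp (p π (t - t ^ p))`, where the two exponentials converge separately. -/
theorem theta_pow_p (hπ : π ^ (p - 1) = -(p : ℂ_[p])) {t : ℂ_[p]} (ht : ‖t‖ < (splitRate p)⁻¹) :
    theta p π 1 t ^ p * NormedSpace.exp (-(p * π) * t) * NormedSpace.exp ((p * π) * t ^ p) = 1 := by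
  have hπ0 := norm_pi_pos hπ
  have hp1 : (1 : ℝ) < p := by exact_mod_cast hp.out.one_lt
  have hτ1 := one_lt_inv_splitRate p
  have hbound : ∀ k : ℕ, k ≠ 0 → k ≤ p → ∀ ρ : ℝ, 0 ≤ ρ → ρ < (splitRate p)⁻¹ →
      ‖(p : ℂ_[p]) * π‖ * ρ ^ k < ‖π‖ := by
    intro k hk hkp ρ h1 h2
    have h3 : ρ ^ k < p := by
      calc ρ ^ k < ((splitRate p)⁻¹) ^ k := by gcongr
        _ ≤ ((splitRate p)⁻¹) ^ p := pow_le_pow_right₀ hτ1.le hkp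
        _ ≤ p := inv_splitRate_pow_le p
    rw [norm_mul, norm_p_complex]
    calc _ < (p : ℝ)⁻¹ * ‖π‖ * p := by gcongr
      _ = ‖π‖ := by field_simp
  have hp0 := hp.out.ne_zero
  have hps := hasPowerSeriesOn_theta hπ
  obtain ⟨d, hd⟩ := hps.exists_pow p
  have he1 := (hasPowerSeriesOn_exp hπ).comp_mul_pow (-(p * π)) one_ne_zero
    (by rw [norm_neg]; exact hbound 1 one_ne_zero hp.out.one_lt.le)
  have he2 := (hasPowerSeriesOn_exp hπ).comp_mul_pow ((p : ℂ_[p]) * π) hp0 (hbound p hp0 le_rfl)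
  have hall := (hd.mul he1).mul he2
  simp only [pow_one] at hall
  refine (eq_of_deriv_eq_zero hall (fun x _ hx => HasDerivAt.deriv ?_) ht).trans ?_
  · have b1 := hbound 1 one_ne_zero hp.out.one_lt.le ‖x‖ (norm_nonneg _) hx
    have b2 := hbound p hp0 le_rfl ‖x‖ (norm_nonneg _) hx
    rw [pow_one] at b1
    have d1 := (hasDerivAt_theta hπ hx).fun_pow p
    have d2 := (hasDerivAt_exp_of_norm_lt hπ (x := -(p * π) * x)
      (by rwa [norm_mul, norm_neg])).comp x ((hasDerivAt_id x).const_mul (-(p * π)))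
    have d3 := (hasDerivAt_exp_of_norm_lt hπ (x := (p : ℂ_[p]) * π * x ^ p)
      (by rwa [norm_mul, norm_pow])).comp x ((hasDerivAt_pow p x).const_mul ((p : ℂ_[p]) * π))
    refine ((d1.mul d2).mul d3).congr_deriv ?_
    simp only [Pi.mul_apply, Function.comp_apply]
    have e : theta p π 1 x ^ p = theta p π 1 x ^ (p - 1) * theta p π 1 x := by
      rw [← pow_succ, Nat.sub_add_cancel hp.out.one_lt.le]
    rw [e]
    ring
  · simp [theta_zero hπ, hp0, NormedSpace.exp_zero]

end Exponential

section ThetaTwo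

variable {p : ℕ} [hp : Fact p.Prime] {π : ℂ_[p]}

/-- `exp π (t - t ^ (p ^ 2))` is the product of `exp π (t - t ^ p)` and
`exp π (t ^ p - t ^ (p ^ 2))`. -/
theorem theta_two_eq (hπ : π ^ (p - 1) = -(p : ℂ_[p])) {t : ℂ_[p]} (ht : ‖t‖ ≤ 1) :
    theta p π 2 t = theta p π 1 t * theta p π 1 (t ^ p) := by
  have hp0 := hp.out.ne_zero
  have hτ := splitRate_pos (p := p)
  have hτ1 := splitRate_lt_one (p := p)
  obtain ⟨S, hS1, hS2⟩ : ∃ S : ℝ, 1 < S ∧ S ^ p ≤ (splitRate p)⁻¹ := by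
    refine ⟨(splitRate p)⁻¹ ^ ((p : ℝ)⁻¹), Real.one_lt_rpow (one_lt_inv_splitRate p)
      (by have := hp.out.pos; positivity), ?_⟩
    rw [← Real.rpow_mul_natCast (by positivity), inv_mul_cancel₀ (by exact_mod_cast hp0),
      Real.rpow_one]
  have hS3 : S ≤ (splitRate p)⁻¹ := (le_self_pow₀ hS1.le hp0).trans hS2
  have h1 := (hasPowerSeriesOn_theta hπ).mono hS3
  have h2 := (hasPowerSeriesOn_theta hπ).comp_mul_pow (R := S) 1 hp0 (fun ρ h0 hρ => by
    rw [norm_one, one_mul]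
    exact (pow_lt_pow_left₀ hρ h0 hp0).trans_le hS2)
  have h3 := (h2.mul h1).2 t (ht.trans_lt hS1)
  simp only [one_mul, one_pow, mul_one] at h3
  rw [mul_comm, ← h3.tsum_eq, theta]
  refine tsum_congr fun n => ?_
  congr 1
  rw [thetaCoeff_eq_coeff π (pow_ne_zero 2 hp0)]
  have e : expPow (-π) (p ^ 2) (pow_ne_zero 2 hp0) * expPow π 1 one_ne_zero =
      PowerSeries.expand p hp0 (thetaSeries p π) * thetaSeries p π := by
    rw [thetaSeries, map_mul, expand_expPow, expand_expPow]
    have e1 : expPow π (p * 1) (mul_ne_zero hp0 one_ne_zero) * expPow (-π) p hp0 = 1 := by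
      rw [expPow_congr (mul_ne_zero hp0 one_ne_zero) hp0 rfl (mul_one p), expPow_mul_expPow,
        add_neg_cancel, expPow_zero]
    rw [expPow_congr (pow_ne_zero 2 hp0) (mul_ne_zero hp0 hp0) rfl (pow_two p)]
    linear_combination (-(expPow (-π) (p * p) (mul_ne_zero hp0 hp0) * expPow π 1 one_ne_zero)) * e1
  rw [e, PowerSeries.coeff_mul]
  refine Finset.sum_congr rfl fun x _ => ?_
  rw [PowerSeries.coeff_expand, coeff_thetaSeries, coeff_thetaSeries]

/-- `θ(t) ≡ 1 + π t` modulo an ideal strictly smaller than `(π)`. -/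
theorem exists_norm_theta_sub_le (hp5 : 5 ≤ p) (hπ : π ^ (p - 1) = -(p : ℂ_[p])) :
    ∃ δ < ‖π‖, ∀ t : ℂ_[p], ‖t‖ ≤ 1 → ‖theta p π 1 t - 1 - π * t‖ ≤ δ := by
  have hπ0 := norm_pi_pos hπ
  have hπ1 := norm_pi_lt_one hπ
  have hτ := splitRate_pos (p := p)
  have hτ1 := splitRate_lt_one (p := p)
  refine ⟨max (‖π‖ ^ 2) (splitRate p ^ p), max_lt (by nlinarith) (splitRate_pow_lt_norm_pi hp5 hπ),
    fun t ht => ?_⟩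
  have hsmall : ∀ n < p, thetaCoeff p π p n = π ^ n / n.factorial := fun n hn => by
    simp [thetaCoeff, Nat.div_eq_of_lt hn]
  have h := (hasPowerSeriesOn_theta hπ).2 t (ht.trans_lt (one_lt_inv_splitRate p))
  have h2 := (hasSum_nat_add_iff' 2).2 h
  rw [Finset.sum_range_succ, Finset.sum_range_one, hsmall 0 (by omega), hsmall 1 (by omega)] at h2
  simp only [pow_zero, pow_one, Nat.factorial_zero, Nat.factorial_one, Nat.cast_one, div_one,
    mul_one, ← sub_sub] at h2
  rw [← h2.tsum_eq]
  refine IsUltrametricDist.norm_tsum_le_of_forall_le_of_nonneg (by positivity) fun n => ?_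
  rw [norm_mul, norm_pow]
  refine (mul_le_of_le_one_right (norm_nonneg _) (pow_le_one₀ (norm_nonneg _) ht)).trans ?_
  rcases lt_or_ge (n + 2) p with hn | hn
  · refine le_max_of_le_left ?_
    rw [hsmall _ hn, norm_div, norm_natCast_of_not_dvd p (fun h => by
      have := (hp.out.dvd_factorial).1 h
      omega), div_one, norm_pow]
    exact pow_le_pow_of_le_one hπ0.le hπ1.le (by omega)
  · exact le_max_of_le_right ((norm_thetaCoeff_le hπ _).trans
      (pow_le_pow_of_le_one hτ.le hτ1.le hn))

end ThetaTwo


/-! ### The cubic Gauss sum -/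

section RootsOfUnity

variable {p : ℕ} [hp : Fact p.Prime] {π : ℂ_[p]}

theorem norm_eq_one_of_pow_eq_one {u : ℂ_[p]} {n : ℕ} (hn : n ≠ 0) (hu : u ^ n = 1) : ‖u‖ = 1 := by
  have := congrArg norm hu
  rw [norm_pow, norm_one] at this
  exact (pow_eq_one_iff_of_nonneg (norm_nonneg _) hn).1 this

theorem norm_sub_le_max' (x y : ℂ_[p]) : ‖x - y‖ ≤ max ‖x‖ ‖y‖ := by
  rw [sub_eq_add_neg, ← norm_neg y]
  exact IsUltrametricDist.norm_add_le_max _ _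

/-- Distinct roots of unity of order prime to `p` are at distance one. -/
theorem norm_sub_eq_one_of_pow_eq_one {u v : ℂ_[p]} {n : ℕ} (hn : ¬ p ∣ n) (hu : u ^ n = 1)
    (hv : v ^ n = 1) (huv : u ≠ v) : ‖u - v‖ = 1 := by
  have hn0 : n ≠ 0 := fun h => hn (h ▸ dvd_zero p)
  have hu1 := norm_eq_one_of_pow_eq_one hn0 hu
  have hv1 := norm_eq_one_of_pow_eq_one hn0 hv
  have hv0 : v ≠ 0 := fun h => by simp [h] at hv1
  refine le_antisymm ((norm_sub_le_max' _ _).trans (by rw [hu1, hv1, max_self])) ?_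
  set w := u / v with hw
  have hw1 : w ^ n = 1 := by rw [hw, div_pow, hu, hv, div_one]
  have hne : w - 1 ≠ 0 := fun h => huv (by
    rw [sub_eq_zero, hw, div_eq_one_iff_eq hv0] at h; exact h)
  have hwn := norm_eq_one_of_pow_eq_one hn0 hw1
  have hgeom : ∑ k ∈ Finset.range n, w ^ k = 0 := by
    have := geom_sum_mul w n
    rw [hw1, sub_self] at this
    exact (mul_eq_zero.1 this).resolve_right hne
  have h1 : ∀ k, ‖w ^ k - 1‖ ≤ ‖w - 1‖ := fun k => by
    rw [← geom_sum_mul, norm_mul]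
    refine mul_le_of_le_one_left (norm_nonneg _)
      (IsUltrametricDist.norm_sum_le_of_forall_le_of_nonneg zero_le_one fun i _ => ?_)
    rw [norm_pow, hwn, one_pow]
  have h2 : (n : ℂ_[p]) = -∑ k ∈ Finset.range n, (w ^ k - 1) := by
    rw [Finset.sum_sub_distrib, hgeom]
    simp
  have h3 : ‖(n : ℂ_[p])‖ ≤ ‖w - 1‖ := by
    rw [h2, norm_neg]
    exact IsUltrametricDist.norm_sum_le_of_forall_le_of_nonneg (norm_nonneg _) fun k _ => h1 k
  rw [norm_natCast_of_not_dvd p hn, show w - 1 = (u - v) / v by rw [hw, sub_div, div_self hv0],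
    norm_div, hv1, div_one] at h3
  exact h3

theorem theta_two_pow_p (hπ : π ^ (p - 1) = -(p : ℂ_[p])) {t : ℂ_[p]}
    (ht : t ^ (p ^ 2 - 1) = 1) : theta p π 2 t ^ p = 1 := by
  have hp1 := hp.out.one_lt
  have hn : p ^ 2 - 1 ≠ 0 := by
    have : 1 < p ^ 2 := Nat.one_lt_pow two_ne_zero hp1
    omega
  have h1 := norm_eq_one_of_pow_eq_one hn ht
  have h2 : (t ^ p) ^ p = t := by
    rw [← pow_mul, ← pow_two, ← Nat.sub_add_cancel (Nat.one_le_pow 2 p hp.out.pos), pow_succ, ht,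
      one_mul]
  have hlt : ‖(p : ℂ_[p]) * π‖ < ‖π‖ := by
    rw [norm_mul, norm_p_complex]
    exact mul_lt_of_lt_one_left (norm_pi_pos hπ) (inv_lt_one_of_one_lt₀ (by exact_mod_cast hp1))
  have e1 := theta_pow_p hπ (t := t) (by rw [h1]; exact one_lt_inv_splitRate p)
  have e2 := theta_pow_p hπ (t := t ^ p) (by
    rw [norm_pow, h1, one_pow]; exact one_lt_inv_splitRate p)
  have e3 := exp_mul_exp_neg hπ (x := p * π * t) (by rwa [norm_mul, h1, mul_one])
  have e4 := exp_mul_exp_neg hπ (x := p * π * t ^ p) (by rwa [norm_mul, norm_pow, h1, one_pow, mul_one])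
  rw [h2] at e2
  rw [theta_two_eq hπ h1.le, mul_pow]
  simp only [neg_mul] at e1 e2
  have e5 : NormedSpace.exp (p * π * t) ≠ 0 := left_ne_zero_of_mul_eq_one e3
  have e6 : NormedSpace.exp (p * π * t ^ p) ≠ 0 := left_ne_zero_of_mul_eq_one e4
  have e7 : NormedSpace.exp (-(p * π * t)) = (NormedSpace.exp (p * π * t))⁻¹ :=
    eq_inv_of_mul_eq_one_right e3
  have e8 : NormedSpace.exp (-(p * π * t ^ p)) = (NormedSpace.exp (p * π * t ^ p))⁻¹ :=
    eq_inv_of_mul_eq_one_right e4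
  rw [e7] at e1
  rw [e8] at e2
  field_simp at e1 e2
  refine mul_right_cancel₀ (mul_ne_zero e5 e6) ?_
  linear_combination e1 * (theta p π 1 (t ^ p) ^ p * NormedSpace.exp (p * π * t)) +
    NormedSpace.exp (p * π * t) * e2

theorem sum_nthRootsFinset_eq_zero {n : ℕ} {ω : ℂ_[p]} (hn : 0 < n) (hω : ω ^ n = 1) {j : ℤ}
    (hj : ω ^ j ≠ 1) : ∑ t ∈ Polynomial.nthRootsFinset n (1 : ℂ_[p]), t ^ j = 0 := by
  have hω0 : ω ≠ 0 := fun h => by simp [h, hn.ne'] at hω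
  have h1 : ∑ t ∈ Polynomial.nthRootsFinset n (1 : ℂ_[p]), (ω * t) ^ j =
      ∑ t ∈ Polynomial.nthRootsFinset n (1 : ℂ_[p]), t ^ j := by
    refine Finset.sum_nbij' (fun t => ω * t) (fun t => ω⁻¹ * t) ?_ ?_ ?_ ?_ ?_
    · intro t ht
      rw [Polynomial.mem_nthRootsFinset hn] at ht ⊢
      rw [mul_pow, hω, ht, one_mul]
    · intro t ht
      rw [Polynomial.mem_nthRootsFinset hn] at ht ⊢
      rw [mul_pow, inv_pow, hω, ht, inv_one, one_mul]
    · intro t _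
      rw [inv_mul_cancel_left₀ hω0]
    · intro t _
      rw [mul_inv_cancel_left₀ hω0]
    · intro t _
      rfl
  simp only [mul_zpow, ← Finset.mul_sum] at h1
  have h2 : (ω ^ j - 1) * ∑ t ∈ Polynomial.nthRootsFinset n (1 : ℂ_[p]), t ^ j = 0 := by
    rw [sub_mul, h1, one_mul, sub_self]
  exact (mul_eq_zero.1 h2).resolve_left (sub_ne_zero.2 hj)

theorem exists_isPrimitiveRoot_of_not_dvd {n : ℕ} (hn : ¬ p ∣ n) :
    ∃ ζ : ℂ_[p], IsPrimitiveRoot ζ n := by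
  have : NeZero ((n : ℕ) : ℂ_[p]) := ⟨fun h => by
    have h1 := norm_natCast_of_not_dvd p hn
    rw [h, norm_zero] at h1
    exact zero_ne_one h1⟩
  exact HasEnoughRootsOfUnity.exists_primitiveRoot ℂ_[p] n

end RootsOfUnity

section GaussSum

variable {p : ℕ} [hp : Fact p.Prime] {π : ℂ_[p]}

/-- The sum of `θ_2` over a coset of `μ_{p-1}` in `μ_{p^2-1}`: either all the values are `1`, or
they are the nontrivial `p`-th roots of unity. -/
theorem sum_theta_two (hp5 : 5 ≤ p) (hπ : π ^ (p - 1) = -(p : ℂ_[p])) {t : ℂ_[p]}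
    (ht : t ^ (p ^ 2 - 1) = 1) [DecidableEq ℂ_[p]] :
    ∑ c ∈ Polynomial.nthRootsFinset (p - 1) (1 : ℂ_[p]), theta p π 2 (c * t) =
      (if t ^ p = -t then (p : ℂ_[p]) else 0) - 1 := by
  have hp1 := hp.out.one_lt
  have hp0 := hp.out.ne_zero
  have hpm : 0 < p - 1 := by omega
  have hp2m : ¬ p ∣ p ^ 2 - 1 := fun h => by
    have h1 : 1 ≤ p ^ 2 := Nat.one_le_pow _ _ hp.out.pos
    have h2 := (Nat.dvd_sub_iff_right h1 (dvd_pow_self p two_ne_zero)).1 h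
    exact hp.out.one_lt.ne' (Nat.dvd_one.1 h2)
  have hpd : ¬ p ∣ p - 1 := fun h => by have := Nat.le_of_dvd hpm h; omega
  have ht1 := norm_eq_one_of_pow_eq_one (fun h => hp2m (by rw [h]; exact dvd_zero p)) ht
  obtain ⟨ζ, hζ⟩ := exists_isPrimitiveRoot_of_not_dvd (p := p) hpd
  have hcard := hζ.card_nthRootsFinset
  have hmem : ∀ c ∈ Polynomial.nthRootsFinset (p - 1) (1 : ℂ_[p]), c ^ (p - 1) = 1 := fun c hc =>
    (Polynomial.mem_nthRootsFinset hpm 1).1 hc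
  have hc1 : ∀ c ∈ Polynomial.nthRootsFinset (p - 1) (1 : ℂ_[p]), ‖c‖ = 1 := fun c hc =>
    norm_eq_one_of_pow_eq_one hpm.ne' (hmem c hc)
  have hcp : ∀ c ∈ Polynomial.nthRootsFinset (p - 1) (1 : ℂ_[p]), c ^ p = c := fun c hc => by
    rw [← mul_pow_sub_one hp0, hmem c hc, mul_one]
  split_ifs with htp
  · rw [Finset.sum_congr rfl (g := fun _ => (1 : ℂ_[p])), Finset.sum_const, hcard, nsmul_eq_mul,
      mul_one, Nat.cast_sub hp1.le, Nat.cast_one]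
    intro c hc
    have h1 : ‖c * t‖ = 1 := by rw [norm_mul, hc1 c hc, ht1, one_mul]
    rw [theta_two_eq hπ h1.le, mul_pow, hcp c hc, htp, mul_neg]
    exact theta_mul_theta_neg hπ (by omega) (by rw [h1]; exact one_lt_inv_splitRate p)
  · obtain ⟨δ, hδ, hδt⟩ := exists_norm_theta_sub_le hp5 hπ
    have hπ1 := norm_pi_lt_one hπ
    have hπ0 := norm_pi_pos hπ
    -- `t + t ^ p` is a unit
    have hunit : ‖t + t ^ p‖ = 1 := by
      rw [add_comm, ← sub_neg_eq_add]
      refine norm_sub_eq_one_of_pow_eq_one hp2m ?_ ?_ htp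
      · rw [← pow_mul, mul_comm, pow_mul, ht, one_pow]
      · rw [Even.neg_pow, ht]
        obtain ⟨k, hk⟩ := hp.out.odd_of_ne_two (by omega)
        exact ⟨2 * k ^ 2 + 2 * k, by rw [hk]; ring_nf; omega⟩
    have hexp : ∀ c, ‖c‖ = 1 → c ^ p = c →
        ‖theta p π 2 (c * t) - 1 - π * c * (t + t ^ p)‖ ≤ max δ (‖π‖ ^ 2) := by
      intro c h1 h2
      have e1 : ‖c * t‖ ≤ 1 := by rw [norm_mul, h1, ht1, one_mul]
      have e2 : ‖(c * t) ^ p‖ ≤ 1 := by rw [norm_pow]; exact pow_le_one₀ (norm_nonneg _) e1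
      have d1 := hδt _ e1
      have d2 := hδt _ e2
      have hδ0 : 0 ≤ δ := (norm_nonneg _).trans d1
      have d3 : ‖theta p π 1 (c * t)‖ ≤ 1 := by
        rw [show theta p π 1 (c * t) = (theta p π 1 (c * t) - 1 - π * (c * t)) +
          (1 + π * (c * t)) by ring]
        refine (IsUltrametricDist.norm_add_le_max _ _).trans (max_le (d1.trans (hδ.le.trans hπ1.le)) ?_)
        refine (IsUltrametricDist.norm_add_le_max _ _).trans (max_le norm_one.le ?_)
        rw [norm_mul]
        exact mul_le_one₀ hπ1.le (norm_nonneg _) e1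
      rw [theta_two_eq hπ e1, show theta p π 1 (c * t) * theta p π 1 ((c * t) ^ p) - 1 -
          π * c * (t + t ^ p) = theta p π 1 (c * t) * (theta p π 1 ((c * t) ^ p) - 1 -
          π * (c * t) ^ p) + (theta p π 1 (c * t) - 1 - π * (c * t)) * (1 + π * (c * t) ^ p) +
          π ^ 2 * ((c * t) * (c * t) ^ p) by
        have : (c * t) ^ p = c * t ^ p := by rw [mul_pow, h2]
        rw [this]; ring]
      refine (IsUltrametricDist.norm_add_le_max _ _).trans (max_le
        ((IsUltrametricDist.norm_add_le_max _ _).trans (max_le ?_ ?_)) ?_)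
      · rw [norm_mul]
        exact le_max_of_le_left ((mul_le_of_le_one_left (norm_nonneg _) d3).trans d2)
      · rw [norm_mul]
        refine le_max_of_le_left ((mul_le_of_le_one_right (norm_nonneg _) ?_).trans d1)
        refine (IsUltrametricDist.norm_add_le_max _ _).trans (max_le norm_one.le ?_)
        rw [norm_mul]
        exact mul_le_one₀ hπ1.le (norm_nonneg _) e2
      · rw [norm_mul, norm_pow, norm_mul]
        exact le_max_of_le_right (mul_le_of_le_one_right (by positivity)
          (mul_le_one₀ e1 (norm_nonneg _) e2))
    have hmax : max δ (‖π‖ ^ 2) < ‖π‖ := max_lt hδ (by nlinarith)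
    have hcong : ∀ x y z : ℂ_[p], ‖x - y‖ ≤ max δ (‖π‖ ^ 2) → ‖y - z‖ = ‖π‖ → x ≠ z := by
      intro x y z h1 h2 h3
      rw [h3, norm_sub_rev] at h1
      exact absurd (h2 ▸ h1) (not_le.2 hmax)
    set P := (Polynomial.nthRootsFinset p (1 : ℂ_[p])).erase 1 with hP
    have himg : ∀ c ∈ Polynomial.nthRootsFinset (p - 1) (1 : ℂ_[p]), theta p π 2 (c * t) ∈ P := by
      intro c hc
      rw [hP, Finset.mem_erase, Polynomial.mem_nthRootsFinset hp.out.pos]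
      refine ⟨hcong _ (1 + π * c * (t + t ^ p)) _ ?_ ?_, theta_two_pow_p hπ ?_⟩
      · rw [← sub_sub]; exact hexp c (hc1 c hc) (hcp c hc)
      · rw [add_sub_cancel_left, norm_mul, norm_mul, hc1 c hc, hunit, mul_one, mul_one]
      · have : c ^ (p ^ 2 - 1) = 1 := by
          rw [show p ^ 2 - 1 = (p - 1) * (p + 1) by
            rw [mul_comm, ← Nat.sq_sub_sq, one_pow], pow_mul, hmem c hc, one_pow]
        rw [mul_pow, this, ht, one_mul]
    have hinj : Set.InjOn (fun c => theta p π 2 (c * t))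
        (Polynomial.nthRootsFinset (p - 1) (1 : ℂ_[p]) : Set ℂ_[p]) := by
      intro c hc d hd hcd
      by_contra hne
      have e1 := hexp c (hc1 c hc) (hcp c hc)
      have e2 := hexp d (hc1 d hd) (hcp d hd)
      simp only at hcd
      rw [hcd] at e1
      have e3 : ‖π * c * (t + t ^ p) - π * d * (t + t ^ p)‖ = ‖π‖ := by
        rw [← sub_mul, ← mul_sub, norm_mul, norm_mul, hunit,
          norm_sub_eq_one_of_pow_eq_one hpd (hmem c hc) (hmem d hd) hne, mul_one, mul_one]
      have e4 : ‖π * c * (t + t ^ p) - π * d * (t + t ^ p)‖ ≤ max δ (‖π‖ ^ 2) := by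
        rw [show π * c * (t + t ^ p) - π * d * (t + t ^ p) =
          (theta p π 2 (d * t) - 1 - π * d * (t + t ^ p)) -
          (theta p π 2 (d * t) - 1 - π * c * (t + t ^ p)) by ring]
        exact (norm_sub_le_max' _ _).trans (max_le e2 e1)
      exact absurd (e3 ▸ e4) (not_le.2 hmax)
    have h1mem : (1 : ℂ_[p]) ∈ Polynomial.nthRootsFinset p (1 : ℂ_[p]) :=
      (Polynomial.mem_nthRootsFinset hp.out.pos 1).2 (one_pow _)
    have hPcard : P.card ≤ p - 1 := by
      rw [hP, Finset.card_erase_of_mem h1mem]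
      refine Nat.sub_le_sub_right ?_ 1
      exact (@Multiset.toFinset_card_le _ (_) _).trans (Polynomial.card_nthRoots _ _)
    have himage : (Polynomial.nthRootsFinset (p - 1) (1 : ℂ_[p])).image
        (fun c => theta p π 2 (c * t)) = P := by
      refine Finset.eq_of_subset_of_card_le (fun x hx => ?_) ?_
      · obtain ⟨c, hc, rfl⟩ := Finset.mem_image.1 hx
        exact himg c hc
      · rw [Finset.card_image_of_injOn hinj, hcard]
        exact hPcard
    have hsum : ∑ c ∈ Polynomial.nthRootsFinset (p - 1) (1 : ℂ_[p]), theta p π 2 (c * t) =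
        ∑ x ∈ P, x := by
      rw [← himage, Finset.sum_image hinj]
    -- a value of `θ_2` serves as a nontrivial root of unity
    have h1c : (1 : ℂ_[p]) ∈ Polynomial.nthRootsFinset (p - 1) (1 : ℂ_[p]) :=
      (Polynomial.mem_nthRootsFinset hpm 1).2 (one_pow _)
    have hω := himg 1 h1c
    rw [hP, Finset.mem_erase, Polynomial.mem_nthRootsFinset hp.out.pos] at hω
    have hz := sum_nthRootsFinset_eq_zero hp.out.pos hω.2 (j := 1) (by rw [zpow_one]; exact hω.1)
    simp only [zpow_one] at hz
    rw [hsum, hP]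
    have := Finset.sum_erase_add (Polynomial.nthRootsFinset p (1 : ℂ_[p])) (fun x => x) h1mem
    rw [hz] at this
    linear_combination this

/-- Stickelberger's evaluation of the cubic Gauss sum over the field with `p ^ 2` elements, when
`p ≡ 2 mod 3`. The cubic character is trivial on `μ_{p-1}`, so `θ_2` may be averaged over the cosets
of this group; only the coset of the elements of trace zero contributes. -/
theorem gaussSum_cubic (hp5 : 5 ≤ p) (hp3 : p % 3 = 2) (hπ : π ^ (p - 1) = -(p : ℂ_[p])) :
    gaussSum p π 2 (((p : ℤ) ^ 2 - 1) / 3) = -p := by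
  classical
  have hp1 := hp.out.one_lt
  have hpm : 0 < p - 1 := by omega
  have hsq : p ^ 2 - 1 = (p - 1) * (p + 1) := by rw [mul_comm, ← Nat.sq_sub_sq, one_pow]
  have hp2m : ¬ p ∣ p ^ 2 - 1 := fun h => by
    have h1 : 1 ≤ p ^ 2 := Nat.one_le_pow _ _ hp.out.pos
    have h2 := (Nat.dvd_sub_iff_right h1 (dvd_pow_self p two_ne_zero)).1 h
    exact hp.out.one_lt.ne' (Nat.dvd_one.1 h2)
  have hpd : ¬ p ∣ p - 1 := fun h => by have := Nat.le_of_dvd hpm h; omega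
  have hn : 0 < p ^ 2 - 1 := by rw [hsq]; positivity
  obtain ⟨m, hm⟩ : ∃ m, p + 1 = 3 * m := ⟨(p + 1) / 3, by omega⟩
  have hm2 : Even m := by
    obtain ⟨k, hk⟩ := hp.out.odd_of_ne_two (by omega)
    rw [hk] at hm
    exact Nat.even_iff.2 (by omega)
  have hj : ((p : ℤ) ^ 2 - 1) / 3 = ((p - 1) * m : ℕ) := by
    refine Int.ediv_eq_of_eq_mul_right three_ne_zero ?_
    have : (p : ℤ) + 1 = 3 * m := by exact_mod_cast hm
    push_cast [Nat.cast_sub hp1.le]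
    linear_combination ((p : ℤ) - 1) * this
  rw [hj]
  set S := Polynomial.nthRootsFinset (p ^ 2 - 1) (1 : ℂ_[p]) with hS
  set Q := Polynomial.nthRootsFinset (p - 1) (1 : ℂ_[p]) with hQ
  have hmemS : ∀ t, t ∈ S ↔ t ^ (p ^ 2 - 1) = 1 := fun t => Polynomial.mem_nthRootsFinset hn 1
  have hmemQ : ∀ t, t ∈ Q ↔ t ^ (p - 1) = 1 := fun t => Polynomial.mem_nthRootsFinset hpm 1
  let χ : ℂ_[p] → ℂ_[p] := fun t => t ^ (-(((p - 1) * m : ℕ) : ℤ))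
  have hχ : ∀ t, χ t = ((t ^ (p - 1)) ^ m)⁻¹ := fun t => by
    simp only [χ]
    rw [zpow_neg, zpow_natCast, pow_mul]
  obtain ⟨ζ, hζ⟩ := exists_isPrimitiveRoot_of_not_dvd (p := p) hpd
  obtain ⟨ω, hω⟩ := exists_isPrimitiveRoot_of_not_dvd (p := p) hp2m
  have hcard : (Q.card : ℂ_[p]) = p - 1 := by
    rw [hQ, hζ.card_nthRootsFinset, Nat.cast_sub hp1.le, Nat.cast_one]
  have hQS : ∀ c ∈ Q, c ^ (p ^ 2 - 1) = 1 := fun c hc => by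
    rw [hsq, pow_mul, (hmemQ c).1 hc, one_pow]
  have hQ0 : ∀ c ∈ Q, c ≠ 0 := fun c hc h => by
    have := (hmemQ c).1 hc
    rw [h, zero_pow hpm.ne'] at this
    exact zero_ne_one this
  -- averaging over `μ_{p-1}`, on which the character is trivial
  have havg : ∀ c ∈ Q, ∑ t ∈ S, χ t * theta p π 2 (c * t) = ∑ t ∈ S, χ t * theta p π 2 t := by
    intro c hc
    refine Finset.sum_nbij' (fun t => c * t) (fun t => c⁻¹ * t) ?_ ?_ ?_ ?_ ?_
    · intro t ht
      rw [hmemS] at ht ⊢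
      rw [mul_pow, hQS c hc, ht, one_mul]
    · intro t ht
      rw [hmemS] at ht ⊢
      rw [mul_pow, inv_pow, hQS c hc, ht, inv_one, one_mul]
    · intro t _
      rw [inv_mul_cancel_left₀ (hQ0 c hc)]
    · intro t _
      rw [mul_inv_cancel_left₀ (hQ0 c hc)]
    · intro t _
      rw [hχ, hχ, mul_pow, (hmemQ c).1 hc, one_mul]
  have h1 : ((p : ℂ_[p]) - 1) * ∑ t ∈ S, χ t * theta p π 2 t =
      ∑ t ∈ S, χ t * ((if t ^ p = -t then (p : ℂ_[p]) else 0) - 1) := by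
    rw [← hcard, ← nsmul_eq_mul, ← Finset.sum_const, Finset.sum_congr rfl fun c hc => (havg c hc).symm,
      Finset.sum_comm]
    refine Finset.sum_congr rfl fun t ht => ?_
    rw [← Finset.mul_sum, sum_theta_two hp5 hπ ((hmemS t).1 ht)]
  have h2 : ∑ t ∈ S, χ t = 0 := by
    refine sum_nthRootsFinset_eq_zero hn hω.pow_eq_one ?_
    rw [zpow_neg, zpow_natCast]
    intro h
    have h3 := (hω.pow_eq_one_iff_dvd _).1 (inv_eq_one.1 h)
    rw [hsq, hm, show (p - 1) * (3 * m) = ((p - 1) * m) * 3 by ring] at h3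
    have hm0 : 0 < m := by omega
    have := Nat.le_of_dvd (by positivity) h3
    have : 0 < (p - 1) * m := by positivity
    omega
  -- the elements of trace zero form a coset of `μ_{p-1}`
  obtain ⟨t₀, ht₀⟩ : ∃ t₀ : ℂ_[p], t₀ ^ (p - 1) = -1 :=
    IsAlgClosed.exists_pow_nat_eq (-1) hpm
  have ht0 : t₀ ≠ 0 := fun h => by
    rw [h, zero_pow hpm.ne'] at ht₀
    simp at ht₀
  have h3 : ∑ t ∈ S, χ t * (if t ^ p = -t then (p : ℂ_[p]) else 0) = p * (p - 1) := by
    simp only [mul_ite, mul_zero]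
    rw [← Finset.sum_filter, ← hcard, mul_comm, ← nsmul_eq_mul, ← Finset.sum_const]
    have hiff : ∀ t : ℂ_[p], t ≠ 0 → (t ^ p = -t ↔ t ^ (p - 1) = -1) := fun t ht => by
      rw [← mul_pow_sub_one hp.out.ne_zero t, ← mul_neg_one t, mul_right_inj' ht]
    refine Finset.sum_nbij' (fun t => t₀⁻¹ * t) (fun c => t₀ * c) ?_ ?_ ?_ ?_ ?_
    · intro t ht
      rw [Finset.mem_filter, hmemS] at ht
      have hne : t ≠ 0 := fun h => by
        have := ht.1
        rw [h, zero_pow hn.ne'] at this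
        exact zero_ne_one this
      rw [hmemQ, mul_pow, inv_pow, ht₀, (hiff t hne).1 ht.2]
      norm_num
    · intro c hc
      rw [Finset.mem_filter, hmemS, hiff _ (mul_ne_zero ht0 (hQ0 c hc)), mul_pow, mul_pow,
        hQS c hc, (hmemQ c).1 hc, ht₀, mul_one, mul_one, hsq, pow_mul, ht₀]
      refine ⟨Even.neg_one_pow ?_, rfl⟩
      rw [hm]
      exact hm2.mul_left 3
    · intro t _
      exact mul_inv_cancel_left₀ ht0 t
    · intro c _
      exact inv_mul_cancel_left₀ ht0 c
    · intro t ht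
      rw [Finset.mem_filter, hmemS] at ht
      have hne : t ≠ 0 := fun h => by
        have := ht.1
        rw [h, zero_pow hn.ne'] at this
        exact zero_ne_one this
      rw [hχ, (hiff t hne).1 ht.2, hm2.neg_one_pow, inv_one, one_mul]
  have h4 : ((p : ℂ_[p]) - 1) * ∑ t ∈ S, χ t * theta p π 2 t = p * (p - 1) := by
    rw [h1]
    simp only [mul_sub, mul_one, Finset.sum_sub_distrib]
    rw [h2, h3]
    ring
  have h5 : (p : ℂ_[p]) - 1 ≠ 0 := by
    rw [sub_ne_zero]
    exact_mod_cast hp1.ne'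
  have h6 : ∑ t ∈ S, χ t * theta p π 2 t = p := mul_left_cancel₀ h5 (by rw [h4]; ring)
  rw [gaussSum, ← h6]

end GaussSum


/-! ### The Airy solutions near infinity -/

section AiryAtInfinity

variable {p : ℕ} [hp : Fact p.Prime] {π : ℂ_[p]}

theorem norm_ascPochhammer_eval_le_factorial {x : ℂ_[p]} {N : ℕ → ℕ}
    (h : Tendsto (fun k => -(N k : ℂ_[p])) atTop (𝓝 x)) (n : ℕ) :
    ‖(ascPochhammer ℂ_[p] n).eval x‖ ≤ ‖(n.factorial : ℂ_[p])‖ := by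
  refine le_of_tendsto (((Polynomial.continuous _).tendsto x).comp h).norm
    (Eventually.of_forall fun k => ?_)
  simp only [Function.comp_apply]
  rw [ascPochhammer_eval_neg_eq_descPochhammer, descPochhammer_eval_eq_descFactorial, norm_mul,
    norm_pow, norm_neg, norm_one, one_pow, one_mul, Nat.descFactorial_eq_factorial_mul_choose,
    Nat.cast_mul, norm_mul]
  exact mul_le_of_le_one_right (norm_nonneg _) (IsUltrametricDist.norm_natCast_le_one _ _)

/-- A `p`-integral rational number is a limit of negative integers, so the binomial coefficients at
it are integral. -/
theorem norm_ascPochhammer_eval_div_le (m : ℤ) {q : ℕ} (hq : ¬ p ∣ q) (n : ℕ) :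
    ‖(ascPochhammer ℂ_[p] n).eval ((m : ℂ_[p]) / q)‖ ≤ ‖(n.factorial : ℂ_[p])‖ := by
  have hp0 : (0 : ℝ) < (p : ℝ)⁻¹ := by have := hp.out.pos; positivity
  have hp1 : (p : ℝ)⁻¹ < 1 := inv_lt_one_of_one_lt₀ (by exact_mod_cast hp.out.one_lt)
  have hex : ∀ s : ℕ, ∃ N : ℕ, ∃ v : ℤ, (q : ℤ) * N + m = v * (p : ℤ) ^ s := by
    intro s
    have hc : IsCoprime (q : ℤ) ((p : ℤ) ^ s) := by
      refine IsCoprime.pow_right ?_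
      exact (Nat.isCoprime_iff_coprime.2 ((Nat.Prime.coprime_iff_not_dvd hp.out).2 hq)).symm
    obtain ⟨u, v, huv⟩ := hc
    have hps : (p : ℤ) ^ s ≠ 0 := pow_ne_zero _ (by exact_mod_cast hp.out.ne_zero)
    refine ⟨((-m * u) % (p : ℤ) ^ s).toNat, m * v - q * ((-m * u) / (p : ℤ) ^ s), ?_⟩
    rw [Int.toNat_of_nonneg (Int.emod_nonneg _ hps), Int.emod_def]
    linear_combination (-m) * huv
  choose N v hN using hex
  have hq1 := norm_natCast_of_not_dvd p hq
  have hq0 : (q : ℂ_[p]) ≠ 0 := fun h => by simp [h] at hq1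
  refine norm_ascPochhammer_eval_le_factorial (N := N) ?_ n
  rw [tendsto_iff_norm_sub_tendsto_zero]
  refine squeeze_zero (fun _ => norm_nonneg _) (fun s => ?_)
    (tendsto_pow_atTop_nhds_zero_of_lt_one hp0.le hp1)
  have h1 := congrArg (Int.cast : ℤ → ℂ_[p]) (hN s)
  push_cast at h1
  rw [show -(N s : ℂ_[p]) - (m : ℂ_[p]) / q = -((v s : ℂ_[p]) * (p : ℂ_[p]) ^ s) / q by
    rw [← h1]; field_simp; ring, norm_div, hq1, div_one, norm_neg, norm_mul, norm_pow,
    norm_p_complex]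
  exact mul_le_of_le_one_left (by positivity) (IsUltrametricDist.norm_intCast_le_one _ _)

/-- The coefficient of `t ^ (3 n)` in the asymptotic series `v`. -/
noncomputable def airyCoeff (κ π : ℂ_[p]) (n : ℕ) : ℂ_[p] :=
  (ascPochhammer ℂ_[p] n).eval (1 / 6) * (ascPochhammer ℂ_[p] n).eval (5 / 6) /
    ((2 * κ * π) ^ n * (n.factorial : ℂ_[p]))

theorem airyCoeff_succ {κ : ℂ_[p]} (hκ : κ ≠ 0) (hπ : π ≠ 0) (n : ℕ) :
    18 * κ * π * (n + 1) * airyCoeff κ π (n + 1) =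
      (9 * n ^ 2 + 9 * n + 5 / 4) * airyCoeff κ π n := by
  have h1 : (n.factorial : ℂ_[p]) ≠ 0 := Nat.cast_ne_zero.2 n.factorial_ne_zero
  have h2 : (n : ℂ_[p]) + 1 ≠ 0 := n.cast_add_one_ne_zero
  rw [airyCoeff, airyCoeff, ascPochhammer_succ_eval, ascPochhammer_succ_eval, Nat.factorial_succ,
    pow_succ]
  push_cast
  field_simp
  ring

theorem norm_airyCoeff_le (hp5 : 5 ≤ p) (hπ : π ^ (p - 1) = -(p : ℂ_[p])) {κ : ℂ_[p]}
    (hκ : ‖κ‖ = 1) (n : ℕ) : ‖airyCoeff κ π n‖ ≤ p * (n + 1) := by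
  have h0 : 0 < ‖(n.factorial : ℂ_[p])‖ :=
    norm_pos_iff.2 (Nat.cast_ne_zero.2 n.factorial_ne_zero)
  have hπ0 := norm_pi_pos hπ
  have h6 : ¬ p ∣ 6 := fun h => by
    rcases (hp.out.dvd_mul (m := 2) (n := 3)).1 h with h | h <;> have := Nat.le_of_dvd (by norm_num) h <;>
      omega
  have h1 := norm_ascPochhammer_eval_div_le 1 h6 n
  have h2 := norm_ascPochhammer_eval_div_le 5 h6 n
  push_cast at h1 h2
  rw [airyCoeff, norm_div, norm_mul, norm_mul, norm_pow, norm_mul, norm_mul, norm_two hp5, hκ,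
    mul_one, one_mul, div_le_iff₀ (by positivity)]
  calc _ ≤ ‖(n.factorial : ℂ_[p])‖ * ‖(n.factorial : ℂ_[p])‖ := by gcongr
    _ ≤ (p * (n + 1) * ‖π‖ ^ n) * ‖(n.factorial : ℂ_[p])‖ := by
        gcongr
        exact norm_factorial_le hπ n
    _ = _ := by ring

theorem hasPowerSeriesOn_airyV (hp5 : 5 ≤ p) (hπ : π ^ (p - 1) = -(p : ℂ_[p])) {κ : ℂ_[p]}
    (hκ : ‖κ‖ = 1) : HasPowerSeriesOn (airyV p κ π)
      (fun n => if 3 ∣ n then airyCoeff κ π (n / 3) else 0) 1 := by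
  have h1 : HasPowerSeriesOn (fun a => ∑' n, airyCoeff κ π n * a ^ n) (airyCoeff κ π) 1 := by
    refine HasPowerSeriesOn.of_bound fun ρ h0 h1 => ?_
    have hs : Tendsto (fun n : ℕ => p * (((n : ℝ) ^ 1 * ρ ^ n) + ρ ^ n)) atTop (𝓝 (p * (0 + 0))) :=
      ((tendsto_pow_const_mul_const_pow_of_abs_lt_one 1 (by rwa [abs_of_pos h0])).add
        (tendsto_pow_atTop_nhds_zero_of_lt_one h0.le h1)).const_mul _
    obtain ⟨C, hC⟩ := hs.bddAbove_range
    refine ⟨C, fun n => le_trans ?_ (hC ⟨n, rfl⟩)⟩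
    calc _ ≤ p * ((n : ℝ) + 1) * ρ ^ n := by gcongr; exact norm_airyCoeff_le hp5 hπ hκ n
      _ = _ := by ring
  have h2 := h1.comp_mul_pow (R := 1) 1 three_ne_zero (fun ρ h0 h1 => by
    rw [norm_one, one_mul]; exact pow_lt_one₀ h0 h1 three_ne_zero)
  simp only [one_mul, one_pow, mul_one] at h2
  have e : airyV p κ π = fun a => ∑' n, airyCoeff κ π n * (a ^ 3) ^ n := by
    funext t
    exact tsum_congr fun n => by rw [airyCoeff, pow_mul]
  rwa [e]

theorem HasPowerSeriesOn.hasSum_mul_deriv {f : ℂ_[p] → ℂ_[p]} {c : ℕ → ℂ_[p]} {R : ℝ}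
    (hf : HasPowerSeriesOn f c R) {t : ℂ_[p]} (ht : ‖t‖ < R) :
    HasSum (fun n : ℕ => n * c n * t ^ n) (t * _root_.deriv f t) := by
  rw [← hasSum_nat_add_iff' 1]
  simp only [Finset.sum_range_one, Nat.cast_zero, zero_mul, sub_zero]
  refine ((hf.deriv.2 t ht).mul_left t).congr_fun fun n => ?_
  rw [pow_succ]
  ring

/-- The differential equation of the asymptotic series. -/
theorem airyV_ode (hp5 : 5 ≤ p) (hπ : π ^ (p - 1) = -(p : ℂ_[p])) {κ : ℂ_[p]} (hκ : ‖κ‖ = 1)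
    {t : ℂ_[p]} (ht : ‖t‖ < 1) :
    t ^ 3 * (t ^ 2 * deriv (deriv (airyV p κ π)) t + 4 * (t * deriv (airyV p κ π) t) +
      5 / 4 * airyV p κ π t) = 6 * κ * π * (t * deriv (airyV p κ π) t) := by
  have hv := hasPowerSeriesOn_airyV hp5 hπ hκ
  have hκ0 : κ ≠ 0 := fun h => by simp [h] at hκ
  set b : ℕ → ℂ_[p] := fun n => if 3 ∣ n then airyCoeff κ π (n / 3) else 0 with hb
  have h1 := hv.hasSum_mul_deriv ht
  have h2 : HasSum (fun n : ℕ => n * (n - 1) * b n * t ^ n)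
      (t ^ 2 * deriv (deriv (airyV p κ π)) t) := by
    rw [← hasSum_nat_add_iff' 1]
    simp only [Finset.sum_range_one, Nat.cast_zero, zero_mul, sub_zero]
    have := (hv.deriv.hasSum_mul_deriv ht).mul_left t
    rw [← mul_assoc, ← pow_two] at this
    refine this.congr_fun fun n => ?_
    push_cast
    ring
  have h3 := ((h2.add (h1.mul_left 4)).add ((hv.2 t ht).mul_left (5 / 4))).mul_left (t ^ 3)
  have h4 := (hasSum_nat_add_iff' 3).2 (h1.mul_left (6 * κ * π))
  have hb1 : b 1 = 0 := by simp [hb]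
  have hb2 : b 2 = 0 := by simp [hb]
  rw [Finset.sum_range_succ, Finset.sum_range_succ, Finset.sum_range_one, hb1, hb2] at h4
  simp only [Nat.cast_zero, zero_mul, mul_zero, add_zero, sub_zero] at h4
  refine h3.unique (h4.congr_fun fun n => ?_)
  by_cases hn : 3 ∣ n
  · obtain ⟨m, rfl⟩ := hn
    have e1 : b (3 * m) = airyCoeff κ π m := by simp [hb]
    have e2 : b (3 * m + 3) = airyCoeff κ π (m + 1) := by
      rw [show 3 * m + 3 = 3 * (m + 1) by ring]
      simp [hb]
    rw [e1, e2]
    have := airyCoeff_succ hκ0 (pi_ne_zero hπ) m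
    push_cast
    linear_combination (-t ^ (3 * m + 3)) * this
  · have e1 : b n = 0 := by simp [hb, hn]
    have e2 : b (n + 3) = 0 := by
      have : ¬ 3 ∣ n + 3 := by omega
      simp [hb, this]
    rw [e1, e2]
    ring

theorem airyV_neg (κ π t : ℂ_[p]) : airyV p κ π (-t) = airyV p (-κ) π t := by
  refine tsum_congr fun n => ?_
  have hinv : ((-1 : ℂ_[p]) ^ n)⁻¹ = (-1) ^ n :=
    inv_eq_of_mul_eq_one_left (by rw [← mul_pow]; simp)
  rw [show 2 * -κ * π = -(2 * κ * π) by ring, neg_pow t, neg_pow (2 * κ * π), pow_mul (-1),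
    show (-1 : ℂ_[p]) ^ 3 = -1 by norm_num, div_eq_mul_inv _ (_ * _), div_eq_mul_inv _ (_ * _), mul_inv, mul_inv,
    mul_inv, hinv]
  ring

/-- The entry in the second row of `V` belonging to `v(1/a)`. -/
noncomputable def airySecond (κ π a : ℂ_[p]) : ℂ_[p] :=
  (2 * π)⁻¹ * ((-(1 / 2) * (a ^ 2)⁻¹ + 3 * κ * π * a) * airyW p κ π a + a⁻¹ * deriv (airyW p κ π) a)

theorem airyVMatrix_eq (κ π a : ℂ_[p]) : airyVMatrix p κ π a =
    !![airyW p κ π a, airyW p (-κ) π a; airySecond κ π a, airySecond (-κ) π a] := by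
  rw [airyVMatrix, airySecond, airySecond]
  congr 4
  ring_nf

theorem airyW_neg (κ π a : ℂ_[p]) : airyW p κ π (-a) = airyW p (-κ) π a := by
  rw [airyW, airyW, inv_neg, airyV_neg]

theorem airySecond_neg (κ π a : ℂ_[p]) : airySecond κ π (-a) = airySecond (-κ) π a := by
  have h : deriv (airyW p κ π) (-a) = -deriv (airyW p (-κ) π) a := by
    have : airyW p (-κ) π = fun a => airyW p κ π (-a) := by
      funext a
      rw [airyW_neg]
    rw [this, deriv_comp_neg, neg_neg]
  rw [airySecond, airySecond, airyW_neg, h]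
  rw [neg_sq, inv_neg]
  ring

theorem hasDerivAt_airyW (hp5 : 5 ≤ p) (hπ : π ^ (p - 1) = -(p : ℂ_[p])) {κ : ℂ_[p]}
    (hκ : ‖κ‖ = 1) {a : ℂ_[p]} (ha : 1 < ‖a‖) :
    HasDerivAt (airyW p κ π) (-(a ^ 2)⁻¹ * deriv (airyV p κ π) a⁻¹) a := by
  have ha0 : a ≠ 0 := fun h => by simp [h] at ha; linarith
  have h1 := ((hasPowerSeriesOn_airyV hp5 hπ hκ).differentiableAt (a := a⁻¹) (by
    rw [norm_inv]; exact inv_lt_one_of_one_lt₀ ha)).hasDerivAt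
  exact (h1.comp a (hasDerivAt_inv ha0)).congr_deriv (by ring)

theorem hasDerivAt_deriv_airyW (hp5 : 5 ≤ p) (hπ : π ^ (p - 1) = -(p : ℂ_[p])) {κ : ℂ_[p]}
    (hκ : ‖κ‖ = 1) {a : ℂ_[p]} (ha : 1 < ‖a‖) :
    HasDerivAt (deriv (airyW p κ π)) (-(6 * κ * π * a ^ 2 - 2 / a) * deriv (airyW p κ π) a -
      5 / 4 * (a ^ 2)⁻¹ * airyW p κ π a) a := by
  have ha0 : a ≠ 0 := fun h => by simp [h] at ha; linarith
  have ht : ‖a⁻¹‖ < 1 := by rw [norm_inv]; exact inv_lt_one_of_one_lt₀ ha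
  have h1 := ((hasPowerSeriesOn_airyV hp5 hπ hκ).deriv.differentiableAt ht).hasDerivAt
  have h2 := h1.comp a (hasDerivAt_inv ha0)
  have h3 := ((hasDerivAt_inv (pow_ne_zero 2 ha0)).comp a (hasDerivAt_pow 2 a)).neg.mul h2
  have hev : deriv (airyW p κ π) =ᶠ[𝓝 a] fun a => -(a ^ 2)⁻¹ * deriv (airyV p κ π) a⁻¹ := by
    filter_upwards [continuous_norm.continuousAt.eventually (lt_mem_nhds ha)] with x hx
    exact (hasDerivAt_airyW hp5 hπ hκ hx).deriv
  refine (h3.congr_of_eventuallyEq hev).congr_deriv ?_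
  have e := airyV_ode hp5 hπ hκ ht
  rw [hev.eq_of_nhds, airyW]
  simp only [Function.comp_apply, Pi.neg_apply]
  field_simp at e ⊢
  linear_combination e

theorem hasDerivAt_airySecond (hp5 : 5 ≤ p) (hπ : π ^ (p - 1) = -(p : ℂ_[p])) {κ : ℂ_[p]}
    (hκ : ‖κ‖ = 1) (hκ2 : κ ^ 2 = -4 / 27) {a : ℂ_[p]} (ha : 1 < ‖a‖) :
    HasDerivAt (airySecond κ π) (-(2 * π * a ^ 3 / 3) * airyW p κ π a +
      (1 / (2 * a) - 3 * κ * π * a ^ 2) * airySecond κ π a) a := by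
  have ha0 : a ≠ 0 := fun h => by simp [h] at ha; linarith
  have hπ0 := pi_ne_zero hπ
  have h1 := hasDerivAt_deriv_airyW hp5 hπ hκ ha
  have h2 := (hasDerivAt_airyW hp5 hπ hκ ha).differentiableAt.hasDerivAt
  have h3 := ((((hasDerivAt_inv (pow_ne_zero 2 ha0)).comp a (hasDerivAt_pow 2 a)).const_mul
    (-(1 / 2))).add ((hasDerivAt_id a).const_mul (3 * κ * π)))
  have h4 := ((h3.mul h2).add ((hasDerivAt_inv ha0).mul h1)).const_mul (2 * π)⁻¹
  refine h4.congr_deriv ?_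
  rw [airySecond]
  simp only [Function.comp_apply, Pi.add_apply, id_eq]
  field_simp
  linear_combination (432 * π ^ 2 * a ^ 7 * airyW p κ π a) * hκ2

theorem hasDerivAt_airyW' (hp5 : 5 ≤ p) (hπ : π ^ (p - 1) = -(p : ℂ_[p])) {κ : ℂ_[p]}
    (hκ : ‖κ‖ = 1) {a : ℂ_[p]} (ha : 1 < ‖a‖) :
    HasDerivAt (airyW p κ π) (2 * π * a * airySecond κ π a +
      (1 / (2 * a) - 3 * κ * π * a ^ 2) * airyW p κ π a) a := by
  have ha0 : a ≠ 0 := fun h => by simp [h] at ha; linarith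
  have hπ0 := pi_ne_zero hπ
  refine (hasDerivAt_airyW hp5 hπ hκ ha).differentiableAt.hasDerivAt.congr_deriv ?_
  rw [airySecond]
  field_simp
  ring

theorem hasPowerSeriesOn_const_mul_pow (k : ℂ_[p]) (m : ℕ) (R : ℝ) :
    HasPowerSeriesOn (fun a => k * a ^ m) (Pi.single m k) R := by
  refine ⟨fun ρ h1 _ => ⟨‖k‖ * ρ ^ m, fun n => ?_⟩, fun a _ => ?_⟩
  · rcases eq_or_ne n m with rfl | hn
    · simp
    · simp [hn]; positivity
  · refine (hasSum_ite_eq m (k * a ^ m)).congr_fun fun n => ?_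
    rcases eq_or_ne n m with rfl | hn
    · simp
    · simp [hn]

/-- The Wronskian relation `det V = -3 κ a`. -/
theorem airy_wronskian (hp5 : 5 ≤ p) (hπ : π ^ (p - 1) = -(p : ℂ_[p])) {κ : ℂ_[p]}
    (hκ : ‖κ‖ = 1) {a : ℂ_[p]} (ha : 1 < ‖a‖) :
    airyW p κ π a * airySecond (-κ) π a - airyW p (-κ) π a * airySecond κ π a = -3 * κ * a := by
  have ha0 : a ≠ 0 := fun h => by simp [h] at ha; linarith
  have hπ0 := pi_ne_zero hπ
  have hκ' : ‖-κ‖ = 1 := by rwa [norm_neg]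
  have v1 := hasPowerSeriesOn_airyV hp5 hπ hκ
  have v2 := hasPowerSeriesOn_airyV hp5 hπ hκ'
  -- with `t = a⁻¹`, the claim is that `-3 κ v v̄ - t ^ 4 (v v̄' - v̄ v') / (2 π)` is constant
  have hf := ((hasPowerSeriesOn_const_mul_pow (-3 * κ) 0 1).mul (v1.mul v2)).sub
    ((hasPowerSeriesOn_const_mul_pow ((2 * π)⁻¹) 4 1).mul ((v1.mul v2.deriv).sub (v2.mul v1.deriv)))
  have key : ∀ t : ℂ_[p], ‖t‖ < 1 → _ := fun t ht => eq_of_deriv_eq_zero hf (fun t ht0 ht => by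
    have e1 := airyV_ode hp5 hπ hκ ht
    have e2 := airyV_ode hp5 hπ hκ' ht
    have d1 := (v1.differentiableAt ht).hasDerivAt
    have d2 := (v2.differentiableAt ht).hasDerivAt
    have d11 := (v1.deriv.differentiableAt ht).hasDerivAt
    have d22 := (v2.deriv.differentiableAt ht).hasDerivAt
    refine HasDerivAt.deriv ((((((hasDerivAt_pow 0 t).const_mul (-3 * κ)).mul (d1.mul d2)).sub
      (((hasDerivAt_pow 4 t).const_mul ((2 * π)⁻¹)).mul ((d1.mul d22).sub (d2.mul d11))))).congr_deriv ?_)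
    simp only [Pi.mul_apply, Pi.sub_apply, Nat.cast_zero, zero_mul, mul_zero, zero_add, pow_zero,
      mul_one, Nat.cast_ofNat, Nat.add_one_sub_one]
    have e3 := mul_left_cancel₀ ht0 (b := airyV p (-κ) π t * (t ^ 2 * (t ^ 2 *
      deriv (deriv (airyV p κ π)) t + 4 * (t * deriv (airyV p κ π) t) + 5 / 4 * airyV p κ π t)) -
      airyV p κ π t * (t ^ 2 * (t ^ 2 * deriv (deriv (airyV p (-κ) π)) t +
      4 * (t * deriv (airyV p (-κ) π) t) + 5 / 4 * airyV p (-κ) π t)))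
      (c := 6 * κ * π * (deriv (airyV p κ π) t * airyV p (-κ) π t +
        airyV p κ π t * deriv (airyV p (-κ) π) t))
      (by linear_combination (-airyV p κ π t) * e2 + airyV p (-κ) π t * e1)
    field_simp
    linear_combination e3) ht
  have ht : ‖a⁻¹‖ < 1 := by rw [norm_inv]; exact inv_lt_one_of_one_lt₀ ha
  have h1 := key a⁻¹ ht
  have z1 : airyV p κ π 0 = 1 := by
    rw [v1.apply_zero one_pos]; simp [airyCoeff]
  have z2 : airyV p (-κ) π 0 = 1 := by
    rw [v2.apply_zero one_pos]; simp [airyCoeff]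
  simp only [pow_zero, mul_one, z1, z2, ne_eq, OfNat.ofNat_ne_zero, not_false_eq_true, zero_pow,
    mul_zero, zero_mul, sub_zero] at h1
  rw [airySecond, airySecond, (hasDerivAt_airyW hp5 hπ hκ ha).deriv,
    (hasDerivAt_airyW hp5 hπ hκ' ha).deriv, airyW, airyW]
  field_simp at h1 ⊢
  linear_combination 2 * h1

theorem isLaurentOn_airyW (hp5 : 5 ≤ p) (hπ : π ^ (p - 1) = -(p : ℂ_[p])) {κ : ℂ_[p]}
    (hκ : ‖κ‖ = 1) {k : ℕ} (hk : k ≠ 0) (R : ℝ) : IsLaurentOn (fun a => airyW p κ π (a ^ k)) R := by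
  refine ((hasPowerSeriesOn_airyV hp5 hπ hκ).isLaurentOn_comp 1 (m := -(k : ℤ)) (by simpa)
    (fun ρ h1 _ => ?_)).congr fun a _ _ => ?_
  · rw [norm_one, one_mul, zpow_neg, zpow_natCast]
    exact inv_lt_one_of_one_lt₀ (one_lt_pow₀ h1 hk)
  · rw [one_mul, zpow_neg, zpow_natCast, airyW]

theorem isLaurentOn_airySecond (hp5 : 5 ≤ p) (hπ : π ^ (p - 1) = -(p : ℂ_[p])) {κ : ℂ_[p]}
    (hκ : ‖κ‖ = 1) {k : ℕ} (hk : k ≠ 0) (R : ℝ) :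
    IsLaurentOn (fun a => airySecond κ π (a ^ k)) R := by
  have h := isLaurentOn_airyW hp5 hπ hκ hk R
  have hd : IsLaurentOn (fun a => deriv (airyV p κ π) (1 * a ^ (-(k : ℤ)))) R :=
    (hasPowerSeriesOn_airyV hp5 hπ hκ).deriv.isLaurentOn_comp 1 (m := -(k : ℤ)) (by simpa)
      (fun ρ h1 _ => by
        rw [norm_one, one_mul, zpow_neg, zpow_natCast]
        exact inv_lt_one_of_one_lt₀ (one_lt_pow₀ h1 hk))
  refine ((((h.zpow_mul (-((2 * k : ℕ) : ℤ)) (-(1 / 2))).add (h.zpow_mul (k : ℤ) (3 * κ * π))).add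
    (hd.zpow_mul (-((3 * k : ℕ) : ℤ)) (-1))).const_mul (2 * π)⁻¹).congr fun a ha _ => ?_
  have ha0 : a ≠ 0 := fun h => by simp [h] at ha; linarith
  have hak : 1 < ‖a ^ k‖ := by rw [norm_pow]; exact one_lt_pow₀ ha hk
  rw [airySecond, (hasDerivAt_airyW hp5 hπ hκ hak).deriv, zpow_neg, zpow_neg, zpow_neg, zpow_natCast,
    zpow_natCast, zpow_natCast, one_mul, pow_mul', pow_mul']
  field_simp

end AiryAtInfinity


/-! ### The exponential factor -/

section Residues

variable {p : ℕ} [hp : Fact p.Prime]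

/-- The quadratic character of `-3`. -/
theorem neg_three_pow_eq (hp5 : 5 ≤ p) :
    (-3 : ZMod p) ^ (p / 2) = if p % 3 = 1 then 1 else -1 := by
  have h2 : (2 : ZMod p) ≠ 0 := fun h => by
    have h' : ((2 : ℕ) : ZMod p) = 0 := by exact_mod_cast h
    have := Nat.le_of_dvd two_pos ((ZMod.natCast_eq_zero_iff _ _).1 h')
    omega
  have h3 : (3 : ZMod p) ≠ 0 := fun h => by
    have h' : ((3 : ℕ) : ZMod p) = 0 := by exact_mod_cast h
    have := Nat.le_of_dvd three_pos ((ZMod.natCast_eq_zero_iff _ _).1 h')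
    omega
  have hne : (-3 : ZMod p) ≠ 0 := neg_ne_zero.2 h3
  -- `-3` is a square exactly when there is a primitive cube root of unity
  have hsq : IsSquare (-3 : ZMod p) ↔ p % 3 = 1 := by
    constructor
    · rintro ⟨s, hs⟩
      have hω3 : ((s - 1) / 2) ^ 3 = 1 := by
        field_simp
        linear_combination (3 - s) * hs
      have hω1 : (s - 1) / 2 ≠ 1 := fun h => by
        rw [div_eq_iff h2] at h
        have e : s = 3 := by linear_combination h
        rw [e] at hs
        have h12 : (2 : ZMod p) * 2 * 3 = 0 := by linear_combination -hs
        simp [h2, h3] at h12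
      have hω0 : (s - 1) / 2 ≠ 0 := fun h => by
        rw [h] at hω3
        simp at hω3
      have ho := orderOf_eq_prime (p := 3) hω3 hω1
      have hd := orderOf_dvd_of_pow_eq_one (ZMod.pow_card_sub_one_eq_one hω0)
      rw [ho] at hd
      omega
    · intro h
      have hcard : Fintype.card (ZMod p)ˣ = p - 1 := ZMod.card_units p
      obtain ⟨u, hu⟩ := exists_prime_orderOf_dvd_card (G := (ZMod p)ˣ) 3 (by rw [hcard]; omega)
      have hu3 : (u : ZMod p) ^ 3 = 1 := by
        have := pow_orderOf_eq_one u
        rw [hu] at this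
        rw [← Units.val_pow_eq_pow_val, this, Units.val_one]
      have hu1 : (u : ZMod p) - 1 ≠ 0 := fun h => by
        have : u = 1 := Units.ext (sub_eq_zero.1 h)
        rw [this, orderOf_one] at hu
        omega
      have hq : (u : ZMod p) ^ 2 + u + 1 = 0 := mul_left_cancel₀ hu1 (by linear_combination hu3)
      exact ⟨2 * u + 1, by linear_combination -4 * hq⟩
  split_ifs with h
  · exact (ZMod.euler_criterion p hne).1 (hsq.2 h)
  · exact (ZMod.pow_div_two_eq_neg_one_or_one p hne).resolve_left fun h1 =>
      h (hsq.1 ((ZMod.euler_criterion p hne).2 h1))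

theorem norm_kappa (hp5 : 5 ≤ p) {κ : ℂ_[p]} (hκ2 : κ ^ 2 = -4 / 27) : ‖κ‖ = 1 := by
  have h := congrArg norm hκ2
  rw [norm_pow, norm_div, norm_neg, show (4 : ℂ_[p]) = 2 ^ 2 by norm_num,
    show (27 : ℂ_[p]) = 3 ^ 3 by norm_num, norm_pow, norm_pow, norm_two hp5, norm_three hp5] at h
  norm_num at h
  exact h.resolve_right fun h => by linarith [norm_nonneg κ]

/-- Modulo `p`, the Frobenius fixes `κ` or changes its sign, according as `-3` is a square in `𝔽_p`
or not, that is, according as `p ≡ 1` or `p ≡ 2 mod 3`. -/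
theorem norm_kappa_pow_sub_le (hp5 : 5 ≤ p) {κ : ℂ_[p]} (hκ2 : κ ^ 2 = -4 / 27) :
    ‖κ ^ p - (if p % 3 = 1 then 1 else -1) * κ‖ ≤ (p : ℝ)⁻¹ := by
  set ε : ℤ := if p % 3 = 1 then 1 else -1 with hε
  have hodd := Nat.odd_iff.1 (hp.out.odd_of_ne_two (by omega))
  have hne : ∀ n : ℕ, 0 < n → n < 5 → ((n : ℕ) : ZMod p) ≠ 0 := fun n h0 h5 h => by
    have := Nat.le_of_dvd h0 ((ZMod.natCast_eq_zero_iff _ _).1 h)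
    omega
  have h2 : (2 : ZMod p) ≠ 0 := by exact_mod_cast hne 2 (by norm_num) (by norm_num)
  have h3 : (3 : ZMod p) ≠ 0 := by exact_mod_cast hne 3 (by norm_num) (by norm_num)
  have hsquare : ∀ x : ZMod p, x ≠ 0 → (x ^ 2) ^ (p / 2) = 1 := fun x hx => by
    rw [← pow_mul, show 2 * (p / 2) = p - 1 by omega, ZMod.pow_card_sub_one_eq_one hx]
  have hmod : ((-4 : ZMod p)) ^ (p / 2) - ε * 27 ^ (p / 2) = 0 := by
    have e1 := neg_three_pow_eq hp5
    have e2 := hsquare (2 * 3) (mul_ne_zero h2 h3)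
    have e3 := hsquare (3 ^ 3) (pow_ne_zero _ h3)
    have e4 : (-4 : ZMod p) ^ (p / 2) * 27 ^ (p / 2) = ε := by
      rw [← mul_pow, show (-4 : ZMod p) * 27 = (-3) * (2 * 3) ^ 2 by ring, mul_pow, e1, e2, mul_one,
        hε]
      split_ifs <;> simp
    have e5 : (27 : ZMod p) ^ (p / 2) * 27 ^ (p / 2) = 1 := by
      rw [← e3, ← mul_pow]
      norm_num
    linear_combination (27 : ZMod p) ^ (p / 2) * e4 - (-4 : ZMod p) ^ (p / 2) * e5
  have hint : (p : ℤ) ∣ (-4) ^ (p / 2) - ε * 27 ^ (p / 2) := by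
    rw [← ZMod.intCast_zmod_eq_zero_iff_dvd]
    push_cast
    exact hmod
  obtain ⟨k, hk⟩ := hint
  have h27 : (27 : ℂ_[p]) ≠ 0 := by norm_num
  have hkc := congrArg (Int.cast : ℤ → ℂ_[p]) hk
  push_cast at hkc
  have hεc : (if p % 3 = 1 then (1 : ℂ_[p]) else -1) = ε := by
    rw [hε]
    split_ifs <;> simp
  have hpow : κ ^ p = (κ ^ 2) ^ (p / 2) * κ := by
    rw [← pow_mul, ← pow_succ]
    congr 1
    omega
  have e : κ ^ p - ε * κ = (p : ℂ_[p]) * (k * κ / 27 ^ (p / 2)) := by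
    rw [hpow, hκ2, div_pow]
    field_simp
    linear_combination κ * hkc
  rw [hεc, e, norm_mul, norm_p_complex]
  refine mul_le_of_le_one_right (by positivity) ?_
  rw [norm_div, norm_mul, norm_kappa hp5 hκ2, norm_pow, show (27 : ℂ_[p]) = 3 ^ 3 by norm_num,
    norm_pow, norm_three hp5, one_pow, one_pow, mul_one, div_one]
  exact IsUltrametricDist.norm_intCast_le_one _ k

end Residues

section ExponentialFactor

variable {p : ℕ} [hp : Fact p.Prime] {π : ℂ_[p]} {b : ℝ}

/-- The function `θ(κ₁ a ^ 3) exp (π (κ₁ ^ p + κ₂) a ^ (3 p))`, whose logarithm is formally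
`π (κ₁ a ^ 3 + κ₂ a ^ (3 p))`. -/
noncomputable def airyE (π κ₁ κ₂ a : ℂ_[p]) : ℂ_[p] :=
  theta p π 1 (κ₁ * a ^ 3) * NormedSpace.exp (π * (κ₁ ^ p + κ₂) * a ^ (3 * p))

theorem norm_exp_arg_lt (hπ : π ^ (p - 1) = -(p : ℂ_[p])) (hb₂ : b < ((p : ℝ) - 1) / p)
    {c : ℂ_[p]} (hc : ‖c‖ ≤ (p : ℝ)⁻¹) {ρ : ℝ} (h0 : 0 ≤ ρ) (h1 : ρ < (p : ℝ) ^ (b / p / 3)) :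
    ‖π * c‖ * ρ ^ (3 * p) < ‖π‖ := by
  have hp0 : (0 : ℝ) < p := by exact_mod_cast hp.out.pos
  have hπ0 := norm_pi_pos hπ
  rw [norm_mul]
  calc _ ≤ ‖π‖ * (p : ℝ)⁻¹ * ρ ^ (3 * p) := by gcongr
    _ < ‖π‖ * (p : ℝ)⁻¹ * p := by gcongr; exact pow_three_mul_lt hb₂ h0 h1
    _ = ‖π‖ := by field_simp

/-- The logarithmic derivative of `airyE` is that of `exp (π (κ₁ a ^ 3 + κ₂ a ^ (3 p)))`, although
this exponential need not converge on the annulus. -/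
theorem hasDerivAt_airyE (hπ : π ^ (p - 1) = -(p : ℂ_[p])) (hb₂ : b < ((p : ℝ) - 1) / p)
    {κ₁ κ₂ : ℂ_[p]} (h1 : ‖κ₁‖ = 1) (h2 : ‖κ₁ ^ p + κ₂‖ ≤ (p : ℝ)⁻¹) {a : ℂ_[p]}
    (ha : ‖a‖ < (p : ℝ) ^ (b / p / 3)) :
    HasDerivAt (airyE π κ₁ κ₂) ((3 * κ₁ * π * a ^ 2 + 3 * p * κ₂ * π * (a ^ (p - 1) * (a ^ p) ^ 2)) *
      airyE π κ₁ κ₂ a) a := by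
  have e1 : ‖κ₁ * a ^ 3‖ < (splitRate p)⁻¹ := by
    rw [norm_mul, h1, one_mul, norm_pow]
    exact pow_three_lt_inv_splitRate hb₂ (norm_nonneg _) ha
  have e2 : ‖π * (κ₁ ^ p + κ₂) * a ^ (3 * p)‖ < ‖π‖ := by
    rw [norm_mul, norm_pow]
    exact norm_exp_arg_lt hπ hb₂ h2 (norm_nonneg _) ha
  have d1 := (hasDerivAt_theta hπ e1).comp a ((hasDerivAt_pow 3 a).const_mul κ₁)
  have d2 := (hasDerivAt_exp_of_norm_lt hπ e2).comp a
    ((hasDerivAt_pow (3 * p) a).const_mul (π * (κ₁ ^ p + κ₂)))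
  refine (d1.mul d2).congr_deriv ?_
  have hp1 := hp.out.one_lt
  have e3 : a ^ p = a ^ (p - 1) * a := (pow_sub_one_mul hp.out.ne_zero a).symm
  have e4 : a ^ (3 * p - 1) = a ^ (p - 1) * (a ^ p) ^ 2 := by
    rw [← pow_mul, ← pow_add]
    congr 1
    omega
  have e5 : κ₁ ^ p = κ₁ ^ (p - 1) * κ₁ := (pow_sub_one_mul hp.out.ne_zero κ₁).symm
  simp only [Function.comp_apply, airyE]
  rw [e4, mul_pow κ₁ (a ^ 3), ← pow_mul a 3, pow_mul' a 3 (p - 1), e5, e3]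
  push_cast
  ring

theorem isLaurentOn_airyE (hπ : π ^ (p - 1) = -(p : ℂ_[p])) (hb₂ : b < ((p : ℝ) - 1) / p)
    {κ₁ κ₂ : ℂ_[p]} (h1 : ‖κ₁‖ = 1) (h2 : ‖κ₁ ^ p + κ₂‖ ≤ (p : ℝ)⁻¹) :
    IsLaurentOn (airyE π κ₁ κ₂) ((p : ℝ) ^ (b / p / 3)) := by
  have l1 := (hasPowerSeriesOn_theta hπ).isLaurentOn_comp (R := (p : ℝ) ^ (b / p / 3)) κ₁
    (m := 3) (by norm_num) (fun ρ h3 h4 => by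
      rw [h1, one_mul]
      exact_mod_cast pow_three_lt_inv_splitRate hb₂ (by linarith) h4)
  have l2 := (hasPowerSeriesOn_exp hπ).isLaurentOn_comp (R := (p : ℝ) ^ (b / p / 3))
    (π * (κ₁ ^ p + κ₂)) (m := ((3 * p : ℕ) : ℤ))
    (by exact_mod_cast mul_ne_zero three_ne_zero hp.out.ne_zero) (fun ρ h3 h4 => by
      rw [zpow_natCast]
      exact norm_exp_arg_lt hπ hb₂ h2 (by linarith) h4)
  refine (l1.mul l2).congr fun a _ _ => ?_
  rw [airyE, zpow_natCast]
  norm_cast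

theorem airyE_mul_airyE_neg (hp5 : 5 ≤ p) (hπ : π ^ (p - 1) = -(p : ℂ_[p]))
    (hb₂ : b < ((p : ℝ) - 1) / p)
    {κ₁ κ₂ : ℂ_[p]} (h1 : ‖κ₁‖ = 1) (h2 : ‖κ₁ ^ p + κ₂‖ ≤ (p : ℝ)⁻¹) {a : ℂ_[p]}
    (ha : ‖a‖ < (p : ℝ) ^ (b / p / 3)) : airyE π κ₁ κ₂ a * airyE π (-κ₁) (-κ₂) a = 1 := by
  have hodd := hp.out.odd_of_ne_two (by omega)
  have e1 : ‖κ₁ * a ^ 3‖ < (splitRate p)⁻¹ := by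
    rw [norm_mul, h1, one_mul, norm_pow]
    exact pow_three_lt_inv_splitRate hb₂ (norm_nonneg _) ha
  have e2 : ‖π * (κ₁ ^ p + κ₂) * a ^ (3 * p)‖ < ‖π‖ := by
    rw [norm_mul, norm_pow]
    exact norm_exp_arg_lt hπ hb₂ h2 (norm_nonneg _) ha
  have e3 := theta_mul_theta_neg hπ (by omega) e1
  have e4 := exp_mul_exp_neg hπ e2
  rw [airyE, airyE, hodd.neg_pow, neg_mul κ₁, show π * (-κ₁ ^ p + -κ₂) * a ^ (3 * p) =
    -(π * (κ₁ ^ p + κ₂) * a ^ (3 * p)) by ring, mul_mul_mul_comm, e3, e4, one_mul]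

theorem airyE_neg_arg (hp5 : 5 ≤ p) (π κ₁ κ₂ a : ℂ_[p]) :
    airyE π κ₁ κ₂ (-a) = airyE π (-κ₁) (-κ₂) a := by
  have hodd := hp.out.odd_of_ne_two (by omega)
  have h3 : Odd (3 * p) := (by decide : Odd 3).mul hodd
  rw [airyE, airyE, hodd.neg_pow, h3.neg_pow, (by decide : Odd 3).neg_pow]
  congr 2 <;> ring

end ExponentialFactor


/-! ### The Frobenius matrix in the basis at infinity -/

section Pairing

variable {p : ℕ} [hp : Fact p.Prime] {π : ℂ_[p]} {b : ℝ}

/-- The Frobenius structure in the ramified variable: `𝔅(a) = 𝔄_{a ^ 2}` satisfies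
`𝔅' = 𝔾(a) 𝔅 - p a ^ (p - 1) 𝔅 𝔾(a ^ p)`. -/
theorem hasDerivAt_frobMatrix_sq (hp5 : 5 ≤ p) (hπ : π ^ (p - 1) = -(p : ℂ_[p]))
    (hb₁ : 1 / ((p : ℝ) - 1) < b) (hb₂ : b < ((p : ℝ) - 1) / p) {a : ℂ_[p]}
    (ha : ‖a‖ < (p : ℝ) ^ (b / p / 3)) (i j : Fin 2) :
    HasDerivAt (fun a => frobMatrix p π (a ^ 2) i j) ((airySystem p π a * frobMatrix p π (a ^ 2) -
      ((p : ℂ_[p]) * a ^ (p - 1)) • (frobMatrix p π (a ^ 2) * airySystem p π (a ^ p))) i j) a := by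
  have h := hasDerivAt_frobMatrix (a := a ^ 2) hp5 hπ (norm_pi_inv_le hπ hb₁)
    (fun ρ h0 h1 => exists_frobRates (pos_of_one_div_lt p hb₁) hb₂ h0 h1)
    (by rw [norm_pow]; exact sq_lt_of_lt (norm_nonneg _) ha) i j
  refine (h.comp a (hasDerivAt_pow 2 a)).congr_deriv ?_
  have e1 : a ^ p = a ^ (p - 1) * a := (pow_sub_one_mul hp.out.ne_zero a).symm
  have e2 : (a ^ 2) ^ (p - 1) = (a ^ (p - 1)) ^ 2 := by rw [← pow_mul, ← pow_mul, mul_comm]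
  have e3 : (a ^ 2) ^ p = (a ^ p) ^ 2 := by rw [← pow_mul, ← pow_mul, mul_comm]
  rw [e2, e3, e1]
  generalize a ^ (p - 1) = x
  fin_cases i <;> fin_cases j <;> simp only [airyBase, airySystem, Matrix.of_apply, Matrix.sub_apply,
    Matrix.smul_apply, Matrix.mul_apply, Fin.sum_univ_two, Fin.zero_eta, Fin.mk_one,
    Matrix.cons_val_zero, Matrix.cons_val_one, Matrix.cons_val', Matrix.cons_val_fin_one,
    smul_eq_mul] <;> push_cast <;> ring

/-- Up to a constant and a power of `a`, the entries of `V(a)⁻¹ 𝔄_{a ^ 2} V(a ^ p)`; the signs of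
`κ₁` and `κ₂` select the row and the column. -/
noncomputable def frobPairing (π κ₁ κ₂ a : ℂ_[p]) : ℂ_[p] :=
  airySecond κ₁ π a * (frobMatrix p π (a ^ 2) 0 0 * airyW p κ₂ π (a ^ p) +
    frobMatrix p π (a ^ 2) 0 1 * airySecond κ₂ π (a ^ p)) -
  airyW p κ₁ π a * (frobMatrix p π (a ^ 2) 1 0 * airyW p κ₂ π (a ^ p) +
    frobMatrix p π (a ^ 2) 1 1 * airySecond κ₂ π (a ^ p))

/-- The pairing, normalized by the power of `a` that removes the contribution of the factor
`a ^ (-1/2)` of the fundamental matrix. -/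
noncomputable def normPairing (π κ₁ κ₂ a : ℂ_[p]) : ℂ_[p] :=
  a ^ (-(((p + 1) / 2 : ℕ) : ℤ)) * frobPairing π κ₁ κ₂ a

/-- Differentiating the pairing by the equations of `𝔄` and of the two columns of `V`, everything
cancels except the contributions of the exponential factors. -/
theorem hasDerivAt_normPairing (hp5 : 5 ≤ p) (hπ : π ^ (p - 1) = -(p : ℂ_[p]))
    (hb₁ : 1 / ((p : ℝ) - 1) < b) (hb₂ : b < ((p : ℝ) - 1) / p) {κ₁ κ₂ : ℂ_[p]}
    (h1 : κ₁ ^ 2 = -4 / 27) (h2 : κ₂ ^ 2 = -4 / 27) {a : ℂ_[p]} (ha1 : 1 < ‖a‖)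
    (ha : ‖a‖ < (p : ℝ) ^ (b / p / 3)) :
    HasDerivAt (normPairing π κ₁ κ₂) (-(3 * κ₁ * π * a ^ 2 + 3 * p * κ₂ * π *
      (a ^ (p - 1) * (a ^ p) ^ 2)) * normPairing π κ₁ κ₂ a) a := by
  have ha0 : a ≠ 0 := fun h => by simp [h] at ha1; linarith
  have hap : 1 < ‖a ^ p‖ := by rw [norm_pow]; exact one_lt_pow₀ ha1 hp.out.ne_zero
  have n1 := norm_kappa hp5 h1
  have n2 := norm_kappa hp5 h2
  have dA := fun i j => hasDerivAt_frobMatrix_sq hp5 hπ hb₁ hb₂ ha i j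
  have dW := hasDerivAt_airyW' hp5 hπ n1 ha1
  have dS := hasDerivAt_airySecond hp5 hπ n1 h1 ha1
  have dpow : HasDerivAt (fun x : ℂ_[p] => x ^ p) (p * a ^ (p - 1)) a := hasDerivAt_pow p a
  have dWp := HasDerivAt.comp (h := fun x : ℂ_[p] => x ^ p) a
    (hasDerivAt_airyW' hp5 hπ n2 hap) dpow
  have dSp := HasDerivAt.comp (h := fun x : ℂ_[p] => x ^ p) a
    (hasDerivAt_airySecond hp5 hπ n2 h2 hap) dpow
  have dz := hasDerivAt_zpow (-(((p + 1) / 2 : ℕ) : ℤ)) a (Or.inl ha0)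
  have d := dz.mul ((dS.mul (((dA 0 0).mul dWp).add ((dA 0 1).mul dSp))).sub
    (dW.mul (((dA 1 0).mul dWp).add ((dA 1 1).mul dSp))))
  refine d.congr_deriv ?_
  have hodd := Nat.odd_iff.1 (hp.out.odd_of_ne_two (by omega))
  have e1 : ((((p + 1) / 2 : ℕ) : ℤ) : ℂ_[p]) = ((p : ℂ_[p]) + 1) / 2 := by
    have : 2 * ((p + 1) / 2) = p + 1 := by omega
    have h3 := congrArg (Nat.cast : ℕ → ℂ_[p]) this
    rw [Nat.cast_mul, Nat.cast_add, Nat.cast_two, Nat.cast_one] at h3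
    rw [Int.cast_natCast]
    linear_combination h3 / 2
  have e2 : 1 / (2 * a ^ p) * (p * a ^ (p - 1)) = p / (2 * a) := by
    rw [← pow_sub_one_mul hp.out.ne_zero a]
    field_simp
  have e3 : a ^ (-(((p + 1) / 2 : ℕ) : ℤ) - 1) = a ^ (-(((p + 1) / 2 : ℕ) : ℤ)) * a⁻¹ :=
    zpow_sub_one₀ ha0 _
  simp only [normPairing, frobPairing, airySystem, Matrix.of_apply, Matrix.sub_apply, Pi.mul_apply,
    Pi.add_apply, Pi.sub_apply, Function.comp_apply,
    Matrix.smul_apply, Matrix.mul_apply, Fin.sum_univ_two, Matrix.cons_val_zero,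
    Matrix.cons_val_one, Matrix.cons_val', Matrix.cons_val_fin_one, smul_eq_mul]
  rw [e3, Int.cast_neg, e1]
  generalize a ^ (-(((p + 1) / 2 : ℕ) : ℤ)) = z
  generalize airySecond κ₁ π a = s₁
  generalize airyW p κ₁ π a = w₁
  generalize airySecond κ₂ π (a ^ p) = s₂
  generalize airyW p κ₂ π (a ^ p) = w₂
  generalize frobMatrix p π (a ^ 2) = F
  linear_combination (z * (s₁ * (F 0 0 * w₂ + F 0 1 * s₂) - w₁ * (F 1 0 * w₂ + F 1 1 * s₂))) * e2

theorem isLaurentOn_normPairing (hp5 : 5 ≤ p) (hπ : π ^ (p - 1) = -(p : ℂ_[p]))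
    (hb₁ : 1 / ((p : ℝ) - 1) < b) (hb₂ : b < ((p : ℝ) - 1) / p) {κ₁ κ₂ : ℂ_[p]}
    (h1 : ‖κ₁‖ = 1) (h2 : ‖κ₂‖ = 1) :
    IsLaurentOn (normPairing π κ₁ κ₂) ((p : ℝ) ^ (b / p / 3)) := by
  have lA : ∀ i j, IsLaurentOn (fun a => frobMatrix p π (a ^ 2) i j) ((p : ℝ) ^ (b / p / 3)) := by
    intro i j
    obtain ⟨c, hc⟩ := exists_hasPowerSeriesOn_frobMatrix hp5 hπ (norm_pi_inv_le hπ hb₁)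
      (fun ρ h0 h1 => exists_frobRates (pos_of_one_div_lt p hb₁) hb₂ h0 h1) i j
    refine (hc.isLaurentOn_comp 1 (m := 2) (by norm_num) (fun ρ h0 h1 => ?_)).congr fun a _ _ => ?_
    · rw [norm_one, one_mul]
      exact_mod_cast sq_lt_of_lt (by linarith) h1
    · rw [one_mul]
      norm_cast
  have w1 := isLaurentOn_airyW hp5 hπ h1 one_ne_zero ((p : ℝ) ^ (b / p / 3))
  have s1 := isLaurentOn_airySecond hp5 hπ h1 one_ne_zero ((p : ℝ) ^ (b / p / 3))
  have w2 := isLaurentOn_airyW hp5 hπ h2 hp.out.ne_zero ((p : ℝ) ^ (b / p / 3))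
  have s2 := isLaurentOn_airySecond hp5 hπ h2 hp.out.ne_zero ((p : ℝ) ^ (b / p / 3))
  simp only [pow_one] at w1 s1
  refine (((s1.mul (((lA 0 0).mul w2).add ((lA 0 1).mul s2))).sub
    (w1.mul (((lA 1 0).mul w2).add ((lA 1 1).mul s2)))).zpow_mul
    (-(((p + 1) / 2 : ℕ) : ℤ)) 1).congr fun a _ _ => ?_
  rw [one_mul, normPairing, frobPairing]

/-- The Airy system is invariant under `a ↦ -a`, which exchanges its two solutions at infinity. -/
theorem normPairing_neg (hp5 : 5 ≤ p) (π κ₁ κ₂ a : ℂ_[p]) :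
    normPairing π κ₁ κ₂ (-a) = (-1) ^ ((p + 1) / 2) * normPairing π (-κ₁) (-κ₂) a := by
  have hodd := hp.out.odd_of_ne_two (by omega)
  have hinv : ((-1 : ℂ_[p]) ^ ((p + 1) / 2))⁻¹ = (-1) ^ ((p + 1) / 2) :=
    inv_eq_of_mul_eq_one_left (by rw [← mul_pow]; simp)
  rw [normPairing, normPairing, frobPairing, frobPairing, neg_sq, hodd.neg_pow, airyW_neg,
    airySecond_neg, airyW_neg, airySecond_neg, zpow_neg, zpow_natCast, zpow_neg, zpow_natCast,
    neg_pow a, mul_inv, hinv]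
  ring

/-- The determinant of `V(a)⁻¹ 𝔄_{a ^ 2} V(a ^ p)`, from `det 𝔄 = p` and the Wronskian. -/
theorem normPairing_det (hp5 : 5 ≤ p) (hπ : π ^ (p - 1) = -(p : ℂ_[p]))
    (hb₁ : 1 / ((p : ℝ) - 1) < b) (hb₂ : b < ((p : ℝ) - 1) / p) {κ : ℂ_[p]} (hκ : ‖κ‖ = 1)
    {a : ℂ_[p]} (ha1 : 1 < ‖a‖) (ha : ‖a‖ < (p : ℝ) ^ (b / p / 3)) :
    normPairing π (-κ) (-κ) a * normPairing π κ κ a -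
      normPairing π (-κ) κ a * normPairing π κ (-κ) a = 9 * κ ^ 2 * p := by
  have ha0 : a ≠ 0 := fun h => by simp [h] at ha1; linarith
  have hap : 1 < ‖a ^ p‖ := by rw [norm_pow]; exact one_lt_pow₀ ha1 hp.out.ne_zero
  have hdet := (det_frobMatrix_eq (a := a ^ 2) hp5 hπ (norm_pi_inv_le hπ hb₁)
    (fun ρ h0 h1 => exists_frobRates (pos_of_one_div_lt p hb₁) hb₂ h0 h1)
    (by rw [norm_pow]; exact sq_lt_of_lt (norm_nonneg _) ha)).trans (det_frobMatrix_zero hp5 hπ)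
  rw [Matrix.det_fin_two] at hdet
  have hw := airy_wronskian hp5 hπ hκ ha1
  have hwp := airy_wronskian hp5 hπ hκ hap
  have hodd := Nat.odd_iff.1 (hp.out.odd_of_ne_two (by omega))
  have hz : a ^ (-(((p + 1) / 2 : ℕ) : ℤ)) * a ^ (-(((p + 1) / 2 : ℕ) : ℤ)) * (a * a ^ p) = 1 := by
    rw [← zpow_natCast a p, ← zpow_add₀ ha0, ← zpow_one_add₀ ha0, ← zpow_add₀ ha0]
    convert zpow_zero a using 2
    omega
  simp only [normPairing, frobPairing]
  generalize a ^ (-(((p + 1) / 2 : ℕ) : ℤ)) = z at *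
  generalize airySecond κ π a = s₁ at *
  generalize airySecond (-κ) π a = s₂ at *
  generalize airyW p κ π a = w₁ at *
  generalize airyW p (-κ) π a = w₂ at *
  generalize airySecond κ π (a ^ p) = t₁ at *
  generalize airySecond (-κ) π (a ^ p) = t₂ at *
  generalize airyW p κ π (a ^ p) = u₁ at *
  generalize airyW p (-κ) π (a ^ p) = u₂ at *
  generalize frobMatrix p π (a ^ 2) = F at *
  linear_combination z ^ 2 * (w₁ * s₂ - w₂ * s₁) * (u₁ * t₂ - u₂ * t₁) * hdet +
    p * z ^ 2 * (u₁ * t₂ - u₂ * t₁) * hw + p * z ^ 2 * (-3 * κ * a) * hwp + 9 * κ ^ 2 * p * hz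

end Pairing


/-! ### The rank one equations on the annulus -/

section Vanishing

variable {p : ℕ} [hp : Fact p.Prime] {π : ℂ_[p]} {b : ℝ}

theorem norm_intCast_of_not_dvd {n : ℤ} (hn : ¬ (p : ℤ) ∣ n) : ‖(n : ℂ_[p])‖ = 1 := by
  have h := norm_natCast_of_not_dvd p (n := n.natAbs) (fun h => hn (Int.natCast_dvd.2 h))
  rcases Int.natAbs_eq n with e | e
  · rw [e, Int.cast_natCast, h]
  · rw [e, Int.cast_neg, norm_neg, Int.cast_natCast, h]

/-- The equation `a K' = c p a ^ (3 p) K` has no nonzero solution on the annulus. The recursion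
forces a coefficient whose index is prime to `p` to grow too fast in the direction of `-∞`; the
other coefficients are products of arithmetic progressions, hence as small as factorials, times
coefficients of large index. -/
theorem eq_zero_of_laurent_recurrence (hp5 : 5 ≤ p) (hπ : π ^ (p - 1) = -(p : ℂ_[p])) {c : ℂ_[p]}
    (hc : ‖c‖ = ‖π‖) {k : ℤ → ℂ_[p]} {ρ C : ℝ} (hρ : 1 < ρ) (hρp : ρ ^ (3 * p) < p)
    (hC : ∀ n, ‖k n‖ * ρ ^ n ≤ C) (hrec : ∀ n : ℤ, n * k n = c * p * k (n - (3 * p : ℕ))) (n : ℤ) :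
    k n = 0 := by
  have hρ0 : 0 < ρ := by linarith
  have hp0 : (0 : ℝ) < p := by exact_mod_cast hp.out.pos
  have hp0' : (p : ℂ_[p]) ≠ 0 := by exact_mod_cast hp.out.ne_zero
  have hπ0 := norm_pi_pos hπ
  have hπ1 := norm_pi_lt_one hπ
  have hC0 : 0 ≤ C := le_trans (by positivity) (hC 0)
  have hC' : ∀ n, ‖k n‖ ≤ C * ρ ^ (-n) := fun n => by
    rw [zpow_neg, ← div_eq_mul_inv, le_div_iff₀ (by positivity)]
    exact hC n
  by_cases hn : (p : ℤ) ∣ n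
  · -- upward recursion: `k (p m)` in terms of coefficients of large index
    obtain ⟨m, rfl⟩ := hn
    have h1 : ∀ m : ℤ, m * k (p * m) = c * k (p * (m - 3)) := fun m => by
      have h := hrec (p * m)
      have e : (p : ℤ) * m - (3 * p : ℕ) = p * (m - 3) := by push_cast; ring
      rw [e] at h
      refine mul_left_cancel₀ hp0' ?_
      push_cast at h
      linear_combination h
    have h2 : ∀ j : ℕ, c ^ j * k (p * m) = 3 ^ j *
        (ascPochhammer ℂ_[p] j).eval (((m + 3 : ℤ) : ℂ_[p]) / (3 : ℕ)) * k (p * (m + 3 * j)) := by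
      intro j
      induction j with
      | zero => simp
      | succ j ih =>
        have h := h1 (m + 3 * j + 3)
        rw [add_sub_cancel_right] at h
        have e : m + 3 * ((j + 1 : ℕ) : ℤ) = m + 3 * j + 3 := by push_cast; ring
        rw [e, ascPochhammer_succ_eval, pow_succ', mul_assoc, ih]
        push_cast at h ⊢
        linear_combination -(3 ^ j * (ascPochhammer ℂ_[p] j).eval (((m : ℂ_[p]) + 3) / 3)) * h
    have h3 : ∀ j : ℕ, ‖k (p * m)‖ ≤
        p * C * ρ ^ (-(p * m : ℤ)) * ((j + 1) * ((ρ ^ (3 * p))⁻¹) ^ j) := by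
      intro j
      have ha := norm_ascPochhammer_eval_div_le (p := p) (m + 3) (q := 3)
        (fun h => by have := Nat.le_of_dvd (by norm_num) h; omega) j
      have h := congrArg norm (h2 j)
      rw [norm_mul, norm_mul, norm_mul, norm_pow, norm_pow, norm_three hp5, one_pow, one_mul, hc]
        at h
      refine le_of_mul_le_mul_left (h.le.trans ?_) (pow_pos hπ0 j)
      calc _ ≤ (p * (j + 1) * ‖π‖ ^ j) * (C * ρ ^ (-(p * (m + 3 * j) : ℤ))) := by
            gcongr
            · exact ha.trans (norm_factorial_le hπ j)
            · exact hC' _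
        _ = _ := by
            have e : (-(p * (m + 3 * j) : ℤ)) = -(p * m : ℤ) + -((3 * p * j : ℕ) : ℤ) := by
              push_cast; ring
            rw [e, zpow_add₀ hρ0.ne', zpow_neg ρ ((3 * p * j : ℕ) : ℤ), zpow_natCast, pow_mul,
              inv_pow]
            ring
    have hr1 : (ρ ^ (3 * p))⁻¹ < 1 :=
      inv_lt_one_of_one_lt₀ (one_lt_pow₀ hρ (mul_ne_zero three_ne_zero hp.out.ne_zero))
    have hr0 : 0 ≤ (ρ ^ (3 * p))⁻¹ := by positivity
    have ht : Tendsto (fun j : ℕ => ((j : ℝ) + 1) * ((ρ ^ (3 * p))⁻¹) ^ j) atTop (𝓝 0) := by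
      have := (tendsto_self_mul_const_pow_of_lt_one hr0 hr1).add
        (tendsto_pow_atTop_nhds_zero_of_lt_one hr0 hr1)
      rw [add_zero] at this
      exact this.congr fun j => by ring
    have ht' := ht.const_mul (p * C * ρ ^ (-(p * m : ℤ)))
    rw [mul_zero] at ht'
    exact norm_le_zero_iff.1 (ge_of_tendsto' ht' h3)
  · -- downward recursion: `n` is a unit, and so are all the indices that occur
    have h1 : ∀ j : ℕ, ‖k n‖ ≤ (‖π‖ * (p : ℝ)⁻¹) ^ j * ‖k (n - (3 * p * j : ℕ))‖ := by
      intro j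
      induction j with
      | zero => simp
      | succ j ih =>
        refine ih.trans (le_of_eq ?_)
        have hd : ¬ (p : ℤ) ∣ n - (3 * p * j : ℕ) := fun h =>
          hn ((dvd_sub_left (by exact_mod_cast Dvd.intro_left (3 * j) (by ring))).1 h)
        have h := congrArg norm (hrec (n - (3 * p * j : ℕ)))
        rw [norm_mul, norm_mul, norm_mul, norm_intCast_of_not_dvd hd, one_mul, hc,
          norm_p_complex] at h
        have e : n - (3 * p * (j + 1) : ℕ) = n - (3 * p * j : ℕ) - (3 * p : ℕ) := by
          push_cast; ring
        rw [h, e]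
        ring
    have h2 : ∀ j : ℕ, ‖k n‖ ≤ C * ρ ^ (-n) * (ρ ^ (3 * p) / p) ^ j := by
      intro j
      calc _ ≤ _ := h1 j
        _ ≤ (1 * (p : ℝ)⁻¹) ^ j * (C * ρ ^ (-(n - (3 * p * j : ℕ)))) := by
          gcongr
          exact hC' _
        _ = _ := by
          rw [neg_sub, sub_eq_neg_add, zpow_add₀ hρ0.ne', zpow_natCast, pow_mul, div_pow, one_mul,
            inv_pow]
          ring
    have ht := (tendsto_pow_atTop_nhds_zero_of_lt_one (by positivity : 0 ≤ ρ ^ (3 * p) / p)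
      ((div_lt_one hp0).2 hρp)).const_mul (C * ρ ^ (-n))
    rw [mul_zero] at ht
    exact norm_le_zero_iff.1 (ge_of_tendsto' ht h2)

theorem IsLaurentOn.eq_zero_of_mul_deriv_eq (hp5 : 5 ≤ p) (hπ : π ^ (p - 1) = -(p : ℂ_[p]))
    (hb₂ : b < ((p : ℝ) - 1) / p) {c : ℂ_[p]} (hc : ‖c‖ = ‖π‖) {f : ℂ_[p] → ℂ_[p]}
    (hf : IsLaurentOn f ((p : ℝ) ^ (b / p / 3)))
    (h : ∀ a, 1 < ‖a‖ → ‖a‖ < (p : ℝ) ^ (b / p / 3) → a * deriv f a = c * p * a ^ (3 * p) * f a)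
    {a : ℂ_[p]} (ha1 : 1 < ‖a‖) (ha : ‖a‖ < (p : ℝ) ^ (b / p / 3)) : f a = 0 := by
  obtain ⟨k, hk⟩ := hf
  have hz : HasLaurentSeriesOn (fun _ : ℂ_[p] => (0 : ℂ_[p])) _ ((p : ℝ) ^ (b / p / 3)) :=
    (hk.mul_deriv.sub (hk.zpow_mul ((3 * p : ℕ) : ℤ) (c * p))).congr fun a h1 h2 => by
      rw [h a h1 h2, zpow_natCast, sub_self]
  obtain ⟨C, hC⟩ := hk.1 ‖a‖ ha1 ha
  have h0 : ∀ n, k n = 0 := eq_zero_of_laurent_recurrence hp5 hπ hc ha1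
    (pow_three_mul_lt hb₂ (norm_nonneg _) ha) hC fun n =>
      sub_eq_zero.1 (hz.eq_zero (norm_two hp5) ha1 ha n)
  refine (hk.2 a ha1 ha).unique ?_
  simp only [h0, zero_mul]
  exact hasSum_zero

/-- The entries of `V⁻¹ 𝔄 V^φ` on the wrong diagonal vanish: an exponential factor turns such an
entry into a solution of the equation above. -/
theorem normPairing_eq_zero (hp5 : 5 ≤ p) (hπ : π ^ (p - 1) = -(p : ℂ_[p]))
    (hb₁ : 1 / ((p : ℝ) - 1) < b) (hb₂ : b < ((p : ℝ) - 1) / p) {κ₁ κ₂ : ℂ_[p]}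
    (h1 : κ₁ ^ 2 = -4 / 27) (h2 : κ₂ ^ 2 = -4 / 27) (h : ‖κ₁ ^ p + -κ₂‖ ≤ (p : ℝ)⁻¹)
    {a : ℂ_[p]} (ha1 : 1 < ‖a‖) (ha : ‖a‖ < (p : ℝ) ^ (b / p / 3)) :
    normPairing π κ₁ κ₂ a = 0 := by
  have n1 := norm_kappa hp5 h1
  have n2 := norm_kappa hp5 h2
  have h0 := ((isLaurentOn_normPairing hp5 hπ hb₁ hb₂ n1 n2).mul
    (isLaurentOn_airyE hπ hb₂ n1 h)).eq_zero_of_mul_deriv_eq hp5 hπ hb₂ (c := -(6 * κ₂ * π))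
    (by rw [norm_neg, norm_mul, norm_mul, n2, show (6 : ℂ_[p]) = 2 * 3 by norm_num, norm_mul,
      norm_two hp5, norm_three hp5]; ring) (fun a ha1 ha => by
      have d := (hasDerivAt_normPairing hp5 hπ hb₁ hb₂ h1 h2 ha1 ha).mul
        (hasDerivAt_airyE hπ hb₂ n1 h ha)
      have e : a ^ (3 * p) = a ^ (p - 1) * a * (a ^ p) ^ 2 := by
        rw [pow_sub_one_mul hp.out.ne_zero, ← pow_succ', ← pow_mul]; congr 1; omega
      have d' := d.deriv
      simp only [Pi.mul_def] at d'
      rw [d', e]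
      ring) ha1 ha
  exact (mul_eq_zero.1 h0).resolve_right
    (left_ne_zero_of_mul_eq_one (airyE_mul_airyE_neg hp5 hπ hb₂ n1 h ha))

/-- The other entries are constant multiples of an exponential factor. -/
theorem exists_normPairing_eq (hp5 : 5 ≤ p) (hπ : π ^ (p - 1) = -(p : ℂ_[p]))
    (hb₁ : 1 / ((p : ℝ) - 1) < b) (hb₂ : b < ((p : ℝ) - 1) / p) {κ₁ κ₂ : ℂ_[p]}
    (h1 : κ₁ ^ 2 = -4 / 27) (h2 : κ₂ ^ 2 = -4 / 27) (h : ‖κ₁ ^ p + κ₂‖ ≤ (p : ℝ)⁻¹) :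
    ∃ C, ∀ a, 1 < ‖a‖ → ‖a‖ < (p : ℝ) ^ (b / p / 3) →
      normPairing π κ₁ κ₂ a * airyE π κ₁ κ₂ a = C := by
  have n1 := norm_kappa hp5 h1
  have n2 := norm_kappa hp5 h2
  refine ((isLaurentOn_normPairing hp5 hπ hb₁ hb₂ n1 n2).mul
    (isLaurentOn_airyE hπ hb₂ n1 h)).eq_const_of_deriv_eq_zero (norm_two hp5) fun a ha1 ha => ?_
  have d := ((hasDerivAt_normPairing hp5 hπ hb₁ hb₂ h1 h2 ha1 ha).mul
    (hasDerivAt_airyE hπ hb₂ n1 h ha)).deriv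
  simp only [Pi.mul_def] at d
  rw [d]
  ring

theorem exists_mem_annulus (hb : 0 < b) :
    ∃ a : ℂ_[p], 1 < ‖a‖ ∧ ‖a‖ < (p : ℝ) ^ (b / p / 3) := by
  have h1 : (1 : ℝ) < p := by exact_mod_cast hp.out.one_lt
  obtain ⟨N, hN⟩ := exists_nat_one_div_lt (show 0 < b / p / 3 by positivity)
  obtain ⟨x, hx⟩ := IsAlgClosed.exists_pow_nat_eq ((p : ℂ_[p])⁻¹) (Nat.succ_pos N)
  have hx' := congrArg norm hx
  rw [norm_pow, norm_inv, norm_p_complex, inv_inv] at hx'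
  refine ⟨x, ?_, ?_⟩
  · by_contra! hle
    exact absurd (hx'.symm.le.trans (pow_le_one₀ (norm_nonneg _) hle)) (not_le.2 h1)
  · refine lt_of_pow_lt_pow_left₀ (N + 1) (by positivity) ?_
    rw [hx', ← Real.rpow_mul_natCast (by positivity)]
    nth_rewrite 1 [← Real.rpow_one (p : ℝ)]
    refine Real.rpow_lt_rpow_of_exponent_lt h1 ?_
    rw [div_lt_iff₀ (by positivity)] at hN
    push_cast
    linarith

end Vanishing


/-! ### Local fundamental matrices -/

section LocalSolutions

variable {p : ℕ} [hp : Fact p.Prime] {π : ℂ_[p]} {b : ℝ}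

theorem IsSqrtBranch.eventually_hasDerivAt {z : ℂ_[p]} {s : ℂ_[p] → ℂ_[p]}
    (hs : IsSqrtBranch p z s) (hz : z ≠ 0) :
    ∀ᶠ a in 𝓝 z, s a ^ 2 = a ∧ s a ≠ 0 ∧ HasDerivAt s (2 * s a)⁻¹ a := by
  filter_upwards [hs.1.eventually_analyticAt, hs.2.eventually_nhds,
    isOpen_ne.mem_nhds hz] with a h1 h2 h3
  have e := h2.self_of_nhds
  have h0 : s a ≠ 0 := fun h => h3 (by rw [← e, h]; simp)
  have h2' : (2 : ℂ_[p]) ≠ 0 := two_ne_zero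
  refine ⟨e, h0, h1.differentiableAt.hasDerivAt.congr_deriv ?_⟩
  have d1 := h1.differentiableAt.hasDerivAt.pow 2
  have d2 : HasDerivAt (s ^ 2) 1 a := (hasDerivAt_id a).congr_of_eventuallyEq h2
  have h := d1.unique d2
  refine eq_inv_of_mul_eq_one_left ?_
  push_cast at h
  linear_combination h

/-- A branch of `exp h` satisfies the differential equation of `exp h`. -/
theorem IsExpBranch.eventually_hasDerivAt (hπ : π ^ (p - 1) = -(p : ℂ_[p])) {z : ℂ_[p]}
    {h h' e : ℂ_[p] → ℂ_[p]} (he : IsExpBranch p h z e) (hd : ∀ a, HasDerivAt h (h' a) a) :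
    ∀ᶠ a in 𝓝 z, e a ≠ 0 ∧ HasDerivAt e (h' a * e a) a := by
  obtain ⟨c, hc, hev⟩ := he
  have hball : ∀ᶠ a in 𝓝 z, ‖h a - h z‖ < ‖π‖ := by
    have h1 : ContinuousAt (fun a => ‖h a - h z‖) z :=
      ((hd z).continuousAt.sub continuousAt_const).norm
    refine h1.eventually (gt_mem_nhds ?_)
    beta_reduce
    rw [sub_self, norm_zero]
    exact norm_pi_pos hπ
  filter_upwards [hev.eventually_nhds, hball] with a h1 h2
  have e1 := h1.self_of_nhds
  refine ⟨by rw [e1]; exact mul_ne_zero hc (exp_ne_zero_of_norm_lt hπ h2), ?_⟩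
  have d := ((HasDerivAt.comp (h := fun a => h a - h z) a (hasDerivAt_exp_of_norm_lt hπ h2)
    ((hd a).sub_const (h z))).const_mul c).congr_of_eventuallyEq h1
  refine d.congr_deriv ?_
  rw [e1]
  ring

theorem IsExpBranch.analyticAt (hπ : π ^ (p - 1) = -(p : ℂ_[p])) {z : ℂ_[p]}
    {h e : ℂ_[p] → ℂ_[p]} (he : IsExpBranch p h z e) (hh : AnalyticAt ℂ_[p] h z) :
    AnalyticAt ℂ_[p] e z := by
  obtain ⟨c, -, hev⟩ := he
  refine AnalyticAt.congr ?_ (hev.mono fun a h => h.symm)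
  refine analyticAt_const.mul (AnalyticAt.fun_comp (g := NormedSpace.exp) ?_
    (hh.sub analyticAt_const))
  rw [sub_self]
  exact (hasPowerSeriesOn_exp hπ).analyticAt (by rw [norm_zero]; exact norm_pi_pos hπ)

/-- Consequences of the choice of branches, in the form in which they are used. -/
theorem IsBranchData.eventually (hπ : π ^ (p - 1) = -(p : ℂ_[p])) {κ z : ℂ_[p]}
    {s e e' : ℂ_[p] → ℂ_[p]} (h : IsBranchData p κ π z s e e') (hz : z ≠ 0) :
    ∀ᶠ a in 𝓝 z, s a ^ 2 = a ∧ s a ≠ 0 ∧ HasDerivAt s (2 * s a)⁻¹ a ∧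
      e a ≠ 0 ∧ HasDerivAt e (3 * κ * π * a ^ 2 * e a) a ∧
      e' a ≠ 0 ∧ HasDerivAt e' (3 * p * κ * π * (a ^ (p - 1) * (a ^ p) ^ 2) * e' a) a := by
  have d1 : ∀ a : ℂ_[p], HasDerivAt (fun a => κ * π * a ^ 3) (3 * κ * π * a ^ 2) a := fun a =>
    ((hasDerivAt_pow 3 a).const_mul (κ * π)).congr_deriv (by push_cast; ring)
  have d2 : ∀ a : ℂ_[p], HasDerivAt (fun a => κ * π * a ^ (3 * p))
      (3 * p * κ * π * (a ^ (p - 1) * (a ^ p) ^ 2)) a := fun a => by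
    refine ((hasDerivAt_pow (3 * p) a).const_mul (κ * π)).congr_deriv ?_
    have e1 : a ^ (3 * p - 1) = a ^ (p - 1) * (a ^ p) ^ 2 := by
      rw [← pow_mul, ← pow_add]
      congr 1
      have := hp.out.one_lt
      omega
    rw [e1]
    push_cast
    ring
  filter_upwards [h.1.eventually_hasDerivAt hz, h.2.1.eventually_hasDerivAt hπ d1,
    h.2.2.eventually_hasDerivAt hπ d2] with a h1 h2 h3
  exact ⟨h1.1, h1.2.1, h1.2.2, h2.1, h2.2, h3.1, h3.2⟩

theorem IsBranchData.analyticAt (hπ : π ^ (p - 1) = -(p : ℂ_[p])) {κ z : ℂ_[p]}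
    {s e e' : ℂ_[p] → ℂ_[p]} (h : IsBranchData p κ π z s e e') :
    AnalyticAt ℂ_[p] s z ∧ AnalyticAt ℂ_[p] e z ∧ AnalyticAt ℂ_[p] e' z :=
  ⟨h.1.1, h.2.1.analyticAt hπ (analyticAt_const.mul (analyticAt_id.pow 3)),
    h.2.2.analyticAt hπ (analyticAt_const.mul (analyticAt_id.pow (3 * p)))⟩

/-- Each column of `V`, multiplied by `a ^ (-1/2)` and its exponential factor, solves the Airy
system. -/
theorem hasDerivAt_airy_column (hp5 : 5 ≤ p) (hπ : π ^ (p - 1) = -(p : ℂ_[p])) {κ : ℂ_[p]}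
    (hκ2 : κ ^ 2 = -4 / 27) {a : ℂ_[p]} (ha : 1 < ‖a‖) {s ε : ℂ_[p] → ℂ_[p]} (hs2 : s a ^ 2 = a)
    (hs0 : s a ≠ 0) (hs : HasDerivAt s (2 * s a)⁻¹ a)
    (hε : HasDerivAt ε (3 * κ * π * a ^ 2 * ε a) a) :
    HasDerivAt (fun x => (s x)⁻¹ * (airyW p κ π x * ε x))
      (2 * π * a * ((s a)⁻¹ * (airySecond κ π a * ε a))) a ∧
    HasDerivAt (fun x => (s x)⁻¹ * (airySecond κ π x * ε x))
      (-(2 * π * a ^ 3 / 3) * ((s a)⁻¹ * (airyW p κ π a * ε a))) a := by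
  have n1 := norm_kappa hp5 hκ2
  have dW := hasDerivAt_airyW' hp5 hπ n1 ha
  have dS := hasDerivAt_airySecond hp5 hπ n1 hκ2 ha
  have ha0 : a ≠ 0 := fun h => by simp [h] at ha; linarith
  have e1 : -(2 * s a)⁻¹ / s a ^ 2 = -(1 / (2 * a)) * (s a)⁻¹ := by
    rw [hs2]; field_simp
  refine ⟨((hs.fun_inv hs0).fun_mul (dW.fun_mul hε)).congr_deriv ?_,
    ((hs.fun_inv hs0).fun_mul (dS.fun_mul hε)).congr_deriv ?_⟩
  · rw [e1]; ring
  · rw [e1]; ring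

theorem airyY_eq (κ π : ℂ_[p]) (s e : ℂ_[p] → ℂ_[p]) (a : ℂ_[p]) : airyY p κ π s e a =
    !![(s a)⁻¹ * (airyW p κ π a * e a), (s a)⁻¹ * (airyW p (-κ) π a * (e a)⁻¹);
      (s a)⁻¹ * (airySecond κ π a * e a), (s a)⁻¹ * (airySecond (-κ) π a * (e a)⁻¹)] := by
  rw [airyY, airyVMatrix_eq]
  ext i j
  rw [Matrix.smul_apply, Matrix.mul_diagonal, smul_eq_mul]
  fin_cases i <;> fin_cases j <;> rfl

theorem airyYFrob_eq (κ π : ℂ_[p]) (s e' : ℂ_[p] → ℂ_[p]) (a : ℂ_[p]) : airyYFrob p κ π s e' a =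
    !![(s a ^ p)⁻¹ * (airyW p κ π (a ^ p) * e' a),
        (s a ^ p)⁻¹ * (airyW p (-κ) π (a ^ p) * (e' a)⁻¹);
      (s a ^ p)⁻¹ * (airySecond κ π (a ^ p) * e' a),
        (s a ^ p)⁻¹ * (airySecond (-κ) π (a ^ p) * (e' a)⁻¹)] := by
  rw [airyYFrob, airyVMatrix_eq]
  ext i j
  rw [Matrix.smul_apply, Matrix.mul_diagonal, smul_eq_mul]
  fin_cases i <;> fin_cases j <;> rfl

theorem det_airyY (hp5 : 5 ≤ p) (hπ : π ^ (p - 1) = -(p : ℂ_[p])) {κ : ℂ_[p]} (hκ : ‖κ‖ = 1)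
    {s e : ℂ_[p] → ℂ_[p]} {a : ℂ_[p]} (ha : 1 < ‖a‖) (hs2 : s a ^ 2 = a) (he : e a ≠ 0) :
    (airyY p κ π s e a).det = -3 * κ := by
  have ha0 : a ≠ 0 := fun h => by simp [h] at ha; linarith
  have hs0 : s a ≠ 0 := fun h => ha0 (by rw [← hs2, h]; simp)
  have hw := airy_wronskian hp5 hπ hκ ha
  have h1 : (s a)⁻¹ ^ 2 * a = 1 := by
    nth_rewrite 2 [← hs2]
    rw [← mul_pow, inv_mul_cancel₀ hs0, one_pow]
  have h2 : e a * (e a)⁻¹ = 1 := mul_inv_cancel₀ he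
  rw [airyY_eq, Matrix.det_fin_two_of]
  generalize (s a)⁻¹ = σ at *
  generalize (e a)⁻¹ = η at *
  linear_combination σ ^ 2 * hw + σ ^ 2 * (airyW p κ π a * airySecond (-κ) π a -
    airyW p (-κ) π a * airySecond κ π a) * h2 - 3 * κ * h1

theorem isFundamentalSolutionAt_airyY (hp5 : 5 ≤ p) (hπ : π ^ (p - 1) = -(p : ℂ_[p]))
    {κ z : ℂ_[p]} (hκ2 : κ ^ 2 = -4 / 27) (hz : 1 < ‖z‖) {s e e' : ℂ_[p] → ℂ_[p]}
    (h : IsBranchData p κ π z s e e') : IsFundamentalSolutionAt p π z (airyY p κ π s e) := by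
  have hκ := norm_kappa hp5 hκ2
  have hκ' : ‖-κ‖ = 1 := by rw [norm_neg, hκ]
  have hz0 : z ≠ 0 := fun h => by simp [h] at hz; linarith
  have hev := h.eventually hπ hz0
  obtain ⟨-, hs0, -, he0, -⟩ := hev.self_of_nhds
  obtain ⟨as, ae, -⟩ := h.analyticAt hπ
  have aW : ∀ κ : ℂ_[p], ‖κ‖ = 1 → AnalyticAt ℂ_[p] (airyW p κ π) z := fun κ hκ => by
    obtain ⟨c, hc⟩ := isLaurentOn_airyW hp5 hπ hκ one_ne_zero (‖z‖ + 1)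
    simpa only [pow_one] using hc.analyticAt hz (lt_add_one _)
  have aS : ∀ κ : ℂ_[p], ‖κ‖ = 1 → AnalyticAt ℂ_[p] (airySecond κ π) z := fun κ hκ => by
    obtain ⟨c, hc⟩ := isLaurentOn_airySecond hp5 hπ hκ one_ne_zero (‖z‖ + 1)
    simpa only [pow_one] using hc.analyticAt hz (lt_add_one _)
  constructor
  · intro i j
    simp only [airyY_eq]
    fin_cases i <;> fin_cases j
    · exact (as.inv hs0).mul ((aW κ hκ).mul ae)
    · exact (as.inv hs0).mul ((aW (-κ) hκ').mul (ae.inv he0))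
    · exact (as.inv hs0).mul ((aS κ hκ).mul ae)
    · exact (as.inv hs0).mul ((aS (-κ) hκ').mul (ae.inv he0))
  · filter_upwards [hev, continuous_norm.continuousAt.eventually (lt_mem_nhds hz)]
      with a ⟨hs2, hs0, hs, he0, he, _, _⟩ ha
    refine ⟨?_, ?_⟩
    · have d1 := hasDerivAt_airy_column hp5 hπ hκ2 ha hs2 hs0 hs he
      have d2 := hasDerivAt_airy_column (ε := fun x => (e x)⁻¹) hp5 hπ (κ := -κ)
        (by rw [neg_sq, hκ2]) ha hs2 hs0 hs ((he.fun_inv he0).congr_deriv (by field_simp))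
      intro i j
      simp only [airyY_eq, airySystem]
      fin_cases i <;> fin_cases j
      · exact d1.1.congr_deriv (by simp [Matrix.mul_apply])
      · exact d2.1.congr_deriv (by simp [Matrix.mul_apply])
      · exact d1.2.congr_deriv (by simp [Matrix.mul_apply])
      · exact d2.2.congr_deriv (by simp [Matrix.mul_apply])
    · rw [det_airyY hp5 hπ hκ ha hs2 he0]
      have : κ ≠ 0 := norm_ne_zero_iff.1 (by rw [hκ]; exact one_ne_zero)
      exact mul_ne_zero (by norm_num) this

end LocalSolutions


/-! ### The connection matrix -/

section ConnectionMatrix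

variable {p : ℕ} [hp : Fact p.Prime] {π : ℂ_[p]} {b : ℝ}

/-- The matrix `𝒴⁻¹ 𝔄_{a ^ 2} 𝒴^φ`, written out in terms of the normalized pairings so that the
branch `s` of the square root does not occur; see `airyY_mul_connection`. -/
noncomputable def connection (κ π : ℂ_[p]) (e e' : ℂ_[p] → ℂ_[p]) (a : ℂ_[p]) :
    Matrix (Fin 2) (Fin 2) ℂ_[p] :=
  !![(-3 * κ)⁻¹ * ((e a)⁻¹ * normPairing π (-κ) κ a * e' a),
      (-3 * κ)⁻¹ * ((e a)⁻¹ * normPairing π (-κ) (-κ) a * (e' a)⁻¹);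
    (3 * κ)⁻¹ * (e a * normPairing π κ κ a * e' a),
      (3 * κ)⁻¹ * (e a * normPairing π κ (-κ) a * (e' a)⁻¹)]

/-- By the Wronskian, `connection` is `𝒴⁻¹ 𝔄_{a ^ 2} 𝒴^φ`; the square root enters only through
`s ^ (1 - p) = a ^ ((1 - p) / 2)`. -/
theorem airyY_mul_connection (hp5 : 5 ≤ p) (hπ : π ^ (p - 1) = -(p : ℂ_[p])) {κ : ℂ_[p]}
    (hκ : ‖κ‖ = 1) {s e e' : ℂ_[p] → ℂ_[p]} {a : ℂ_[p]} (ha : 1 < ‖a‖) (hs2 : s a ^ 2 = a)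
    (he : e a ≠ 0) : frobMatrix p π (a ^ 2) * airyYFrob p κ π s e' a =
      airyY p κ π s e a * connection κ π e e' a := by
  have ha0 : a ≠ 0 := fun h => by simp [h] at ha; linarith
  have hs0 : s a ≠ 0 := fun h => ha0 (by rw [← hs2, h]; simp)
  have hκ0 : κ ≠ 0 := norm_ne_zero_iff.1 (by rw [hκ]; exact one_ne_zero)
  have hw := airy_wronskian hp5 hπ hκ ha
  have hodd := Nat.odd_iff.1 (hp.out.odd_of_ne_two (by omega))
  have hz : (s a)⁻¹ * (a ^ (-(((p + 1) / 2 : ℕ) : ℤ)) * a) = (s a ^ p)⁻¹ := by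
    have e1 : a ^ ((p + 1) / 2) = s a ^ (p + 1) := by
      conv_lhs => rw [← hs2]
      rw [← pow_mul]
      congr 1
      omega
    rw [zpow_neg, zpow_natCast, e1]
    nth_rewrite 3 [← hs2]
    field_simp
    ring
  have h2 : e a * (e a)⁻¹ = 1 := mul_inv_cancel₀ he
  have h3 : (-3 * κ)⁻¹ = -(3 * κ)⁻¹ := by rw [neg_mul, inv_neg]
  have h4 : (3 * κ)⁻¹ * (3 * κ) = 1 := inv_mul_cancel₀ (mul_ne_zero three_ne_zero hκ0)
  rw [airyY_eq, airyYFrob_eq, connection, h3, ← hz]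
  simp only [normPairing, frobPairing]
  generalize a ^ (-(((p + 1) / 2 : ℕ) : ℤ)) = z at *
  generalize airySecond κ π a = s₁ at *
  generalize airySecond (-κ) π a = s₂ at *
  generalize airyW p κ π a = w₁ at *
  generalize airyW p (-κ) π a = w₂ at *
  generalize airySecond κ π (a ^ p) = t₁ at *
  generalize airySecond (-κ) π (a ^ p) = t₂ at *
  generalize airyW p κ π (a ^ p) = u₁ at *
  generalize airyW p (-κ) π (a ^ p) = u₂ at *
  generalize frobMatrix p π (a ^ 2) = F at *
  generalize (s a)⁻¹ = σ at *
  generalize (e a)⁻¹ = η at *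
  generalize (3 * κ)⁻¹ = k at *
  generalize (e' a)⁻¹ = θ at *
  ext i j
  fin_cases i <;> fin_cases j <;> simp only [Matrix.mul_apply, Fin.sum_univ_two, Fin.zero_eta,
    Fin.mk_one, Matrix.of_apply, Matrix.cons_val_zero, Matrix.cons_val_one, Matrix.cons_val',
    Matrix.cons_val_fin_one]
  · linear_combination (σ * z * (F 0 0 * u₁ + F 0 1 * t₁) * e' a) *
      (k * hw - a * h4 + k * (w₁ * s₂ - w₂ * s₁) * h2)
  · linear_combination (σ * z * (F 0 0 * u₂ + F 0 1 * t₂) * θ) *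
      (k * hw - a * h4 + k * (w₁ * s₂ - w₂ * s₁) * h2)
  · linear_combination (σ * z * (F 1 0 * u₁ + F 1 1 * t₁) * e' a) *
      (k * hw - a * h4 + k * (w₁ * s₂ - w₂ * s₁) * h2)
  · linear_combination (σ * z * (F 1 0 * u₂ + F 1 1 * t₂) * θ) *
      (k * hw - a * h4 + k * (w₁ * s₂ - w₂ * s₁) * h2)

/-- The matrix `𝒴⁻¹ 𝔄_{a ^ 2} 𝒴^φ` is locally constant, because all its entries have derivative
zero. -/
theorem eventually_connection_eq (hp5 : 5 ≤ p) (hπ : π ^ (p - 1) = -(p : ℂ_[p]))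
    (hb₁ : 1 / ((p : ℝ) - 1) < b) (hb₂ : b < ((p : ℝ) - 1) / p) {κ z : ℂ_[p]}
    (hκ2 : κ ^ 2 = -4 / 27) (hz1 : 1 < ‖z‖) (hz : ‖z‖ < (p : ℝ) ^ (b / p / 3))
    {s e e' : ℂ_[p] → ℂ_[p]} (h : IsBranchData p κ π z s e e') :
    ∀ᶠ a in 𝓝 z, connection κ π e e' a = connection κ π e e' z := by
  have hz0 : z ≠ 0 := fun h => by simp [h] at hz1; linarith
  have hκ2' : (-κ) ^ 2 = -4 / 27 := by rw [neg_sq, hκ2]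
  have hev := h.eventually hπ hz0
  obtain ⟨-, -, -, he0, -, he0', -⟩ := hev.self_of_nhds
  obtain ⟨-, ae, ae'⟩ := h.analyticAt hπ
  have key : ∀ κ₁ κ₂ : ℂ_[p], κ₁ ^ 2 = -4 / 27 → κ₂ ^ 2 = -4 / 27 → ∀ ε ε' : ℂ_[p] → ℂ_[p],
      AnalyticAt ℂ_[p] ε z → AnalyticAt ℂ_[p] ε' z →
      (∀ᶠ a in 𝓝 z, HasDerivAt ε (3 * κ₁ * π * a ^ 2 * ε a) a ∧
        HasDerivAt ε' (3 * p * κ₂ * π * (a ^ (p - 1) * (a ^ p) ^ 2) * ε' a) a) →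
      ∀ᶠ a in 𝓝 z, ε a * normPairing π κ₁ κ₂ a * ε' a = ε z * normPairing π κ₁ κ₂ z * ε' z := by
    intro κ₁ κ₂ h1 h2 ε ε' aε aε' hd
    obtain ⟨c, hc⟩ := isLaurentOn_normPairing hp5 hπ hb₁ hb₂ (norm_kappa hp5 h1)
      (norm_kappa hp5 h2)
    refine eventually_eq_of_eventually_deriv_eq_zero
      (f := fun a => ε a * normPairing π κ₁ κ₂ a * ε' a)
      ((aε.mul (hc.analyticAt hz1 hz)).mul aε') ?_
    filter_upwards [hd, continuous_norm.continuousAt.eventually (lt_mem_nhds hz1),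
      continuous_norm.continuousAt.eventually (gt_mem_nhds hz)] with a ⟨d1, d2⟩ ha1 ha
    rw [((d1.fun_mul (hasDerivAt_normPairing hp5 hπ hb₁ hb₂ h1 h2 ha1 ha)).fun_mul d2).deriv]
    ring
  have k1 := key (-κ) κ hκ2' hκ2 (fun a => (e a)⁻¹) e' (ae.inv he0) ae' <| by
    filter_upwards [hev] with a ⟨_, _, _, he0, he, he0', he'⟩
    exact ⟨(he.fun_inv he0).congr_deriv (by field_simp), he'⟩
  have k2 := key (-κ) (-κ) hκ2' hκ2' (fun a => (e a)⁻¹) (fun a => (e' a)⁻¹) (ae.inv he0)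
    (ae'.inv he0') <| by
    filter_upwards [hev] with a ⟨_, _, _, he0, he, he0', he'⟩
    exact ⟨(he.fun_inv he0).congr_deriv (by field_simp),
      (he'.fun_inv he0').congr_deriv (by field_simp)⟩
  have k3 := key κ κ hκ2 hκ2 e e' ae ae' <| by
    filter_upwards [hev] with a ⟨_, _, _, he0, he, he0', he'⟩
    exact ⟨he, he'⟩
  have k4 := key κ (-κ) hκ2 hκ2' e (fun a => (e' a)⁻¹) ae (ae'.inv he0') <| by
    filter_upwards [hev] with a ⟨_, _, _, he0, he, he0', he'⟩
    exact ⟨he, (he'.fun_inv he0').congr_deriv (by field_simp)⟩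
  filter_upwards [k1, k2, k3, k4] with a h1 h2 h3 h4
  rw [connection, connection, h1, h2, h3, h4]

/-- The relation defining `M` has the value of `connection` at `z` as its only solution. -/
theorem frobRelation_iff (hp5 : 5 ≤ p) (hπ : π ^ (p - 1) = -(p : ℂ_[p]))
    (hb₁ : 1 / ((p : ℝ) - 1) < b) (hb₂ : b < ((p : ℝ) - 1) / p) {κ z : ℂ_[p]}
    (hκ2 : κ ^ 2 = -4 / 27) (hz1 : 1 < ‖z‖) (hz : ‖z‖ < (p : ℝ) ^ (b / p / 3))
    {s e e' : ℂ_[p] → ℂ_[p]} (h : IsBranchData p κ π z s e e')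
    (N : Matrix (Fin 2) (Fin 2) ℂ_[p]) :
    FrobRelation p κ π z s e e' N ↔ N = connection κ π e e' z := by
  have hκ := norm_kappa hp5 hκ2
  have hz0 : z ≠ 0 := fun h => by simp [h] at hz1; linarith
  have hev := h.eventually hπ hz0
  constructor
  · intro hN
    obtain ⟨hs2, -, -, he0, -⟩ := hev.self_of_nhds
    have h1 := hN.self_of_nhds
    rw [airyY_mul_connection hp5 hπ hκ hz1 hs2 he0] at h1
    have hdet : IsUnit (airyY p κ π s e z).det := by
      rw [det_airyY hp5 hπ hκ hz1 hs2 he0]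
      have : κ ≠ 0 := norm_ne_zero_iff.1 (by rw [hκ]; exact one_ne_zero)
      exact (mul_ne_zero (by norm_num) this).isUnit
    have h2 := congrArg (fun X => (airyY p κ π s e z)⁻¹ * X) h1
    simp only [Matrix.nonsing_inv_mul_cancel_left _ _ hdet] at h2
    exact h2.symm
  · rintro rfl
    filter_upwards [hev, eventually_connection_eq hp5 hπ hb₁ hb₂ hκ2 hz1 hz h,
      continuous_norm.continuousAt.eventually (lt_mem_nhds hz1)]
      with a ⟨hs2, _, _, he0, _⟩ hc ha1
    rw [airyY_mul_connection hp5 hπ hκ ha1 hs2 he0, hc]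

theorem isUnit_connection (hp5 : 5 ≤ p) (hπ : π ^ (p - 1) = -(p : ℂ_[p]))
    (hb₁ : 1 / ((p : ℝ) - 1) < b) (hb₂ : b < ((p : ℝ) - 1) / p) {κ z : ℂ_[p]}
    (hκ2 : κ ^ 2 = -4 / 27) (hz1 : 1 < ‖z‖) (hz : ‖z‖ < (p : ℝ) ^ (b / p / 3))
    {e e' : ℂ_[p] → ℂ_[p]} (he : e z ≠ 0) (he' : e' z ≠ 0) :
    IsUnit (connection κ π e e' z) := by
  have hκ := norm_kappa hp5 hκ2
  have hκ0 : κ ≠ 0 := norm_ne_zero_iff.1 (by rw [hκ]; exact one_ne_zero)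
  have hp0 : (p : ℂ_[p]) ≠ 0 := by exact_mod_cast hp.out.ne_zero
  have hd := normPairing_det hp5 hπ hb₁ hb₂ hκ hz1 hz
  rw [Matrix.isUnit_iff_isUnit_det, connection, Matrix.det_fin_two_of]
  refine IsUnit.mk0 _ fun h0 => hp0 ?_
  have h1 : e z * (e z)⁻¹ = 1 := mul_inv_cancel₀ he
  have h2 : e' z * (e' z)⁻¹ = 1 := mul_inv_cancel₀ he'
  have h3 : (-3 * κ)⁻¹ = -(3 * κ)⁻¹ := by rw [neg_mul, inv_neg]
  have h4 : (3 * κ)⁻¹ * (3 * κ) = 1 := inv_mul_cancel₀ (mul_ne_zero three_ne_zero hκ0)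
  rw [h3] at h0
  generalize (3 * κ)⁻¹ = k at *
  generalize (e z)⁻¹ = η at *
  generalize (e' z)⁻¹ = η' at *
  have h5 : k ^ 2 * (9 * κ ^ 2 * p) = 0 := by
    rw [← hd]
    linear_combination h0 - k ^ 2 * (normPairing π (-κ) (-κ) z * normPairing π κ κ z -
      normPairing π (-κ) κ z * normPairing π κ (-κ) z) * (h1 * (e' z * η') + h2)
  linear_combination h5 - p * (k * (3 * κ) + 1) * h4

/-- The nonvanishing entries, evaluated on the whole annulus by a single constant. The second
formula is the first one at `-a`. -/
theorem exists_normPairing_mul_eq (hp5 : 5 ≤ p) (hπ : π ^ (p - 1) = -(p : ℂ_[p]))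
    (hb₁ : 1 / ((p : ℝ) - 1) < b) (hb₂ : b < ((p : ℝ) - 1) / p) {κ₁ κ₂ : ℂ_[p]}
    (h1 : κ₁ ^ 2 = -4 / 27) (h2 : κ₂ ^ 2 = -4 / 27) (h : ‖κ₁ ^ p + κ₂‖ ≤ (p : ℝ)⁻¹) :
    ∃ C, ∀ a, 1 < ‖a‖ → ‖a‖ < (p : ℝ) ^ (b / p / 3) →
      normPairing π (-κ₁) (-κ₂) a = C * airyE π κ₁ κ₂ a ∧
      normPairing π κ₁ κ₂ a = (-1) ^ ((p + 1) / 2) * C * (airyE π κ₁ κ₂ a)⁻¹ := by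
  have n1 := norm_kappa hp5 h1
  obtain ⟨C, hC⟩ := exists_normPairing_eq hp5 hπ hb₁ hb₂ h1 h2 h
  have hsq : ((-1 : ℂ_[p]) ^ ((p + 1) / 2)) * (-1) ^ ((p + 1) / 2) = 1 := by
    rw [← mul_pow]; simp
  refine ⟨(-1) ^ ((p + 1) / 2) * C, fun a ha1 ha => ?_⟩
  have hE := airyE_mul_airyE_neg hp5 hπ hb₂ n1 h ha
  have hE0 := left_ne_zero_of_mul_eq_one hE
  have hC1 := hC a ha1 ha
  have hC2 := hC (-a) (by rwa [norm_neg]) (by rwa [norm_neg])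
  rw [normPairing_neg hp5, airyE_neg_arg hp5] at hC2
  constructor
  · rw [← hC2]
    linear_combination -(normPairing π (-κ₁) (-κ₂) a) * (hE + airyE π κ₁ κ₂ a *
      airyE π (-κ₁) (-κ₂) a * hsq)
  · rw [← mul_assoc, hsq, one_mul, ← hC1, mul_inv_cancel_right₀ hE0]

end ConnectionMatrix


section ConnectionConstant

variable {p : ℕ} [hp : Fact p.Prime] {π : ℂ_[p]} {b : ℝ}

theorem connection_offDiag_eq_zero (hp5 : 5 ≤ p) (hp3 : p % 3 = 1)
    (hπ : π ^ (p - 1) = -(p : ℂ_[p])) (hb₁ : 1 / ((p : ℝ) - 1) < b) (hb₂ : b < ((p : ℝ) - 1) / p)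
    {κ z : ℂ_[p]} (hκ2 : κ ^ 2 = -4 / 27) (hz1 : 1 < ‖z‖) (hz : ‖z‖ < (p : ℝ) ^ (b / p / 3))
    (e e' : ℂ_[p] → ℂ_[p]) :
    connection κ π e e' z 0 1 = 0 ∧ connection κ π e e' z 1 0 = 0 := by
  have hodd := hp.out.odd_of_ne_two (by omega)
  have hκ2' : (-κ) ^ 2 = -4 / 27 := by rw [neg_sq, hκ2]
  have hr := norm_kappa_pow_sub_le hp5 hκ2
  have hr' := norm_kappa_pow_sub_le hp5 hκ2'
  rw [if_pos hp3, one_mul, sub_eq_add_neg] at hr hr'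
  have h1 := normPairing_eq_zero hp5 hπ hb₁ hb₂ hκ2 hκ2 hr hz1 hz
  have h2 := normPairing_eq_zero hp5 hπ hb₁ hb₂ hκ2' hκ2' hr' hz1 hz
  simp [connection, h1, h2]

theorem connection_diag_eq_zero (hp5 : 5 ≤ p) (hp3 : p % 3 = 2)
    (hπ : π ^ (p - 1) = -(p : ℂ_[p])) (hb₁ : 1 / ((p : ℝ) - 1) < b) (hb₂ : b < ((p : ℝ) - 1) / p)
    {κ z : ℂ_[p]} (hκ2 : κ ^ 2 = -4 / 27) (hz1 : 1 < ‖z‖) (hz : ‖z‖ < (p : ℝ) ^ (b / p / 3))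
    (e e' : ℂ_[p] → ℂ_[p]) :
    connection κ π e e' z 0 0 = 0 ∧ connection κ π e e' z 1 1 = 0 := by
  have hκ2' : (-κ) ^ 2 = -4 / 27 := by rw [neg_sq, hκ2]
  have hr := norm_kappa_pow_sub_le hp5 hκ2
  have hr' := norm_kappa_pow_sub_le hp5 hκ2'
  rw [if_neg (by omega), neg_one_mul, sub_eq_add_neg] at hr hr'
  rw [neg_neg] at hr'
  have h1 := normPairing_eq_zero hp5 hπ hb₁ hb₂ hκ2 hκ2' hr hz1 hz
  have h2 := normPairing_eq_zero hp5 hπ hb₁ hb₂ hκ2' hκ2 hr' hz1 hz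
  simp [connection, h1, h2]

/-- For compatible branches and `p ≡ 1 mod 3`, the exponential factors cancel. The square of the
diagonal entry comes from `det 𝔄 = p`. -/
theorem exists_connection_eq_diagonal (hp5 : 5 ≤ p) (hp3 : p % 3 = 1)
    (hπ : π ^ (p - 1) = -(p : ℂ_[p])) (hb₁ : 1 / ((p : ℝ) - 1) < b) (hb₂ : b < ((p : ℝ) - 1) / p)
    {κ : ℂ_[p]} (hκ2 : κ ^ 2 = -4 / 27) :
    ∃ μ : ℂ_[p], μ ^ 2 = -(-1) ^ ((p + 1) / 2) * p ∧ ∀ z : ℂ_[p], 1 < ‖z‖ →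
      ‖z‖ < (p : ℝ) ^ (b / p / 3) → ∀ e e' : ℂ_[p] → ℂ_[p], e z ≠ 0 → e' z ≠ 0 →
      e z * (e' z)⁻¹ = airyE π κ (-κ) z →
      connection κ π e e' z = !![μ, 0; 0, -(-1) ^ ((p + 1) / 2) * μ] := by
  have hκ := norm_kappa hp5 hκ2
  have hκ0 : κ ≠ 0 := norm_ne_zero_iff.1 (by rw [hκ]; exact one_ne_zero)
  have hκ2' : (-κ) ^ 2 = -4 / 27 := by rw [neg_sq, hκ2]
  have hr := norm_kappa_pow_sub_le hp5 hκ2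
  rw [if_pos hp3, one_mul, sub_eq_add_neg] at hr
  obtain ⟨C, hC⟩ := exists_normPairing_mul_eq hp5 hπ hb₁ hb₂ hκ2 hκ2' hr
  simp only [neg_neg] at hC
  refine ⟨(-3 * κ)⁻¹ * C, ?_, fun z hz1 hz e e' he he' hc => ?_⟩
  · obtain ⟨a, ha1, ha⟩ := exists_mem_annulus (p := p) (pos_of_one_div_lt p hb₁)
    have hE0 := left_ne_zero_of_mul_eq_one (airyE_mul_airyE_neg hp5 hπ hb₂ hκ hr ha)
    have hd := normPairing_det hp5 hπ hb₁ hb₂ hκ ha1 ha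
    have hr' := norm_kappa_pow_sub_le hp5 hκ2'
    rw [if_pos hp3, one_mul, sub_eq_add_neg] at hr'
    rw [(hC a ha1 ha).1, (hC a ha1 ha).2, normPairing_eq_zero hp5 hπ hb₁ hb₂ hκ2 hκ2 hr ha1 ha,
      mul_zero, zero_sub] at hd
    have hε : ((-1 : ℂ_[p]) ^ ((p + 1) / 2)) * (-1) ^ ((p + 1) / 2) = 1 := by
      rw [← mul_pow]; simp
    generalize (-1 : ℂ_[p]) ^ ((p + 1) / 2) = ε at *
    field_simp at hd ⊢
    linear_combination -ε * hd - C ^ 2 * hε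
  · have h0 := connection_offDiag_eq_zero hp5 hp3 hπ hb₁ hb₂ hκ2 hz1 hz e e'
    rw [Matrix.eta_fin_two (connection κ π e e' z), h0.1, h0.2]
    have h1 := hC z hz1 hz
    rw [← hc] at h1
    congr! 3
    · simp only [connection, Matrix.of_apply, Matrix.cons_val_zero, Matrix.cons_val', h1.1,
        Matrix.cons_val_fin_one]
      field_simp
    · simp only [connection, Matrix.of_apply, Matrix.cons_val_one, Matrix.cons_val', h1.2,
        Matrix.cons_val_fin_one]
      field_simp

/-- For compatible branches and `p ≡ 2 mod 3`, the exponential factors cancel in the antidiagonal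
entries. -/
theorem exists_connection_eq_antidiagonal (hp5 : 5 ≤ p) (hp3 : p % 3 = 2)
    (hπ : π ^ (p - 1) = -(p : ℂ_[p])) (hb₁ : 1 / ((p : ℝ) - 1) < b) (hb₂ : b < ((p : ℝ) - 1) / p)
    {κ : ℂ_[p]} (hκ2 : κ ^ 2 = -4 / 27) :
    ∃ μ : ℂ_[p], μ ^ 2 = (-1) ^ ((p + 1) / 2) * p ∧ ∀ z : ℂ_[p], 1 < ‖z‖ →
      ‖z‖ < (p : ℝ) ^ (b / p / 3) → ∀ e e' : ℂ_[p] → ℂ_[p], e z ≠ 0 → e' z ≠ 0 →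
      e z * e' z = airyE π κ κ z →
      connection κ π e e' z = !![0, μ; -(-1) ^ ((p + 1) / 2) * μ, 0] := by
  have hκ := norm_kappa hp5 hκ2
  have hκ0 : κ ≠ 0 := norm_ne_zero_iff.1 (by rw [hκ]; exact one_ne_zero)
  have hκ2' : (-κ) ^ 2 = -4 / 27 := by rw [neg_sq, hκ2]
  have hr := norm_kappa_pow_sub_le hp5 hκ2
  rw [if_neg (by omega), neg_one_mul, sub_eq_add_neg] at hr
  have hrn := hr
  rw [neg_neg] at hr
  obtain ⟨C, hC⟩ := exists_normPairing_mul_eq hp5 hπ hb₁ hb₂ hκ2 hκ2 hr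
  refine ⟨(-3 * κ)⁻¹ * C, ?_, fun z hz1 hz e e' he he' hc => ?_⟩
  · obtain ⟨a, ha1, ha⟩ := exists_mem_annulus (p := p) (pos_of_one_div_lt p hb₁)
    have hE0 := left_ne_zero_of_mul_eq_one (airyE_mul_airyE_neg hp5 hπ hb₂ hκ hr ha)
    have hd := normPairing_det hp5 hπ hb₁ hb₂ hκ ha1 ha
    rw [(hC a ha1 ha).1, (hC a ha1 ha).2, normPairing_eq_zero hp5 hπ hb₁ hb₂ hκ2 hκ2' hrn ha1 ha,
      mul_zero, sub_zero] at hd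
    have hε : ((-1 : ℂ_[p]) ^ ((p + 1) / 2)) * (-1) ^ ((p + 1) / 2) = 1 := by
      rw [← mul_pow]; simp
    generalize (-1 : ℂ_[p]) ^ ((p + 1) / 2) = ε at *
    field_simp at hd ⊢
    linear_combination ε * hd - C ^ 2 * hε
  · have h0 := connection_diag_eq_zero hp5 hp3 hπ hb₁ hb₂ hκ2 hz1 hz e e'
    rw [Matrix.eta_fin_two (connection κ π e e' z), h0.1, h0.2]
    have h1 := hC z hz1 hz
    rw [← hc] at h1
    congr! 3
    · simp only [connection, Matrix.of_apply, Matrix.cons_val_zero, Matrix.cons_val', h1.1,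
        Matrix.cons_val_fin_one, Matrix.cons_val_one]
      field_simp
    · simp only [connection, Matrix.of_apply, Matrix.cons_val_one, Matrix.cons_val', h1.2,
        Matrix.cons_val_fin_one, Matrix.cons_val_zero]
      field_simp

end ConnectionConstant

end Airy

theorem mainTheorem9 (p : ℕ) [Fact p.Prime] (hp : 5 ≤ p)
    (π : ℂ_[p]) (hπ : π ^ (p - 1) = -(p : ℂ_[p]))
    (i : ℂ_[p]) (hi : i ^ 2 = -1) (r : ℂ_[p]) (hr : r ^ 2 = 3)
    (κ : ℂ_[p]) (hκ : κ = 2 * i / (3 * r))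
    (g : ℂ_[p]) (hg : g = -Airy.gaussSum p π 2 (((p : ℤ) ^ 2 - 1) / 3))
    (b : ℝ) (hb₁ : 1 / ((p : ℝ) - 1) < b) (hb₂ : b < ((p : ℝ) - 1) / p) :
    (∀ a : ℂ_[p], ‖a‖ < (p : ℝ) ^ (2 * (b / p) / 3) →
      Airy.IsDualFrobeniusMatrix p π b a (Airy.frobMatrix p π a)) ∧
    (∀ z : ℂ_[p], 1 < ‖z‖ → ‖z‖ < (p : ℝ) ^ (b / p / 3) →
      ∀ s e e' : ℂ_[p] → ℂ_[p], Airy.IsBranchData p κ π z s e e' →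
        Airy.IsFundamentalSolutionAt p π z (Airy.airyY p κ π s e) ∧
        ∃ M : Matrix (Fin 2) (Fin 2) ℂ_[p],
          IsUnit M ∧
          (∀ N, Airy.FrobRelation p κ π z s e e' N ↔ N = M) ∧
          ((p % 12 = 1 ∨ p % 12 = 7) → M 0 1 = 0 ∧ M 1 0 = 0) ∧
          ((p % 12 = 5 ∨ p % 12 = 11) → M 0 0 = 0 ∧ M 1 1 = 0)) ∧
    ∃ μ : ℂ_[p], ∃ M : Matrix (Fin 2) (Fin 2) ℂ_[p],
      (p % 12 = 1 → μ ^ 2 = p ∧ M = !![μ, 0; 0, μ]) ∧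
      (p % 12 = 7 → μ ^ 2 = -p ∧ M = !![μ, 0; 0, -μ]) ∧
      (p % 12 = 5 → μ ^ 2 = -g ∧ M = !![0, μ; μ, 0]) ∧
      (p % 12 = 11 → μ ^ 2 = g ∧ M = !![0, μ; -μ, 0]) ∧
      ∀ z : ℂ_[p], 1 < ‖z‖ → ‖z‖ < (p : ℝ) ^ (b / p / 3) →
        ∀ s e e' : ℂ_[p] → ℂ_[p], Airy.IsBranchData p κ π z s e e' →
          Airy.IsCompatible p κ π z e e' →
          ∀ N, Airy.FrobRelation p κ π z s e e' N ↔ N = M := by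
  have hκ2 : κ ^ 2 = -4 / 27 := by
    rw [hκ, div_pow, mul_pow, mul_pow, hi, hr]
    norm_num
  have hb₀ := Airy.pos_of_one_div_lt p hb₁
  have hp1 : (1 : ℝ) ≤ p := by exact_mod_cast (by omega : 1 ≤ p)
  have hprime : Fact p.Prime := inferInstance
  have hodd := Nat.odd_iff.1 (hprime.out.odd_of_ne_two (by omega))
  have hp3 : p % 3 ≠ 0 := fun h => by
    have := (Nat.prime_dvd_prime_iff_eq Nat.prime_three hprime.out).1 (Nat.dvd_of_mod_eq_zero h)
    omega
  refine ⟨fun a ha => ?_, fun z hz1 hz s e e' h => ⟨?_, ?_⟩, ?_⟩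
  · -- the rates are needed on a closed disc inside the region
    obtain ⟨ρ, h1, h2⟩ := exists_between ha
    obtain ⟨σ, hσ⟩ := Airy.exists_frobRates hb₀ hb₂ ((norm_nonneg _).trans_lt h1) h2
    refine Airy.isDualFrobeniusMatrix_frobMatrix hp hπ hb₀.le (Airy.norm_pi_inv_le hπ hb₁) hσ
      h1.le (ha.le.trans ?_)
    rw [← Real.rpow_mul_natCast (by positivity)]
    refine Real.rpow_le_rpow_of_exponent_le hp1 ?_
    have := div_le_self hb₀.le hp1
    push_cast
    linarith
  · exact Airy.isFundamentalSolutionAt_airyY hp hπ hκ2 hz1 h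
  · have hz0 : z ≠ 0 := fun h => by simp [h] at hz1; linarith
    obtain ⟨-, -, -, he0, -, he0', -⟩ := (h.eventually hπ hz0).self_of_nhds
    exact ⟨Airy.connection κ π e e' z,
      Airy.isUnit_connection hp hπ hb₁ hb₂ hκ2 hz1 hz he0 he0',
      Airy.frobRelation_iff hp hπ hb₁ hb₂ hκ2 hz1 hz h,
      fun h12 => Airy.connection_offDiag_eq_zero hp (by omega) hπ hb₁ hb₂ hκ2 hz1 hz e e',
      fun h12 => Airy.connection_diag_eq_zero hp (by omega) hπ hb₁ hb₂ hκ2 hz1 hz e e'⟩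
  · rcases (by omega : p % 3 = 1 ∨ p % 3 = 2) with h3 | h3
    · obtain ⟨μ, hμ, hM⟩ := Airy.exists_connection_eq_diagonal hp h3 hπ hb₁ hb₂ hκ2
      refine ⟨μ, !![μ, 0; 0, -(-1) ^ ((p + 1) / 2) * μ], fun h12 => ?_, fun h12 => ?_,
        fun h12 => by omega, fun h12 => by omega, fun z hz1 hz s e e' h hc N => ?_⟩
      · have he : Odd ((p + 1) / 2) := by rw [Nat.odd_iff]; omega
        rw [he.neg_one_pow] at hμ ⊢
        simpa using hμ
      · have he : Even ((p + 1) / 2) := by rw [Nat.even_iff]; omega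
        rw [he.neg_one_pow] at hμ ⊢
        simpa using hμ
      · have hz0 : z ≠ 0 := fun h => by simp [h] at hz1; linarith
        obtain ⟨-, -, -, he0, -, he0', -⟩ := (h.eventually hπ hz0).self_of_nhds
        rw [← hM z hz1 hz e e' he0 he0' ((hc.1 (by omega)).self_of_nhds.trans
          (by rw [Airy.airyE, ← sub_eq_add_neg]))]
        exact Airy.frobRelation_iff hp hπ hb₁ hb₂ hκ2 hz1 hz h N
    · have hgp : g = p := by rw [hg, Airy.gaussSum_cubic hp h3 hπ, neg_neg]
      obtain ⟨μ, hμ, hM⟩ := Airy.exists_connection_eq_antidiagonal hp h3 hπ hb₁ hb₂ hκ2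
      refine ⟨μ, !![0, μ; -(-1) ^ ((p + 1) / 2) * μ, 0], fun h12 => by omega, fun h12 => by omega,
        fun h12 => ?_, fun h12 => ?_, fun z hz1 hz s e e' h hc N => ?_⟩
      · have he : Odd ((p + 1) / 2) := by rw [Nat.odd_iff]; omega
        rw [he.neg_one_pow] at hμ ⊢
        rw [hgp]
        simpa using hμ
      · have he : Even ((p + 1) / 2) := by rw [Nat.even_iff]; omega
        rw [he.neg_one_pow] at hμ ⊢
        rw [hgp]
        simpa using hμ
      · have hz0 : z ≠ 0 := fun h => by simp [h] at hz1; linarith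
        obtain ⟨-, -, -, he0, -, he0', -⟩ := (h.eventually hπ hz0).self_of_nhds
        rw [← hM z hz1 hz e e' he0 he0' (hc.2 (by omega)).self_of_nhds]
        exact Airy.frobRelation_iff hp hπ hb₁ hb₂ hκ2 hz1 hz h N
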